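/- **Setting: the group.** Let $B_3\subset\mathbb Z^3$ be the set of integer vectors of squared length $1$ (short roots) or $2$ (long roots). For a field $\mathbb E$, let $G(\mathbb E)$ be the Chevalley group given by generators $x_\zeta(t)$ ($\zeta\in B_3$, $t\in\mathbb E$) and the Steinberg relations - $x_\zeta(t)x_\zeta(u)=x_\zeta(t+u)$ (linearity); - $[x_\zeta(t),x_\eta(u)]=\prod_{(a,b)}x_{a\zeta+b\eta}(C^{a,b}_{\zeta,\eta}t^au^b)$ for $\zeta\ne-\eta$ (commutator), where $[g,h]=ghg^{-1}h^{-1}$ and the product is over the pairs $(a,b)=(1,1),(1,2),(2,1)$, in this order, for which $a\zeta+b\eta\in B_3$ (no other $a,b\ge1$ give a root); - $h_\zeta(t)h_\zeta(u)=h_\zeta(tu)$ for $t,u\neq0$ (diagonal), where $h_\zeta(t)=g_\zeta(t)g_\zeta(-1)$ and $g_\zeta(t)=x_\zeta(t)x_{-\zeta}(-t^{-1})x_\zeta(t)$. The Chevalley structure constants are: with $\lambda(v)=\operatorname{sgn}(3v_0+2v_1+v_2)$, one has $C^{1,1}_{\zeta,\eta}=\lambda(\zeta)\lambda(\eta)\lambda(\zeta+\eta)(-1)^{\zeta_1\eta_0+\zeta_2\eta_0+\zeta_2\eta_1}\varepsilon$,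 where $\varepsilon=-2$ if $\zeta,\eta$ are both short and $\varepsilon=1$ otherwise; $C^{1,2}_{\zeta,\eta}=\lambda(\zeta)\lambda(\zeta+2\eta)$; and $C^{2,1}_{\zeta,\eta}=-\lambda(\eta)\lambda(2\zeta+\eta)$. **Setting: the unipotent groups.** Let $\alpha=(1,-1,0)$, $\beta=(0,1,-1)$, $\psi=(0,0,1)$, $\omega=(-1,0,0)$. The small link has $I=\{\beta,\psi,\omega\}$ and the large link has $I=\{\alpha,\beta,\psi\}$. Let $I^+$ be the set of roots that are nonnegative integer combinations of elements of $I$; the height $\mathrm{ht}(\zeta)$ of $\zeta\in I^+$ is the sum of its coefficients. Let $J\subseteq I^+$ be the set of roots that are nonnegative integer combinations of two elements of $I$. Let $q=p^k$, let $m\ge6$, let $\mathbb F_{q^m}=\mathbb F_q(x)$ with $x$ of degree $m$ over $\mathbb F_q$, and let $\mathbb F_q[x]_{\le1}=\{s+tx:s,t\in\mathbb F_q\}$. Let $U(\mathbb F_q[x]_{\le1})\le G(\mathbb F_{q^m})$ be the subgroup generated by the $x_\zeta(f)$ with $\zeta\in I$ and $f\in\mathbb F_q[x]_{\le1}$. Its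 three designated subgroups are $H_\eta$ ($\eta\in I$), generated by the $x_\zeta(f)$ with $\zeta\in I\setminus\{\eta\}$ and $f\in\mathbb F_q[x]_{\le1}$. Write $U^{sm}_{B_3}$, $U^{lg}_{B_3}$ in the two cases. The base group $U(\mathbb F_p)\le G(\mathbb F_p)$ is generated by the $x_\zeta(t)$ with $\zeta\in I$, $t\in\mathbb F_p$. **Words and derivations.** A word is a finite sequence of group elements. The formal inverse of a word is obtained by reversing it and inverting each letter. Write $v\sim u$ if $v$ is a cyclic shift of $u$ or of $u^{-1}$. An equation $y=z$ is identified with the word $yz^{-1}$. Given a set of relators (words), one step leads from $w$ to $w'$ if there are words $a,u,b,v$ and a relator $r$ with $w\sim aub$, $w'\sim avb$ and $r\sim uv^{-1}$. A word $w$ is derived in at most $N$ steps if at most $N$ steps reduce it to the one-letter word $1$. **Allowed relators of length $\le M$.** - (i) In-subgroup relations: words of length $\le M$ with product $1$, all of whose letters lie in one of the designated subgroups $H_\eta$. - (ii) Lifts of base relations: take a word of length $\le M$ in symbols $x_\zeta(u)$ with $\zeta\in J$ and $u\in\mathbb F_p$ whose product is $1$ in $G(\mathbb F_p)$. Choose any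 $t_{\eta,0},t_{\eta,1}\in\mathbb F_q$ ($\eta\in I$), and replace each letter $x_\zeta(u)$, $\zeta=\sum_{\eta\in I}c_\eta\eta$, by the letter $x_\zeta\bigl(u\prod_{\eta\in I}(t_{\eta,1}x+t_{\eta,0})^{c_\eta}\bigr)$. **Pure-degree symbols and relations.** For $\zeta\in I^+$, $t\in\mathbb F_q$ and $0\le i\le\mathrm{ht}(\zeta)$, the symbol $\{\zeta;t;i\}$ is the one-letter word $x_\zeta(tx^i)$ if $\zeta\in J$. If $\zeta\notin J$, it is the following fixed alias, a word with product $x_\zeta(tx^i)$; here $\min$ denotes the minimum, $[\cdot,\cdot]$ the four-letter commutator word, and an inverse letter is the inverse group element. - Small link: $\{\beta+\psi+\omega;t;i\}=[\{\beta;t;i_1\},\{\psi+\omega;1;i-i_1\}]$ with $i_1=\min(i,1)$. - Large link: - with $i_1=\min(i,1)$ and $i_2=i-i_1$, $\{\alpha+\beta+\psi;t;i\}=\{\beta+\psi;-\tfrac12;i_2\}\{\alpha;t;i_1\}\{\beta+\psi;1;i_2\}\{\alpha;-t;i_1\}\{\beta+\psi;-\tfrac12;i_2\}$; - with $i_1=\min(i,1)$,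 $\{\alpha+\beta+2\psi;t;i\}=[\{\alpha;t;i_1\},\{\beta+2\psi;1;i-i_1\}]$; - with $i_1=\min(i,2)$, $\{\alpha+2\beta+2\psi;t;i\}=[\{\alpha+\beta;t;i_1\},\{\beta+2\psi;-1;i-i_1\}]$. The pure-degree Steinberg relations in $U(\mathbb F_q[x]_{\le1})$ are the following, for all $\zeta,\eta\in I^+$ (including $\zeta=\eta$), $t,u\in\mathbb F_q$, $0\le i\le\mathrm{ht}(\zeta)$ and $0\le j\le\mathrm{ht}(\eta)$, with aliases expanded: $$\{\zeta;t;i\}\{\zeta;u;i\}=\{\zeta;t+u;i\},$$ $$[\{\zeta;t;i\},\{\eta;u;j\}]=\prod_{(a,b)}\{a\zeta+b\eta;\,C^{a,b}_{\zeta,\eta}t^au^b;\,ai+bj\}.$$ The product is over the same pairs, in the same order, as in the commutator relation above. **Theorem (strong lifting theorem for $B_3$ links).** There exist $N,M\in\mathbb N$ such that for every odd prime power $p$ (in particular every odd prime), every $k\ge1$, and all $m$ and $x$ as above with $q=p^k$: 1. every pure-degree Steinberg relation in $U^{sm}_{B_3}(\mathbb F_{p^k}[x]_{\le1})$ can be derived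 in at most $N$ steps from in-subgroup relations of length $\le M$ and lifts of relations of length $\le M$ in $U^{sm}_{B_3}(\mathbb F_p)$; 2. every pure-degree Steinberg relation in $U^{lg}_{B_3}(\mathbb F_{p^k}[x]_{\le1})$ can be derived in at most $N$ steps from in-subgroup relations of length $\le M$ and lifts of relations of length $\le M$ in $U^{lg}_{B_3}(\mathbb F_p)$. -/

import Mathlib

namespace B3Lift

/-! ## The root system of type B_3 and its structure constants -/

/-- Integer vectors in three-space. -/
abbrev Vec : Type := Fin 3 → ℤ

/-- The squared Euclidean length. -/
def sqLen (v : Vec) : ℤ := v 0 ^ 2 + v 1 ^ 2 + v 2 ^ 2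

/-- The roots of `B_3`: integer vectors of squared length 1 (short) or 2 (long). -/
def IsRoot (v : Vec) : Prop := sqLen v = 1 ∨ sqLen v = 2

instance (v : Vec) : Decidable (IsRoot v) := inferInstanceAs (Decidable (_ ∨ _))

/-- Sign of a root for the positive system of the linear form `3 v₀ + 2 v₁ + v₂`. -/
def lam (v : Vec) : ℤ := Int.sign (3 * v 0 + 2 * v 1 + v 2)

/-- The bimultiplicative sign `(-1)^(v₁ w₀ + v₂ w₀ + v₂ w₁)`. -/
def sgm (v w : Vec) : ℤ := if Even (v 1 * w 0 + v 2 * w 0 + v 2 * w 1) then 1 else -1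

/-- The pairs `(a, b)` for which `a ζ + b η` can be a root of `B_3` with `a, b ≥ 1`, `ζ ≠ -η`. -/
def pairs : List (ℕ × ℕ) := [(1, 1), (1, 2), (2, 1)]

/-- The Chevalley structure constant of `x_{aζ+bη}` in the commutator of `x_ζ` and `x_η`. -/
def chevC (a b : ℕ) (v w : Vec) : ℤ :=
  if a = 1 ∧ b = 1 then
    lam v * lam w * lam (v + w) * sgm v w * (if sqLen v = 1 ∧ sqLen w = 1 then -2 else 1)
  else if a = 1 ∧ b = 2 then lam v * lam (v + 2 • w)
  else if a = 2 ∧ b = 1 then -(lam w * lam (2 • v + w))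
  else 0

/-- No other pair of positive coefficients occurs, so `pairs` misses no commutator term. -/
theorem mem_pairs_of_isRoot {v w : Vec} (hv : IsRoot v) (hw : IsRoot w) (hne : v ≠ -w)
    {a b : ℕ} (ha : 1 ≤ a) (hb : 1 ≤ b) (hr : IsRoot ((a : ℤ) • v + (b : ℤ) • w)) :
    (a, b) ∈ pairs := by
  have hpos : 1 ≤ sqLen (v + w) := by
    by_contra hlt
    apply hne
    simp only [sqLen, Pi.add_apply] at hlt
    have h0 : v 0 + w 0 = 0 := by nlinarith [sq_nonneg (v 1 + w 1), sq_nonneg (v 2 + w 2)]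
    have h1 : v 1 + w 1 = 0 := by nlinarith [sq_nonneg (v 0 + w 0), sq_nonneg (v 2 + w 2)]
    have h2 : v 2 + w 2 = 0 := by nlinarith [sq_nonneg (v 1 + w 1), sq_nonneg (v 0 + w 0)]
    funext i
    fin_cases i <;> simp <;> omega
  obtain ⟨k, hk⟩ : ∃ k : ℤ, k = v 0 * w 0 + v 1 * w 1 + v 2 * w 2 := ⟨_, rfl⟩
  have e1 : sqLen (v + w) = sqLen v + 2 * k + sqLen w := by
    simp only [sqLen, Pi.add_apply, hk]; ring
  have e2 : sqLen ((a : ℤ) • v + (b : ℤ) • w) =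
      a ^ 2 * sqLen v + 2 * (a * b * k) + b ^ 2 * sqLen w := by
    simp only [sqLen, Pi.add_apply, Pi.smul_apply, smul_eq_mul, hk]; ring
  have hle : sqLen ((a : ℤ) • v + (b : ℤ) • w) ≤ 2 := by rcases hr with h | h <;> omega
  have ha' : (1 : ℤ) ≤ a := by exact_mod_cast ha
  have hb' : (1 : ℤ) ≤ b := by exact_mod_cast hb
  have hab : (0 : ℤ) ≤ a * b := by positivity
  have hbd : a ≤ 2 ∧ b ≤ 2 ∧ ¬ (a = 2 ∧ b = 2) := by
    zify
    rw [e2] at hle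
    rw [e1] at hpos
    rcases hv with hv | hv <;> rcases hw with hw | hw <;> rw [hv, hw] at hle hpos
    · have : 0 ≤ k := by omega
      have := mul_nonneg hab this
      refine ⟨by nlinarith, by nlinarith, ?_⟩
      rintro ⟨h1, h2⟩
      rw [h1, h2] at hle
      omega
    · have : 0 ≤ k + 1 := by omega
      have := mul_nonneg hab this
      refine ⟨?_, ?_, ?_⟩
      · have : (b : ℤ) ≤ 1 := by nlinarith [sq_nonneg ((a : ℤ) - b)]
        have : (b : ℤ) = 1 := by omega
        rw [this] at hle
        nlinarith
      · nlinarith [sq_nonneg ((a : ℤ) - b)]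
      · rintro ⟨h1, h2⟩
        rw [h1, h2] at hle
        omega
    · have : 0 ≤ k + 1 := by omega
      have := mul_nonneg hab this
      refine ⟨?_, ?_, ?_⟩
      · nlinarith [sq_nonneg ((a : ℤ) - b)]
      · have : (a : ℤ) ≤ 1 := by nlinarith [sq_nonneg ((a : ℤ) - b)]
        have : (a : ℤ) = 1 := by omega
        rw [this] at hle
        nlinarith
      · rintro ⟨h1, h2⟩
        rw [h1, h2] at hle
        omega
    · have : 0 ≤ k + 1 := by omega
      have := mul_nonneg hab this
      refine ⟨by nlinarith [sq_nonneg ((a : ℤ) - 2 * b), sq_nonneg ((a : ℤ) - b)],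
        by nlinarith [sq_nonneg (2 * (a : ℤ) - b), sq_nonneg ((a : ℤ) - b)], ?_⟩
      rintro ⟨h1, h2⟩
      rw [h1, h2] at hle
      omega
  obtain ⟨h1, h2, h3⟩ := hbd
  interval_cases a <;> interval_cases b <;> simp [pairs] at h3 ⊢

/-! ## The Chevalley group by its Steinberg presentation -/

section Chevalley

variable (R : Type*) [Field R]

/-- The symbols `x_v(t)`, `v` a root and `t ∈ R`. -/
abbrev RootSym : Type _ := {v : Vec // IsRoot v} × R

variable {R}

/-- The symbol `x_v(t)` in the free group (trivial when `v` is not a root). -/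
def fx (v : Vec) (t : R) : FreeGroup (RootSym R) :=
  if h : IsRoot v then FreeGroup.of (⟨v, h⟩, t) else 1

/-- The free-group word of `g_v(t) = x_v(t) x_{-v}(-t⁻¹) x_v(t)`. -/
def fg (v : Vec) (t : R) : FreeGroup (RootSym R) := fx v t * fx (-v) (-t⁻¹) * fx v t

/-- The free-group word of `h_v(t) = g_v(t) g_v(-1)`. -/
def fh (v : Vec) (t : R) : FreeGroup (RootSym R) := fg v t * fg v (-1)

variable (R)

/-- Linearity, commutator and diagonal relators. -/
inductive IsChevRel : FreeGroup (RootSym R) → Prop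
  | linear (v : Vec) (hv : IsRoot v) (t u : R) :
      IsChevRel (fx v t * fx v u * (fx v (t + u))⁻¹)
  | comm (v w : Vec) (hv : IsRoot v) (hw : IsRoot w) (hne : v ≠ -w) (t u : R) :
      IsChevRel (fx v t * fx w u * (fx v t)⁻¹ * (fx w u)⁻¹ * ((pairs.map fun ab =>
        fx (ab.1 • v + ab.2 • w) ((chevC ab.1 ab.2 v w : R) * (t ^ ab.1 * u ^ ab.2))).prod)⁻¹)
  | diag (v : Vec) (hv : IsRoot v) (t u : R) (ht : t ≠ 0) (hu : u ≠ 0) :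
      IsChevRel (fh v t * fh v u * (fh v (t * u))⁻¹)

/-- The Chevalley group `G_{B_3}(R)` over the field `R`. -/
abbrev Chev : Type _ := PresentedGroup {r : FreeGroup (RootSym R) | IsChevRel R r}

variable {R}

/-- The root element `x_v(t)` of the Chevalley group. -/
def xr (v : Vec) (t : R) : Chev R := PresentedGroup.mk _ (fx v t)

/-- The subgroup generated by the `x_v(t)` with `v ∈ I` and `t ∈ L`. -/
def unip (I : Set Vec) (L : Set R) : Subgroup (Chev R) :=
  Subgroup.closure {g | ∃ v ∈ I, ∃ t ∈ L, g = xr v t}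

end Chevalley

/-! ## Words and derivations -/

section Words

variable {G : Type*} [Group G]

/-- The formal inverse of a word: reverse it and invert every letter. -/
def winv (w : List G) : List G := (w.map fun g => g⁻¹).reverse

/-- `v ∼ u`: `v` is a cyclic shift of `u` or of the inverse of `u`. -/
def WEquiv (v u : List G) : Prop := v.IsRotated u ∨ v.IsRotated (winv u)

/-- One step from `w` to `w'` by a relator of `Rel`. -/
def Step (Rel : Set (List G)) (w w' : List G) : Prop :=
  ∃ a u b v : List G, ∃ r ∈ Rel,
    WEquiv w (a ++ u ++ b) ∧ WEquiv w' (a ++ v ++ b) ∧ WEquiv r (u ++ winv v)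

/-- `w` can be reduced to the one-letter word `1` in at most `N` steps. -/
def DerivableWithin (Rel : Set (List G)) (N : ℕ) (w : List G) : Prop :=
  ∃ n ≤ N, ∃ f : ℕ → List G, f 0 = w ∧ f n = [1] ∧ ∀ i < n, Step Rel (f i) (f (i + 1))

/-- The commutator word `a b a⁻¹ b⁻¹` in two letters. -/
def commWord (a b : G) : List G := [a, b, a⁻¹, b⁻¹]

end Words

/-! ## Unipotent groups over polynomials of degree at most one -/

/-- Base of the large link: `α, β, ψ`. -/
def baseLg : Fin 3 → Vec := ![![1, -1, 0], ![0, 1, -1], ![0, 0, 1]]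

/-- Base of the small link: `β, ψ, ω`. -/
def baseSm : Fin 3 → Vec := ![![0, 1, -1], ![0, 0, 1], ![-1, 0, 0]]

/-- The vector with coefficients `c` in the base `b`. The roots of `I⁺` are the vectors of this
form that are roots, and `c` is their (unique) coefficient vector. -/
def comb (b : Fin 3 → Vec) (c : Fin 3 → ℕ) : Vec := ∑ i, c i • b i

/-- The height of the root with coefficients `c`. -/
def ht (c : Fin 3 → ℕ) : ℕ := ∑ i, c i

/-- Coefficient vectors supported on at most two elements of the base. -/
def Present (c : Fin 3 → ℕ) : Prop := ∃ j, c j = 0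

instance (c : Fin 3 → ℕ) : Decidable (Present c) := inferInstanceAs (Decidable (∃ j, c j = 0))

section Links

variable (F : Type*) {K E : Type*} [Field F] [Field K] [Field E] [Algebra F K] [Algebra K E]

/-- The polynomials of degree at most one in `x`. -/
def degLeOne (K : Type*) {E : Type*} [Field K] [Field E] [Algebra K E] (x : E) : Set E :=
  {y | ∃ s t : K, y = algebraMap K E s + algebraMap K E t * x}

/-- The designated subgroup obtained by omitting the base element of index `j`. -/
def sub (K : Type*) {E : Type*} [Field K] [Field E] [Algebra K E]
    (b : Fin 3 → Vec) (x : E) (j : Fin 3) : Subgroup (Chev E) :=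
  unip {v | ∃ i, i ≠ j ∧ v = b i} (degLeOne K x)

/-- The pure-degree element `x_ζ(t x^i)`, where `ζ` has coefficients `c`. -/
def pd (b : Fin 3 → Vec) (x : E) (c : Fin 3 → ℕ) (t : K) (i : ℕ) : Chev E :=
  xr (comb b c) (algebraMap K E t * x ^ i)

/-- In-subgroup relators of length at most `M`. -/
def inSubgroupRel (K : Type*) {E : Type*} [Field K] [Field E] [Algebra K E]
    (b : Fin 3 → Vec) (x : E) (M : ℕ) : Set (List (Chev E)) :=
  {w | w.length ≤ M ∧ (∃ j, ∀ g ∈ w, g ∈ sub K b x j) ∧ w.prod = 1}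

/-- The letter obtained from `x_ζ(u)`, `u ∈ F`, by the lift with parameters `t0`, `t1`. -/
def liftLetter {F : Type*} [Field F] [Algebra F K]
    (b : Fin 3 → Vec) (x : E) (t0 t1 : Fin 3 → K) (s : (Fin 3 → ℕ) × F) : Chev E :=
  xr (comb b s.1) (algebraMap K E (algebraMap F K s.2) *
    ∏ i, (algebraMap K E (t1 i) * x + algebraMap K E (t0 i)) ^ s.1 i)

/-- Lifts of relations of length at most `M` from the base group over `F`. -/
def liftedRel (F K : Type*) {E : Type*} [Field F] [Field K] [Field E] [Algebra F K] [Algebra K E]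
    (b : Fin 3 → Vec) (x : E) (M : ℕ) : Set (List (Chev E)) :=
  {w | ∃ s : List ((Fin 3 → ℕ) × F), s.length ≤ M ∧
    (∀ q ∈ s, IsRoot (comb b q.1) ∧ Present q.1) ∧
    (s.map fun q => xr (comb b q.1) q.2).prod = 1 ∧
    ∃ t0 t1 : Fin 3 → K, w = s.map (liftLetter b x t0 t1)}

/-- All relators allowed in a derivation. -/
def allowedRel (F K : Type*) {E : Type*} [Field F] [Field K] [Field E] [Algebra F K] [Algebra K E]
    (b : Fin 3 → Vec) (x : E) (M : ℕ) : Set (List (Chev E)) :=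
  inSubgroupRel K b x M ∪ liftedRel F K b x M

/-- Aliases in the large link for `α+β+ψ`, `α+β+2ψ` and `α+2β+2ψ`. -/
def aliasLg (x : E) (c : Fin 3 → ℕ) (t : K) (i : ℕ) : List (Chev E) :=
  if c = ![1, 1, 1] then
    [pd baseLg x ![0, 1, 1] (-(1 / 2) : K) (i - min i 1), pd baseLg x ![1, 0, 0] t (min i 1),
     pd baseLg x ![0, 1, 1] (1 : K) (i - min i 1), pd baseLg x ![1, 0, 0] (-t) (min i 1),
     pd baseLg x ![0, 1, 1] (-(1 / 2) : K) (i - min i 1)]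
  else if c = ![1, 1, 2] then
    commWord (pd baseLg x ![1, 0, 0] t (min i 1)) (pd baseLg x ![0, 1, 2] (1 : K) (i - min i 1))
  else
    commWord (pd baseLg x ![1, 1, 0] t (min i 2)) (pd baseLg x ![0, 1, 2] (-1 : K) (i - min i 2))

/-- Alias in the small link for `β+ψ+ω`. -/
def aliasSm (x : E) (_c : Fin 3 → ℕ) (t : K) (i : ℕ) : List (Chev E) :=
  commWord (pd baseSm x ![1, 0, 0] t (min i 1)) (pd baseSm x ![0, 1, 1] (1 : K) (i - min i 1))

/-- The word of a pure-degree symbol: a single letter for a present root, its alias otherwise. -/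
def symWord (b : Fin 3 → Vec) (al : (Fin 3 → ℕ) → K → ℕ → List (Chev E)) (x : E)
    (c : Fin 3 → ℕ) (t : K) (i : ℕ) : List (Chev E) :=
  if Present c then [pd b x c t i] else al c t i

/-- The word of the product on the right-hand side of a pure-degree commutator relation. -/
def commRhs (b : Fin 3 → Vec) (al : (Fin 3 → ℕ) → K → ℕ → List (Chev E)) (x : E)
    (c d : Fin 3 → ℕ) (t u : K) (i j : ℕ) : List (Chev E) :=
  pairs.flatMap fun ab =>
    if IsRoot (comb b (ab.1 • c + ab.2 • d)) then
      symWord b al x (ab.1 • c + ab.2 • d)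
        ((chevC ab.1 ab.2 (comb b c) (comb b d) : K) * (t ^ ab.1 * u ^ ab.2))
        (ab.1 * i + ab.2 * j)
    else []

/-- The pure-degree Steinberg relations, as words equated to the identity. -/
inductive IsSteinberg (b : Fin 3 → Vec) (al : (Fin 3 → ℕ) → K → ℕ → List (Chev E)) (x : E) :
    List (Chev E) → Prop
  | linear (c : Fin 3 → ℕ) (hc : IsRoot (comb b c)) (t u : K) (i : ℕ) (hi : i ≤ ht c) :
      IsSteinberg b al x
        (symWord b al x c t i ++ symWord b al x c u i ++ winv (symWord b al x c (t + u) i))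
  | comm (c d : Fin 3 → ℕ) (hc : IsRoot (comb b c)) (hd : IsRoot (comb b d)) (t u : K)
      (i j : ℕ) (hi : i ≤ ht c) (hj : j ≤ ht d) :
      IsSteinberg b al x
        (symWord b al x c t i ++ symWord b al x d u j ++ winv (symWord b al x c t i) ++
          winv (symWord b al x d u j) ++ winv (commRhs b al x c d t u i j))

end Links

end B3Lift

/-!
Derivations of bounded length are replaced by identities in one group. Fix an index type `ι` of
fields `F i`, `K i`, `E i` with elements `x i`, and call two families of words (one word for each
`i`) congruent if a single number bounds, for all `i` at once, both the number of rewriting steps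
and the length of the relators used. The classes of words in letters whose free cancellations are
allowed relators lie in the group `RelatorFamily.Grp` of units of the quotient. A pure-degree
relation has derivations of bounded length, uniformly in all fields and scalars, as soon as it
holds in this group for the family of all instances of the relation
(`RelatorFamily.Represents.derivableWithin`); there are only finitely many pairs of roots and
degrees.

In this group the symbols `x_ζ(f)` of the present roots become functions of a polynomial `f` over
the ring `S` of families of scalars. They are additive in `f`, vanish beyond the height of `ζ`
(`DegHom`), and satisfy the Steinberg relations of each rank two subsystem, because those lie in
a designated subgroup (`degHom_rootLetter`, `commutator_rootLetter`). Lifted relations give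
further identities, whose arguments are products of linear polynomials attached to the simple
roots (`prod_lift_eq`). Only the few lifts recorded as fields of `SmallLink` and `LargeLink` are
used. It remains to reconstruct from these data the whole unipotent group over polynomials.

Two devices serve for this. First, a lifted relation concerns a pair of arguments with a common
linear factor, such as `(a b, b c)`, and the pairs for which a biadditive relation holds are
closed under addition in either argument; specializing the linear polynomials to `1`, `X` and
`1 + X` and subtracting separates the monomials, so that the relation holds for all pairs
(`BiClosed`). Where a linear factor occurs squared, as in `(b c ^ 2, b c d)`, scalars have to be
moved between the linear factors as well; this uses that every scalar is a sum of two units and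
that 2 is invertible (`OddScalars`). Second, a commutator of root elements which is biadditive in
its arguments `a`, `h` depends only on the product `a h` once it is balanced: for linear `a` and
`b`, the pairs `(a, b h)` and `(b, a h)` give the same value. It is then the value at `a h` of
one additive family, which serves as the family of root elements of a missing root
(`exists_degHom_of_balanced`).

In the small link the missing root `β + ψ + ω` is reached from `[β, ψ + ω]`, and balance follows
from conjugating `[ψ, ω]` by `β` (`SmallLink.exists_completion`). In the large link the missing
long roots come first: `α + β + 2ψ` as `[α, β + 2ψ]`, then `α + 2β + 2ψ` as
`[β, α + β + 2ψ]`. The short root `α + β + ψ` comes last, where the commutator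
of `α` and `β + ψ` has a second term, which the symmetric product `LargeLink.short` removes;
the lift that identifies this product with the one formed from `α + β` and `ψ` shows that it is
balanced (`LargeLink.exists_D`, `LargeLink.IsD.exists_E`, `LargeLink.IsE.exists_T`). All
commutator relations between the completed families (`SmallLink.IsT.commRel`,
`LargeLink.commRel`) then follow, and the aliases have the right values by construction.
-/

namespace B3Lift

/-! ### Bounded rewriting as a group -/

section Rewriting

variable {G : Type*} [Group G]

/-- A `Step` without cyclic shifts of the word itself: a subword `u` is replaced by `v`. -/
def SubwordStep (R : Set (List G)) (w w' : List G) : Prop :=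
  ∃ a u b v : List G, (∃ r ∈ R, WEquiv r (u ++ winv v)) ∧ w = a ++ u ++ b ∧ w' = a ++ v ++ b

/-- `w` is rewritten to `w'` in at most `n` subword replacements. -/
inductive RewritesIn (R : Set (List G)) : ℕ → List G → List G → Prop
  | refl (n : ℕ) (w : List G) : RewritesIn R n w w
  | head {n : ℕ} {w w' w'' : List G} :
      SubwordStep R w w' → RewritesIn R n w' w'' → RewritesIn R (n + 1) w w''

theorem winv_append (u v : List G) : winv (u ++ v) = winv v ++ winv u := by
  simp [winv]

theorem winv_winv (u : List G) : winv (winv u) = u := by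
  simp [winv, List.map_reverse]

theorem SubwordStep.symm {R : Set (List G)} {w w' : List G} (h : SubwordStep R w w') :
    SubwordStep R w' w := by
  obtain ⟨a, u, b, v, ⟨r, hr, he⟩, hw, hw'⟩ := h
  refine ⟨a, v, b, u, ⟨r, hr, ?_⟩, hw', hw⟩
  have : winv (v ++ winv u) = u ++ winv v := by rw [winv_append, winv_winv]
  rcases he with he | he
  · right; rwa [this]
  · left; rwa [winv_append, winv_winv] at he

theorem SubwordStep.context {R : Set (List G)} {w w' : List G} (h : SubwordStep R w w')
    (p s : List G) : SubwordStep R (p ++ w ++ s) (p ++ w' ++ s) := by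
  obtain ⟨a, u, b, v, hr, rfl, rfl⟩ := h
  exact ⟨p ++ a, u, b ++ s, v, hr, by simp, by simp⟩

theorem SubwordStep.step {R : Set (List G)} {w w' : List G} (h : SubwordStep R w w') :
    Step R w w' := by
  obtain ⟨a, u, b, v, ⟨r, hr, he⟩, rfl, rfl⟩ := h
  exact ⟨a, u, b, v, r, hr, Or.inl (List.IsRotated.refl _), Or.inl (List.IsRotated.refl _), he⟩

theorem SubwordStep.mono {R R' : Set (List G)} (hR : R ⊆ R') {w w' : List G}
    (h : SubwordStep R w w') : SubwordStep R' w w' := by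
  obtain ⟨a, u, b, v, ⟨r, hr, he⟩, h₁, h₂⟩ := h
  exact ⟨a, u, b, v, ⟨r, hR hr, he⟩, h₁, h₂⟩

namespace RewritesIn

variable {R R' : Set (List G)} {m n : ℕ} {w w' w'' : List G}

theorem mono (h : RewritesIn R n w w') (hR : R ⊆ R') (hn : n ≤ m) : RewritesIn R' m w w' := by
  induction h generalizing m with
  | refl => exact .refl _ _
  | head hs _ ih =>
    obtain ⟨m, rfl⟩ : ∃ k, m = k + 1 := ⟨m - 1, by omega⟩
    exact .head (hs.mono hR) (ih (by omega))

theorem trans (h : RewritesIn R m w w') (h' : RewritesIn R n w' w'') :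
    RewritesIn R (m + n) w w'' := by
  induction h with
  | refl => exact h'.mono subset_rfl (by omega)
  | head hs _ ih => rw [Nat.add_right_comm]; exact .head hs (ih h')

theorem symm (h : RewritesIn R n w w') : RewritesIn R n w' w := by
  induction h with
  | refl => exact .refl _ _
  | head hs _ ih => exact ih.trans (.head hs.symm (.refl 0 _))

theorem context (h : RewritesIn R n w w') (p s : List G) :
    RewritesIn R n (p ++ w ++ s) (p ++ w' ++ s) := by
  induction h with
  | refl => exact .refl _ _
  | head hs _ ih => exact .head (hs.context p s) ih

theorem append {v v' : List G} (h : RewritesIn R m w w') (h' : RewritesIn R n v v') :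
    RewritesIn R (m + n) (w ++ v) (w' ++ v') := by
  have h₁ := h.context [] v
  have h₂ := h'.context w' []
  simp only [List.nil_append, List.append_nil] at h₁ h₂
  exact h₁.trans h₂

theorem exists_steps (h : RewritesIn R n w w') :
    ∃ k ≤ n, ∃ f : ℕ → List G, f 0 = w ∧ f k = w' ∧ ∀ i < k, Step R (f i) (f (i + 1)) := by
  induction h with
  | refl n w => exact ⟨0, Nat.zero_le _, fun _ => w, rfl, rfl, by simp⟩
  | @head n w w' w'' hs _ ih =>
    obtain ⟨k, hk, f, h0, h1, hf⟩ := ih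
    refine ⟨k + 1, by omega, fun i => if i = 0 then w else f (i - 1), rfl, by simpa using h1, ?_⟩
    intro i hi
    rcases i with _ | i
    · simpa [h0] using hs.step
    · simpa using hf i (by omega)

/-- Rewriting to the empty word costs one more step than a derivation, the replacement of the
empty word by the one-letter word `1`. -/
theorem derivableWithin (h : RewritesIn R n w []) (h1 : [1] ∈ R) :
    DerivableWithin R (n + 1) w := by
  have h₂ : RewritesIn R 1 ([] : List G) [1] :=
    .head ⟨[], [], [], [1], ⟨[1], h1, Or.inl (by simp [winv])⟩, rfl, rfl⟩ (.refl 0 _)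
  exact (h.trans h₂).exists_steps

end RewritesIn

theorem DerivableWithin.mono {R R' : Set (List G)} {m n : ℕ} {w : List G}
    (h : DerivableWithin R m w) (hR : R ⊆ R') (hn : m ≤ n) : DerivableWithin R' n w := by
  obtain ⟨k, hk, f, h0, h1, hf⟩ := h
  refine ⟨k, hk.trans hn, f, h0, h1, fun i hi => ?_⟩
  obtain ⟨a, u, b, v, r, hr, h⟩ := hf i hi
  exact ⟨a, u, b, v, r, hR hr, h⟩

end Rewriting

section Uniform

variable {ι : Type*} {G : ι → Type*}

/-- The family of words whose letters are the members of a word of families. -/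
def famWord (l : List (∀ i, G i)) : ∀ i, FreeMonoid (G i) :=
  fun i => FreeMonoid.ofList (l.map fun g => g i)

theorem famWord_append (l l' : List (∀ i, G i)) :
    famWord (l ++ l') = famWord l * famWord l' := by
  funext i; simp [famWord]

variable [∀ i, Group (G i)]

/-- Relators at every member of a family of groups, growing with the length bound. -/
structure RelatorFamily (G : ι → Type*) [∀ i, Group (G i)] where
  /-- The relators allowed at the length bound `n`. -/
  rel : ℕ → ∀ i, Set (List (G i))
  mono : ∀ {m n : ℕ}, m ≤ n → ∀ i, rel m i ⊆ rel n i

variable (𝓡 : RelatorFamily G)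

/-- Two families of words are congruent if a single bound serves, at every index, both as the
number of rewriting steps and as the length of the relators used. -/
def RelatorFamily.con : Con (∀ i, FreeMonoid (G i)) where
  r w w' := ∃ n, ∀ i, RewritesIn (𝓡.rel n i) n (w i).toList (w' i).toList
  iseqv :=
    { refl := fun _ => ⟨0, fun _ => .refl _ _⟩
      symm := fun ⟨n, h⟩ => ⟨n, fun i => (h i).symm⟩
      trans := fun ⟨m, h⟩ ⟨n, h'⟩ => ⟨m + n, fun i =>
        ((h i).mono (𝓡.mono (by omega) i) le_rfl).trans
          ((h' i).mono (𝓡.mono (by omega) i) le_rfl)⟩ }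
  mul' := fun ⟨m, h⟩ ⟨n, h'⟩ => ⟨m + n, fun i => by
    simpa using ((h i).mono (𝓡.mono (by omega) i) le_rfl).append
      ((h' i).mono (𝓡.mono (by omega) i) le_rfl)⟩

/-- The group of units of families of words up to uniformly bounded rewriting: an identity
in this group is a derivation whose length is bounded independently of the index. -/
abbrev RelatorFamily.Grp : Type _ := (𝓡.con.Quotient)ˣ

/-- A family of letters is cancellable if its free cancellations are relators of bounded length. -/
def RelatorFamily.Cancellable (g : ∀ i, G i) : Prop :=
  ∃ n, ∀ i, [g i, (g i)⁻¹] ∈ 𝓡.rel n i ∧ [(g i)⁻¹, g i] ∈ 𝓡.rel n i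

theorem rewritesIn_nil_of_mem {H : Type*} [Group H] {R : Set (List H)} {w : List H} (h : w ∈ R) :
    RewritesIn R 1 w [] :=
  .head ⟨[], w, [], [], ⟨w, h, Or.inl (by simp [winv, List.IsRotated.refl])⟩, by simp, rfl⟩
    (.refl 0 _)

variable {𝓡}

theorem RelatorFamily.mk_famWord_eq_one {l : List (∀ i, G i)}
    (h : ∃ n, ∀ i, (l.map fun g => g i) ∈ 𝓡.rel n i) :
    (famWord l : 𝓡.con.Quotient) = 1 := by
  obtain ⟨n, h⟩ := h
  refine (Con.eq 𝓡.con).2 ⟨n + 1, fun i => ?_⟩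
  exact (rewritesIn_nil_of_mem (𝓡.mono (Nat.le_succ n) i (h i))).mono subset_rfl (by omega)

open Classical in
/-- The class of a one-letter family, as a unit (and `1` if it is not cancellable). -/
noncomputable def RelatorFamily.letter (𝓡 : RelatorFamily G) (g : ∀ i, G i) : 𝓡.Grp :=
  if h : 𝓡.Cancellable g then
    ⟨(famWord [g] : 𝓡.con.Quotient), (famWord [g⁻¹] : 𝓡.con.Quotient), by
      rw [← Con.coe_mul, ← famWord_append]
      exact mk_famWord_eq_one (h.imp fun n hn i => (hn i).1), by
      rw [← Con.coe_mul, ← famWord_append]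
      exact mk_famWord_eq_one (h.imp fun n hn i => (hn i).2)⟩
  else 1

theorem RelatorFamily.Cancellable.inv {g : ∀ i, G i} (h : 𝓡.Cancellable g) :
    𝓡.Cancellable g⁻¹ :=
  h.imp fun n hn i => by simpa using (hn i).symm

theorem RelatorFamily.coe_letter {g : ∀ i, G i} (h : 𝓡.Cancellable g) :
    (𝓡.letter g : 𝓡.con.Quotient) = (famWord [g] : 𝓡.con.Quotient) := by
  simp [letter, h]

theorem RelatorFamily.letter_inv {g : ∀ i, G i} (h : 𝓡.Cancellable g) :
    𝓡.letter g⁻¹ = (𝓡.letter g)⁻¹ := by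
  apply Units.ext
  rw [coe_letter h.inv]
  simp [letter, h]

theorem RelatorFamily.coe_prod_letter {l : List (∀ i, G i)} (h : ∀ g ∈ l, 𝓡.Cancellable g) :
    ((l.map 𝓡.letter).prod : 𝓡.con.Quotient) = (famWord l : 𝓡.con.Quotient) := by
  induction l with
  | nil => rfl
  | cons g l ih =>
    rw [List.map_cons, List.prod_cons, Units.val_mul,
      ih fun g hg => h g (List.mem_cons_of_mem _ hg), coe_letter (h g List.mem_cons_self),
      ← Con.coe_mul, ← famWord_append, List.singleton_append]

/-- A word of families that is a relator at every index is trivial. -/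
theorem RelatorFamily.prod_letter_eq_one {l : List (∀ i, G i)} (h : ∀ g ∈ l, 𝓡.Cancellable g)
    (hr : ∃ n, ∀ i, (l.map fun g => g i) ∈ 𝓡.rel n i) : (l.map 𝓡.letter).prod = 1 := by
  apply Units.ext
  rw [coe_prod_letter h, mk_famWord_eq_one hr, Units.val_one]

theorem RelatorFamily.prod_letter_winv {l : List (∀ i, G i)} (h : ∀ g ∈ l, 𝓡.Cancellable g) :
    ((winv l).map 𝓡.letter).prod = ((l.map 𝓡.letter).prod)⁻¹ := by
  rw [List.prod_inv_reverse, winv, List.map_reverse, List.map_map, List.map_map]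
  congr 2
  exact List.map_congr_left fun g hg => letter_inv (h g hg)

/-- An identity between families of letters yields derivations of uniformly bounded length. -/
theorem RelatorFamily.exists_derivableWithin {l : List (∀ i, G i)}
    (h : ∀ g ∈ l, 𝓡.Cancellable g) (hl : (l.map 𝓡.letter).prod = 1)
    (h1 : ∀ᶠ n in Filter.atTop, ∀ i, [1] ∈ 𝓡.rel n i) :
    ∀ᶠ n in Filter.atTop, ∀ i, DerivableWithin (𝓡.rel n i) n (l.map fun g => g i) := by
  have := congrArg Units.val hl
  rw [coe_prod_letter h, Units.val_one] at this
  obtain ⟨n, hn⟩ := (Con.eq 𝓡.con).1 this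
  filter_upwards [h1, Filter.eventually_ge_atTop (n + 1)] with k hk hnk i
  exact (((hn i).mono (𝓡.mono (by omega) i) le_rfl).derivableWithin (hk i)).mono subset_rfl hnk

end Uniform

/-! ### Additive families indexed by polynomials of bounded degree -/

section Polynomials

open Polynomial

variable {S : Type*} [CommRing S]

/-- The polynomial `s + t X`. -/
noncomputable def lin (s t : S) : S[X] := C s + C t * X

theorem lin_zero_right (s : S) : lin s 0 = C s := by simp [lin]

theorem natDegree_lin_le (s t : S) : (lin s t).natDegree ≤ 1 := by
  unfold lin; compute_degree

theorem eq_lin_of_natDegree_le {f : S[X]} (hf : f.natDegree ≤ 1) :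
    f = lin (f.coeff 0) (f.coeff 1) := by
  rw [lin, add_comm]; exact eq_X_add_C_of_natDegree_le_one hf

theorem polynomial_induction_of_natDegree_le {P : S[X] → Prop} (n : ℕ)
    (hadd : ∀ f g, P f → P g → P (f + g)) (hmono : ∀ i ≤ n, ∀ s, P (C s * X ^ i)) {f : S[X]}
    (hf : f.natDegree ≤ n) : P f := by
  rw [f.as_sum_range_C_mul_X_pow' (Nat.lt_succ_of_le hf)]
  refine Finset.sum_induction _ P hadd (by simpa using hmono 0 (Nat.zero_le _) 0) fun i hi => ?_
  exact hmono i (by have := Finset.mem_range.1 hi; omega) _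

variable {Γ : Type*} [Group Γ]

/-- `φ` turns sums of polynomials into products and kills all monomials of degree above `n`. -/
structure DegHom (n : ℕ) (φ : S[X] → Γ) : Prop where
  add : ∀ f g, φ (f + g) = φ f * φ g
  high : ∀ i s, n < i → φ (C s * X ^ i) = 1

namespace DegHom

variable {n m : ℕ} {φ ψ : S[X] → Γ}

theorem zero (h : DegHom n φ) : φ 0 = 1 := by
  have := h.add 0 0
  simpa using this

theorem neg (h : DegHom n φ) (f : S[X]) : φ (-f) = (φ f)⁻¹ := by
  rw [eq_inv_iff_mul_eq_one, ← h.add, neg_add_cancel, h.zero]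

theorem sub (h : DegHom n φ) (f g : S[X]) : φ (f - g) = φ f * (φ g)⁻¹ := by
  rw [sub_eq_add_neg, h.add, h.neg]

theorem comm (h : DegHom n φ) (f g : S[X]) : Commute (φ f) (φ g) := by
  rw [Commute, SemiconjBy, ← h.add, add_comm, h.add]

theorem conj (h : DegHom n φ) (γ : Γ) : DegHom n fun f => γ * φ f * γ⁻¹ where
  add f g := by simp only [h.add]; group
  high i s hi := by simp [h.high i s hi]

/-- A property of group elements closed under multiplication holds on the range of `φ` as soon
as it holds on monomials of degree at most `n`. -/
theorem induction (h : DegHom n φ) {P : Γ → Prop} (hmul : ∀ x y, P x → P y → P (x * y))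
    (hmono : ∀ i ≤ n, ∀ s, P (φ (C s * X ^ i))) (f : S[X]) : P (φ f) := by
  induction f using Polynomial.induction_on' with
  | add f g hf hg => rw [h.add]; exact hmul _ _ hf hg
  | monomial i s =>
    rw [← C_mul_X_pow_eq_monomial]
    rcases le_or_gt i n with hi | hi
    · exact hmono i hi s
    · rw [h.high i s hi, ← h.zero]
      simpa using hmono 0 (Nat.zero_le _) 0

theorem commute_of_mono (h : DegHom n φ) {γ : Γ}
    (hmono : ∀ i ≤ n, ∀ s, Commute γ (φ (C s * X ^ i))) (f : S[X]) : Commute γ (φ f) :=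
  h.induction (fun _ _ => Commute.mul_right) hmono f

end DegHom

/-! ### Commutation relations between polynomial families

A relation `R` on polynomials that is additive in both arguments (`BiClosed R`) is propagated
from products of linear forms to all monomials. An instance of the hypothesis at `1 + X` gives,
once the other pairs of monomials are known, one new pair at a time. -/

/-- A relation closed under subtraction in each argument. -/
structure BiClosed (R : S[X] → S[X] → Prop) : Prop where
  zero_left : ∀ g, R 0 g
  zero_right : ∀ f, R f 0
  sub_left : ∀ {f f' g}, R f g → R f' g → R (f - f') g
  sub_right : ∀ {f g g'}, R f g → R f g' → R f (g - g')

namespace BiClosed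

variable {R : S[X] → S[X] → Prop}

theorem neg_left (h : BiClosed R) {f g} (h' : R f g) : R (-f) g := by
  simpa using h.sub_left (h.zero_left g) h'

theorem neg_right (h : BiClosed R) {f g} (h' : R f g) : R f (-g) := by
  simpa using h.sub_right (h.zero_right f) h'

theorem add_left (h : BiClosed R) {f f' g} (h₁ : R f g) (h₂ : R f' g) : R (f + f') g := by
  simpa using h.sub_left h₁ (h.neg_left h₂)

theorem add_right (h : BiClosed R) {f g g'} (h₁ : R f g) (h₂ : R f g') : R f (g + g') := by
  simpa using h.sub_right h₁ (h.neg_right h₂)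

theorem swap (h : BiClosed R) : BiClosed fun f g => R g f :=
  ⟨h.zero_right, h.zero_left, h.sub_right, h.sub_left⟩

/-- Elimination of a single unknown pair from a known relation between sums. -/
theorem cancel (h : BiClosed R) {F G f f' g g' : S[X]} (hFG : R F G) (hF : F = f + f')
    (hG : G = g + g') (h₁ : R f' g) (h₂ : R f' g') (h₃ : R f g') : R f g := by
  subst hF hG
  have h₄ : R f (g + g') := by
    simpa using h.sub_left hFG (h.add_right h₁ h₂)
  simpa using h.sub_right h₄ h₃

theorem commute {n m : ℕ} {φ ψ : S[X] → Γ} (hφ : DegHom n φ) (hψ : DegHom m ψ) :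
    BiClosed fun f g => Commute (φ f) (ψ g) where
  zero_left g := by rw [hφ.zero]; exact Commute.one_left _
  zero_right f := by rw [hψ.zero]; exact Commute.one_right _
  sub_left h h' := by rw [hφ.sub]; exact h.mul_left h'.inv_left
  sub_right h h' := by rw [hψ.sub]; exact h.mul_right h'.inv_right

end BiClosed

theorem commute_of_monomials {n m : ℕ} {φ ψ : S[X] → Γ} (hφ : DegHom n φ) (hψ : DegHom m ψ)
    (h : ∀ i ≤ n, ∀ j ≤ m, ∀ s u, Commute (φ (C s * X ^ i)) (ψ (C u * X ^ j))) (f g : S[X]) :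
    Commute (φ f) (ψ g) :=
  hψ.commute_of_mono (fun j hj u =>
    (hφ.commute_of_mono (fun i hi s => (h i hi j hj s u).symm) f).symm) g

/-- Every element is a sum of two units, and 2 is a unit. Products of fields of odd
characteristic have this property. -/
class OddScalars (S : Type*) [CommRing S] : Prop where
  exists_half : ∃ h : S, 2 * h = 1
  exists_units : ∀ s : S, ∃ s₁ s₂ v₁ v₂ : S, s = s₁ + s₂ ∧ s₁ * v₁ = 1 ∧ s₂ * v₂ = 1

section Elimination

variable {R : S[X] → S[X] → Prop}

theorem BiClosed.of_units [OddScalars S] (hR : BiClosed R) {i j : ℕ}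
    (h : ∀ s v, s * v = 1 → ∀ u, R (C s * X ^ i) (C u * X ^ j)) (s u : S) :
    R (C s * X ^ i) (C u * X ^ j) := by
  obtain ⟨s₁, s₂, v₁, v₂, rfl, h₁, h₂⟩ := OddScalars.exists_units s
  rw [C_add, add_mul]
  exact hR.add_left (h _ _ h₁ u) (h _ _ h₂ u)

/-- Propagation from pairs `(a b, b c)` to all pairs of quadratic monomials. -/
theorem BiClosed.of_mul_mul (hR : BiClosed R)
    (h : ∀ a₀ a₁ b₀ b₁ c₀ c₁, R (lin a₀ a₁ * lin b₀ b₁) (lin b₀ b₁ * lin c₀ c₁)) :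
    ∀ i ≤ 2, ∀ j ≤ 2, ∀ s u, R (C s * X ^ i) (C u * X ^ j) := by
  have h00 : ∀ s u, R (C s * X ^ 0) (C u * X ^ 0) := fun s u => by
    simpa [lin] using h s 0 1 0 u 0
  have h01 : ∀ s u, R (C s * X ^ 0) (C u * X ^ 1) := fun s u => by
    simpa [lin] using h s 0 1 0 0 u
  have h10 : ∀ s u, R (C s * X ^ 1) (C u * X ^ 0) := fun s u => by
    simpa [lin] using h 0 s 1 0 u 0
  have h11 : ∀ s u, R (C s * X ^ 1) (C u * X ^ 1) := fun s u => by
    simpa [lin] using h 0 s 1 0 0 u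
  have h12 : ∀ s u, R (C s * X ^ 1) (C u * X ^ 2) := fun s u => by
    convert h s 0 0 1 0 u using 1 <;> simp only [lin, C_0, C_1] <;> ring
  have h21 : ∀ s u, R (C s * X ^ 2) (C u * X ^ 1) := fun s u => by
    convert h 0 s 0 1 u 0 using 1 <;> simp only [lin, C_0, C_1] <;> ring
  have h22 : ∀ s u, R (C s * X ^ 2) (C u * X ^ 2) := fun s u => by
    convert h 0 s 0 1 0 u using 1 <;> simp only [lin, C_0, C_1] <;> ring
  have h02 : ∀ s u, R (C s * X ^ 0) (C u * X ^ 2) := fun s u => by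
    refine hR.cancel (h s 0 1 1 0 u) (f' := C s * X ^ 1) (g' := C u * X ^ 1) ?_ ?_
      (h12 _ _) (h11 _ _) (h01 _ _) <;> simp only [lin, C_0, C_1] <;> ring
  have h20 : ∀ s u, R (C s * X ^ 2) (C u * X ^ 0) := fun s u => by
    refine hR.cancel (h 0 s 1 1 u 0) (f' := C s * X ^ 1) (g' := C u * X ^ 1) ?_ ?_
      (h10 _ _) (h11 _ _) (h21 _ _) <;> simp only [lin, C_0, C_1] <;> ring
  intro i hi j hj
  interval_cases i <;> interval_cases j <;> with_reducible assumption

/-- Scalars of the first argument can be absorbed in `b`, those of the second in `d`. -/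
theorem BiClosed.scale_sq {p : ℕ} {q : S[X] → S[X]}
    (h : ∀ b₀ b₁ c₀ c₁ d₀ d₁, R (lin b₀ b₁ * lin c₀ c₁ ^ p)
      (lin b₀ b₁ * q (lin c₀ c₁) * lin d₀ d₁)) {s v : S} (hs : s * v = 1)
    (b₀ b₁ c₀ c₁ d₀ d₁ : S) : R (C s * (lin b₀ b₁ * lin c₀ c₁ ^ p))
      (lin b₀ b₁ * q (lin c₀ c₁) * lin d₀ d₁) := by
  have e : C s * C v = (1 : S[X]) := by rw [← C_mul, hs, C_1]
  convert h (s * b₀) (s * b₁) c₀ c₁ (v * d₀) (v * d₁) using 1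
  · simp only [lin, C_mul]; ring
  · simp only [lin, C_mul]
    linear_combination (-(C b₀ + C b₁ * X) * q (C c₀ + C c₁ * X) * (C d₀ + C d₁ * X)) * e

/-- Half of the propagation from pairs `(b c², b c d)`: new pairs from old ones. -/
theorem BiClosed.of_mul_sq_aux [OddScalars S] (hR : BiClosed R)
    (h : ∀ b₀ b₁ c₀ c₁ d₀ d₁, R (lin b₀ b₁ * lin c₀ c₁ ^ 2)
      (lin b₀ b₁ * lin c₀ c₁ * lin d₀ d₁))
    (h' : ∀ b₀ b₁ c₀ c₁ d₀ d₁, R (lin b₀ b₁ * lin c₀ c₁ * lin d₀ d₁)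
      (lin b₀ b₁ * lin c₀ c₁ ^ 2)) :
    (∀ s u, R (C s * X ^ 2) (C u * X ^ 0)) ∧ (∀ s u, R (C s * X ^ 3) (C u * X ^ 1)) ∧
    ((∀ s u, R (C s * X ^ 0) (C u * X ^ 2)) → (∀ s u, R (C s * X ^ 1) (C u * X ^ 3)) →
      (∀ s u, R (C s * X ^ 0) (C u * X ^ 3))) ∧
    (∀ i ≤ 3, ∀ j ≤ 3, i ≤ j + 1 → j ≤ i + 1 → ∀ s u, R (C s * X ^ i) (C u * X ^ j)) := by
  have hs {s v : S} (hs : s * v = 1) (b₀ b₁ c₀ c₁ d₀ d₁ : S) :=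
    BiClosed.scale_sq (q := fun c => c) h hs b₀ b₁ c₀ c₁ d₀ d₁
  have hs' {s v : S} (hs : s * v = 1) (b₀ b₁ c₀ c₁ d₀ d₁ : S) :=
    BiClosed.scale_sq (R := fun f g => R g f) (q := fun c => c) h' hs b₀ b₁ c₀ c₁ d₀ d₁
  have h00 : ∀ s u, R (C s * X ^ 0) (C u * X ^ 0) := hR.of_units fun s v e u => by
    simpa [lin] using hs e 1 0 1 0 u 0
  have h01 : ∀ s u, R (C s * X ^ 0) (C u * X ^ 1) := hR.of_units fun s v e u => by
    simpa [lin] using hs e 1 0 1 0 0 u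
  have h11 : ∀ s u, R (C s * X ^ 1) (C u * X ^ 1) := hR.of_units fun s v e u => by
    convert hs e 0 1 1 0 u 0 using 1 <;> simp only [lin, C_0, C_1] <;> ring
  have h12 : ∀ s u, R (C s * X ^ 1) (C u * X ^ 2) := hR.of_units fun s v e u => by
    convert hs e 0 1 1 0 0 u using 1 <;> simp only [lin, C_0, C_1] <;> ring
  have h21 : ∀ s u, R (C s * X ^ 2) (C u * X ^ 1) := hR.of_units fun s v e u => by
    convert hs e 1 0 0 1 u 0 using 1 <;> simp only [lin, C_0, C_1] <;> ring
  have h22 : ∀ s u, R (C s * X ^ 2) (C u * X ^ 2) := hR.of_units fun s v e u => by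
    convert hs e 1 0 0 1 0 u using 1 <;> simp only [lin, C_0, C_1] <;> ring
  have h32 : ∀ s u, R (C s * X ^ 3) (C u * X ^ 2) := hR.of_units fun s v e u => by
    convert hs e 0 1 0 1 u 0 using 1 <;> simp only [lin, C_0, C_1] <;> ring
  have h33 : ∀ s u, R (C s * X ^ 3) (C u * X ^ 3) := hR.of_units fun s v e u => by
    convert hs e 0 1 0 1 0 u using 1 <;> simp only [lin, C_0, C_1] <;> ring
  have h10 : ∀ s u, R (C s * X ^ 1) (C u * X ^ 0) := fun s u =>
    hR.swap.of_units (fun u v e s => by simpa [lin] using hs' e 1 0 1 0 0 s) u s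
  have h23 : ∀ s u, R (C s * X ^ 2) (C u * X ^ 3) := fun s u =>
    hR.swap.of_units (fun u v e s => by
      convert hs' e 0 1 0 1 s 0 using 1 <;> simp only [lin, C_0, C_1] <;> ring) u s
  have h20 : ∀ s u, R (C s * X ^ 2) (C u * X ^ 0) := hR.of_units fun s v e u => by
    refine hR.cancel (hs e 1 0 1 1 u 0) (f' := C s * X ^ 0 + C s * X ^ 1 + C s * X ^ 1)
      (g' := C u * X ^ 1) ?_ ?_ ?_ ?_ ?_
    iterate 2 simp only [lin, C_0, C_1]; ring
    all_goals with_reducible repeat' first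
      | apply hR.add_left | apply hR.add_right
      | apply h00 | apply h01 | apply h10 | apply h11 | apply h12 | apply h21
  have h31 : ∀ s u, R (C s * X ^ 3) (C u * X ^ 1) := hR.of_units fun s v e u => by
    refine hR.cancel (hs e 0 1 1 1 u 0) (f' := C s * X ^ 1 + C s * X ^ 2 + C s * X ^ 2)
      (g' := C u * X ^ 2) ?_ ?_ ?_ ?_ ?_
    iterate 2 simp only [lin, C_0, C_1]; ring
    all_goals with_reducible repeat' first
      | apply hR.add_left | apply hR.add_right
      | apply h00 | apply h01 | apply h10 | apply h11 | apply h12 | apply h20 | apply h21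
      | apply h22 | apply h23 | apply h32
  refine ⟨h20, h31, fun h02 h13 => ?_, ?_⟩
  · refine hR.of_units fun s v e u => ?_
    refine hR.cancel (hs e 1 1 1 1 0 u) (f' := C s * X ^ 1 + C s * X ^ 1 + C s * X ^ 1 +
      C s * X ^ 2 + C s * X ^ 2 + C s * X ^ 2 + C s * X ^ 3)
      (g' := C u * X ^ 1 + C u * X ^ 2 + C u * X ^ 2) ?_ ?_ ?_ ?_ ?_
    iterate 2 simp only [lin, C_0, C_1]; ring
    all_goals with_reducible repeat' first
      | apply hR.add_left | apply hR.add_right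
      | apply h00 | apply h01 | apply h10 | apply h11 | apply h12 | apply h20 | apply h21
      | apply h22 | apply h23 | apply h31 | apply h32 | apply h33 | apply h02 | apply h13
  · intro i hi j hj hi' hj'
    interval_cases i <;> interval_cases j <;> first | with_reducible assumption | omega

/-- Propagation from pairs `(b c², b c d)` and `(b c d, b c²)` to all pairs of cubic monomials. -/
theorem BiClosed.of_mul_sq [OddScalars S] (hR : BiClosed R)
    (h : ∀ b₀ b₁ c₀ c₁ d₀ d₁, R (lin b₀ b₁ * lin c₀ c₁ ^ 2)
      (lin b₀ b₁ * lin c₀ c₁ * lin d₀ d₁))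
    (h' : ∀ b₀ b₁ c₀ c₁ d₀ d₁, R (lin b₀ b₁ * lin c₀ c₁ * lin d₀ d₁)
      (lin b₀ b₁ * lin c₀ c₁ ^ 2)) :
    ∀ i ≤ 3, ∀ j ≤ 3, ∀ s u, R (C s * X ^ i) (C u * X ^ j) := by
  obtain ⟨h20, h31, k03, k⟩ := hR.of_mul_sq_aux h h'
  obtain ⟨h02, h13, k30, -⟩ := hR.swap.of_mul_sq_aux h' h
  have h03 := k03 (fun s u => h02 u s) (fun s u => h13 u s)
  have h30 := k30 (fun s u => h20 u s) (fun s u => h31 u s)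
  intro i hi j hj s u
  by_cases hij : i ≤ j + 1 ∧ j ≤ i + 1
  · exact k i hi j hj hij.1 hij.2 s u
  interval_cases i <;> interval_cases j <;>
    first
    | with_reducible exact h20 s u | with_reducible exact h31 s u
    | with_reducible exact h02 u s | with_reducible exact h13 u s | with_reducible exact h03 s u
    | with_reducible exact h30 u s | exact absurd (by norm_num) hij

/-- As 2 is invertible, the squares of linear forms span the quadratic polynomials. -/
theorem square_induction [OddScalars S] {P : S[X] → Prop} (hsub : ∀ f g, P f → P g → P (f - g))
    (hsq : ∀ c₀ c₁, P (lin c₀ c₁ ^ 2)) : ∀ j ≤ 2, ∀ u, P (C u * X ^ j) := by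
  obtain ⟨k, hk⟩ := OddScalars.exists_half (S := S)
  have e : (2 : S[X]) * C k = 1 := by rw [← C_ofNat, ← C_mul, hk, C_1]
  intro j hj u
  -- With `k = 1/2`, every scalar is a difference of two squares.
  have e' : C u = C (k * (u + 1)) ^ 2 - C (k * (u - 1)) ^ 2 := by
    simp only [C_mul, C_add, C_sub, C_1]
    linear_combination (-C u - 2 * C k * C u) * e
  interval_cases j
  · rw [e']
    convert hsub _ _ (hsq (k * (u + 1)) 0) (hsq (k * (u - 1)) 0) using 1
    simp [lin]
  · convert hsub _ _ (hsub _ _ (hsq 1 (u * k)) (hsq 1 0)) (hsq 0 (u * k)) using 1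
    simp only [lin, C_0, C_1, C_mul]
    linear_combination (-C u * X) * e
  · rw [e']
    convert hsub _ _ (hsq 0 (k * (u + 1))) (hsq 0 (k * (u - 1))) using 1
    simp only [lin, C_0]; ring

/-- Propagation from pairs `(f, f c²)` with `f = a b`. -/
theorem BiClosed.of_mul_self_sq [OddScalars S] (hR : BiClosed R)
    (h : ∀ a₀ a₁ b₀ b₁ c₀ c₁, R (lin a₀ a₁ * lin b₀ b₁)
      (lin a₀ a₁ * lin b₀ b₁ * lin c₀ c₁ ^ 2)) :
    ∀ i ≤ 2, ∀ j ≤ 4, ∀ s u, R (C s * X ^ i) (C u * X ^ j) := by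
  have hk : ∀ a₀ a₁ b₀ b₁, ∀ j ≤ 2, ∀ u, R (lin a₀ a₁ * lin b₀ b₁)
      (lin a₀ a₁ * lin b₀ b₁ * (C u * X ^ j)) := fun a₀ a₁ b₀ b₁ =>
    square_induction (P := fun k => R (lin a₀ a₁ * lin b₀ b₁) (lin a₀ a₁ * lin b₀ b₁ * k))
      (fun f g hf hg => by rw [mul_sub]; exact hR.sub_right hf hg)
      (h a₀ a₁ b₀ b₁)
  have hs {s v : S} (hs : s * v = 1) (a₀ a₁ b₀ b₁ : S) (j : ℕ) (hj : j ≤ 2) (u : S) :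
      R (C s * (lin a₀ a₁ * lin b₀ b₁)) (lin a₀ a₁ * lin b₀ b₁ * (C u * X ^ j)) := by
    have e : C s * C v = (1 : S[X]) := by rw [← C_mul, hs, C_1]
    convert hk (s * a₀) (s * a₁) b₀ b₁ j hj (v * u) using 1
    · simp only [lin, C_mul]; ring
    · simp only [lin, C_mul]
      linear_combination (-(C a₀ + C a₁ * X) * (C b₀ + C b₁ * X) * (C u * X ^ j)) * e
  have k0 : ∀ j ≤ 2, ∀ s u, R (C s * X ^ 0) (C u * X ^ j) := fun j hj =>
    hR.of_units fun s v e u => by simpa [lin] using hs e 1 0 1 0 j hj u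
  have k1 : ∀ j ≤ 2, ∀ s u, R (C s * X ^ 1) (C u * X ^ (j + 1)) := fun j hj =>
    hR.of_units fun s v e u => by
      convert hs e 1 0 0 1 j hj u using 1 <;> simp only [lin, C_0, C_1] <;> ring
  have k2 : ∀ j ≤ 2, ∀ s u, R (C s * X ^ 2) (C u * X ^ (j + 2)) := fun j hj =>
    hR.of_units fun s v e u => by
      convert hs e 0 1 0 1 j hj u using 1 <;> simp only [lin, C_0, C_1] <;> ring
  have h00 := k0 0 (by norm_num)
  have h01 := k0 1 (by norm_num)
  have h02 := k0 2 (by norm_num)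
  have h11 : ∀ s u, R (C s * X ^ 1) (C u * X ^ 1) := k1 0 (by norm_num)
  have h12 : ∀ s u, R (C s * X ^ 1) (C u * X ^ 2) := k1 1 (by norm_num)
  have h13 : ∀ s u, R (C s * X ^ 1) (C u * X ^ 3) := k1 2 (by norm_num)
  have h22 : ∀ s u, R (C s * X ^ 2) (C u * X ^ 2) := k2 0 (by norm_num)
  have h23 : ∀ s u, R (C s * X ^ 2) (C u * X ^ 3) := k2 1 (by norm_num)
  have h24 : ∀ s u, R (C s * X ^ 2) (C u * X ^ 4) := k2 2 (by norm_num)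
  have h03 : ∀ s u, R (C s * X ^ 0) (C u * X ^ 3) := hR.of_units fun s v e u => by
    refine hR.cancel (hs e 1 0 1 1 2 (by norm_num) u) (f' := C s * X ^ 1)
      (g' := C u * X ^ 2) ?_ ?_ (h13 _ _) (h12 _ _) (h02 _ _) <;>
    simp only [lin, C_0, C_1] <;> ring
  have h10 : ∀ s u, R (C s * X ^ 1) (C u * X ^ 0) := hR.of_units fun s v e u => by
    refine hR.cancel (hs e 1 0 1 1 0 (by norm_num) u) (f' := C s * X ^ 0)
      (g' := C u * X ^ 1) ?_ ?_ (h00 _ _) (h01 _ _) (h11 _ _) <;>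
    simp only [lin, C_0, C_1] <;> ring
  have h14 : ∀ s u, R (C s * X ^ 1) (C u * X ^ 4) := hR.of_units fun s v e u => by
    refine hR.cancel (hs e 0 1 1 1 2 (by norm_num) u) (f' := C s * X ^ 2)
      (g' := C u * X ^ 3) ?_ ?_ (h24 _ _) (h23 _ _) (h13 _ _) <;>
    simp only [lin, C_0, C_1] <;> ring
  have h21 : ∀ s u, R (C s * X ^ 2) (C u * X ^ 1) := hR.of_units fun s v e u => by
    refine hR.cancel (hs e 0 1 1 1 0 (by norm_num) u) (f' := C s * X ^ 1)
      (g' := C u * X ^ 2) ?_ ?_ (h11 _ _) (h12 _ _) (h22 _ _) <;>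
    simp only [lin, C_0, C_1] <;> ring
  have h04 : ∀ s u, R (C s * X ^ 0) (C u * X ^ 4) := hR.of_units fun s v e u => by
    refine hR.cancel (hs e 1 1 1 1 2 (by norm_num) u)
      (f' := C s * X ^ 1 + C s * X ^ 1 + C s * X ^ 2)
      (g' := C u * X ^ 2 + C u * X ^ 3 + C u * X ^ 3) ?_ ?_ ?_ ?_ ?_
    iterate 2 simp only [lin, C_1]; ring
    all_goals with_reducible repeat' first
      | apply hR.add_left | apply hR.add_right
      | apply h00 | apply h01 | apply h02 | apply h03 | apply h10 | apply h11 | apply h12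
      | apply h13 | apply h14 | apply h21 | apply h22 | apply h23 | apply h24
  have h20 : ∀ s u, R (C s * X ^ 2) (C u * X ^ 0) := hR.of_units fun s v e u => by
    refine hR.cancel (hs e 1 1 1 1 0 (by norm_num) u)
      (f' := C s * X ^ 0 + C s * X ^ 1 + C s * X ^ 1)
      (g' := C u * X ^ 1 + C u * X ^ 1 + C u * X ^ 2) ?_ ?_ ?_ ?_ ?_
    iterate 2 simp only [lin, C_1]; ring
    all_goals with_reducible repeat' first
      | apply hR.add_left | apply hR.add_right
      | apply h00 | apply h01 | apply h02 | apply h03 | apply h04 | apply h10 | apply h11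
      | apply h12 | apply h13 | apply h14 | apply h21 | apply h22
  intro i hi j hj
  interval_cases i <;> interval_cases j <;> with_reducible assumption

/-- Propagation from pairs `(b c, a b c²)`. -/
theorem BiClosed.of_mul_mul_sq [OddScalars S] (hR : BiClosed R)
    (h : ∀ b₀ b₁ c₀ c₁ a₀ a₁, R (lin b₀ b₁ * lin c₀ c₁ ^ 1)
      (lin b₀ b₁ * lin c₀ c₁ ^ 2 * lin a₀ a₁)) :
    ∀ i ≤ 2, ∀ j ≤ 4, ∀ s u, R (C s * X ^ i) (C u * X ^ j) := by
  have hs {s v : S} (hs : s * v = 1) (b₀ b₁ c₀ c₁ a₀ a₁ : S) :=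
    BiClosed.scale_sq (q := fun c => c ^ 2) h hs b₀ b₁ c₀ c₁ a₀ a₁
  have h00 : ∀ s u, R (C s * X ^ 0) (C u * X ^ 0) := hR.of_units fun s v e u => by
    simpa [lin] using hs e 1 0 1 0 u 0
  have h01 : ∀ s u, R (C s * X ^ 0) (C u * X ^ 1) := hR.of_units fun s v e u => by
    simpa [lin] using hs e 1 0 1 0 0 u
  have h11 : ∀ s u, R (C s * X ^ 1) (C u * X ^ 1) := hR.of_units fun s v e u => by
    convert hs e 0 1 1 0 u 0 using 1 <;> simp only [lin, C_0, C_1] <;> ring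
  have h12 : ∀ s u, R (C s * X ^ 1) (C u * X ^ 2) := hR.of_units fun s v e u => by
    convert hs e 0 1 1 0 0 u using 1 <;> simp only [lin, C_0, C_1] <;> ring
  have h13 : ∀ s u, R (C s * X ^ 1) (C u * X ^ 3) := hR.of_units fun s v e u => by
    convert hs e 1 0 0 1 0 u using 1 <;> simp only [lin, C_0, C_1] <;> ring
  have h23 : ∀ s u, R (C s * X ^ 2) (C u * X ^ 3) := hR.of_units fun s v e u => by
    convert hs e 0 1 0 1 u 0 using 1 <;> simp only [lin, C_0, C_1] <;> ring
  have h24 : ∀ s u, R (C s * X ^ 2) (C u * X ^ 4) := hR.of_units fun s v e u => by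
    convert hs e 0 1 0 1 0 u using 1 <;> simp only [lin, C_0, C_1] <;> ring
  have h10 : ∀ s u, R (C s * X ^ 1) (C u * X ^ 0) := hR.of_units fun s v e u => by
    refine hR.cancel (hs e 1 1 1 0 u 0) (f' := C s * X ^ 0)
      (g' := C u * X ^ 1) ?_ ?_ (h00 _ _) (h01 _ _) (h11 _ _) <;>
    simp only [lin, C_0, C_1] <;> ring
  have h02 : ∀ s u, R (C s * X ^ 0) (C u * X ^ 2) := hR.of_units fun s v e u => by
    refine hR.cancel (hs e 1 1 1 0 0 u) (f' := C s * X ^ 1)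
      (g' := C u * X ^ 1) ?_ ?_ (h12 _ _) (h11 _ _) (h01 _ _) <;>
    simp only [lin, C_0, C_1] <;> ring
  have h14 : ∀ s u, R (C s * X ^ 1) (C u * X ^ 4) := hR.of_units fun s v e u => by
    refine hR.cancel (hs e 1 1 0 1 0 u) (f' := C s * X ^ 2)
      (g' := C u * X ^ 3) ?_ ?_ (h24 _ _) (h23 _ _) (h13 _ _) <;>
    simp only [lin, C_0, C_1] <;> ring
  have h22 : ∀ s u, R (C s * X ^ 2) (C u * X ^ 2) := hR.of_units fun s v e u => by
    refine hR.cancel (hs e 1 1 0 1 u 0) (f' := C s * X ^ 1)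
      (g' := C u * X ^ 3) ?_ ?_ (h12 _ _) (h13 _ _) (h23 _ _) <;>
    simp only [lin, C_0, C_1] <;> ring
  have h21 : ∀ s u, R (C s * X ^ 2) (C u * X ^ 1) := hR.of_units fun s v e u => by
    refine hR.cancel (hs e 0 1 1 1 u 0) (f' := C s * X ^ 1)
      (g' := C u * X ^ 2 + C u * X ^ 2 + C u * X ^ 3) ?_ ?_ ?_ ?_ ?_
    iterate 2 simp only [lin, C_0, C_1]; ring
    all_goals with_reducible repeat' first
      | apply hR.add_left | apply hR.add_right
      | apply h00 | apply h01 | apply h02 | apply h10 | apply h11 | apply h12 | apply h13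
      | apply h14 | apply h22 | apply h23
  have h03 : ∀ s u, R (C s * X ^ 0) (C u * X ^ 3) := hR.of_units fun s v e u => by
    refine hR.cancel (hs e 1 0 1 1 0 u) (f' := C s * X ^ 1)
      (g' := C u * X ^ 1 + C u * X ^ 2 + C u * X ^ 2) ?_ ?_ ?_ ?_ ?_
    iterate 2 simp only [lin, C_0, C_1]; ring
    all_goals with_reducible repeat' first
      | apply hR.add_left | apply hR.add_right
      | apply h00 | apply h01 | apply h02 | apply h10 | apply h11 | apply h12 | apply h13
  have h04 : ∀ s u, R (C s * X ^ 0) (C u * X ^ 4) := hR.of_units fun s v e u => by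
    refine hR.cancel (hs e 1 1 1 1 0 u) (f' := C s * X ^ 1 + C s * X ^ 1 + C s * X ^ 2)
      (g' := C u * X ^ 1 + C u * X ^ 2 + C u * X ^ 2 + C u * X ^ 2 +
        C u * X ^ 3 + C u * X ^ 3 + C u * X ^ 3) ?_ ?_ ?_ ?_ ?_
    iterate 2 simp only [lin, C_0, C_1]; ring
    all_goals with_reducible repeat' first
      | apply hR.add_left | apply hR.add_right
      | apply h00 | apply h01 | apply h02 | apply h03 | apply h10 | apply h11 | apply h12
      | apply h13 | apply h14 | apply h21 | apply h22 | apply h23 | apply h24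
  have h20 : ∀ s u, R (C s * X ^ 2) (C u * X ^ 0) := hR.of_units fun s v e u => by
    refine hR.cancel (hs e 1 1 1 1 u 0) (f' := C s * X ^ 0 + C s * X ^ 1 + C s * X ^ 1)
      (g' := C u * X ^ 1 + C u * X ^ 1 + C u * X ^ 1 +
        C u * X ^ 2 + C u * X ^ 2 + C u * X ^ 2 + C u * X ^ 3) ?_ ?_ ?_ ?_ ?_
    iterate 2 simp only [lin, C_0, C_1]; ring
    all_goals with_reducible repeat' first
      | apply hR.add_left | apply hR.add_right
      | apply h00 | apply h01 | apply h02 | apply h03 | apply h04 | apply h10 | apply h11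
      | apply h12 | apply h13 | apply h14 | apply h21 | apply h22 | apply h23
  intro i hi j hj
  interval_cases i <;> interval_cases j <;> with_reducible assumption

end Elimination

/-! ### Balanced biadditive maps -/

/-- The part of a polynomial of degree at most `n`. -/
noncomputable def truncDeg (n : ℕ) (f : S[X]) : S[X] :=
  ∑ i ∈ Finset.range (n + 1), C (f.coeff i) * X ^ i

theorem truncDeg_add (n : ℕ) (f g : S[X]) : truncDeg n (f + g) = truncDeg n f + truncDeg n g := by
  simp [truncDeg, add_mul, Finset.sum_add_distrib]

theorem natDegree_truncDeg_le (n : ℕ) (f : S[X]) : (truncDeg n f).natDegree ≤ n :=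
  natDegree_sum_le_of_forall_le _ _ fun i hi =>
    (natDegree_C_mul_X_pow_le _ _).trans (by have := Finset.mem_range.1 hi; omega)

theorem truncDeg_of_natDegree_le {n : ℕ} {f : S[X]} (hf : f.natDegree ≤ n) :
    truncDeg n f = f :=
  (f.as_sum_range_C_mul_X_pow' (Nat.lt_succ_of_le hf)).symm

theorem truncDeg_high {n i : ℕ} (hi : n < i) (s : S) : truncDeg n (C s * X ^ i) = 0 := by
  refine Finset.sum_eq_zero fun j hj => ?_
  have : j ≠ i := by have := Finset.mem_range.1 hj; omega
  simp [coeff_X_pow, this]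

theorem DegHom.truncDeg {n : ℕ} {φ : S[X] → Γ} (h : DegHom n φ) (f : S[X]) :
    φ (truncDeg n f) = φ f := by
  induction f using Polynomial.induction_on' with
  | add f g hf hg => rw [truncDeg_add, h.add, h.add, hf, hg]
  | monomial i s =>
    rw [← C_mul_X_pow_eq_monomial]
    rcases le_or_gt i n with hi | hi
    · rw [truncDeg_of_natDegree_le ((natDegree_C_mul_X_pow_le _ _).trans hi)]
    · rw [truncDeg_high hi, h.high i s hi, h.zero]

/-- Every value of `φ` is taken at a polynomial of degree at most `n`. -/
theorem DegHom.exists_natDegree_le {n : ℕ} {φ : S[X] → Γ} (h : DegHom n φ) (f : S[X]) :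
    ∃ f' : S[X], f'.natDegree ≤ n ∧ φ f = φ f' :=
  ⟨_, natDegree_truncDeg_le n f, (h.truncDeg f).symm⟩

theorem exists_degHom_of_balanced_of_high {n : ℕ} (hn : 1 ≤ n) {τ : S[X] → S[X] → Γ}
    (addl : ∀ a a' h, τ (a + a') h = τ a h * τ a' h)
    (addr : ∀ a h h', τ a (h + h') = τ a h * τ a h')
    (comm : ∀ a h a' h', Commute (τ a h) (τ a' h'))
    (high : ∀ a j u, n < j → τ a (C u * X ^ j) = 1)
    (bal : ∀ a₀ a₁ b₀ b₁, ∀ j < n, ∀ u, τ (lin a₀ a₁) (lin b₀ b₁ * (C u * X ^ j)) =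
      τ (lin b₀ b₁) (lin a₀ a₁ * (C u * X ^ j))) :
    ∃ D : S[X] → Γ, DegHom (n + 1) D ∧ (∀ k, ∃ h h', D k = τ 1 h * τ X h') ∧
      ∀ a h, a.natDegree ≤ 1 → h.natDegree ≤ n → τ a h = D (a * h) := by
  have z : ∀ a, τ a 0 = 1 := fun a => by simpa using addr a 0 0
  -- The value at `k = k₀ + X k'` is read off from the products `k₀ = 1 k₀` and `X k'`.
  refine ⟨fun k => τ 1 (C (k.coeff 0)) * τ X (divX k), ⟨fun f g => ?_, fun i s hi => ?_⟩,
    fun k => ⟨_, _, rfl⟩, fun a h ha hh => ?_⟩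
  · simp only [coeff_add, C_add, divX_add, addr]
    exact (comm _ _ _ _).mul_mul_mul_comm _ _
  · obtain ⟨i, rfl⟩ : ∃ j, i = j + 1 := ⟨i - 1, by omega⟩
    have : divX (C s * X ^ (i + 1)) = C s * X ^ i := by
      ext j; simp [coeff_divX, coeff_X_pow]
    rw [this, high _ _ _ (by omega)]
    simp [z]
  · have hadd : ∀ f g : S[X], τ 1 (C ((f + g).coeff 0)) * τ X (divX (f + g)) =
        (τ 1 (C (f.coeff 0)) * τ X (divX f)) * (τ 1 (C (g.coeff 0)) * τ X (divX g)) := by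
      intro f g
      simp only [coeff_add, C_add, divX_add, addr]
      exact (comm _ _ _ _).mul_mul_mul_comm _ _
    refine polynomial_induction_of_natDegree_le (P := fun a => τ a h =
      τ 1 (C ((a * h).coeff 0)) * τ X (divX (a * h))) 1 ?_ ?_ ha
    · intro f g hf hg
      simp only [addl, add_mul, hadd, ← hf, ← hg]
    intro i hi s
    refine polynomial_induction_of_natDegree_le (P := fun h => τ (C s * X ^ i) h =
      τ 1 (C ((C s * X ^ i * h).coeff 0)) * τ X (divX (C s * X ^ i * h))) n ?_ ?_ hh
    · intro f g hf hg
      simp only [addr, mul_add, hadd, ← hf, ← hg]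
    intro j hj u
    have e : C s * X ^ i * (C u * X ^ j) = C (s * u) * X ^ (i + j) := by
      rw [C_mul]; ring
    have d0 : ∀ (r : S), divX (C r * X ^ 0) = 0 := fun r => by simp
    have d1 : ∀ (r : S) (m : ℕ), divX (C r * X ^ (m + 1)) = C r * X ^ m := fun r m => by
      ext k; simp [coeff_divX, coeff_X_pow]
    have c1 : ∀ (r : S) (m : ℕ), C ((C r * X ^ (m + 1)).coeff 0) = 0 := fun r m => by simp
    rw [e]
    have l0 : ∀ r : S, lin r 0 = C r := lin_zero_right
    have l1 : ∀ r : S, lin 0 r = C r * X := fun r => by simp [lin]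
    interval_cases i
    · rcases j with _ | j
      · have := bal s 0 1 0 0 (by omega) u
        simp only [l0, C_1, one_mul] at this
        simp only [pow_zero, mul_one] at this ⊢
        rw [this]
        simp [z, C_mul]
      · have := bal s 0 0 1 j (by omega) u
        simp only [l0, l1, C_1, one_mul] at this
        rw [zero_add, c1, d1, z, one_mul, pow_zero, mul_one, C_mul, mul_assoc, ← this]
        congr 1; ring
    · rw [Nat.add_comm 1 j, c1, d1, z, one_mul, pow_one]
      rcases j with _ | j
      · have h₁ := bal 0 s 1 0 0 (by omega) u
        have h₂ := bal 0 1 1 0 0 (by omega) (s * u)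
        simp only [l0, l1, C_1, one_mul] at h₁ h₂
        rw [h₁, h₂, C_mul]
        congr 1; ring
      · have h₁ := bal 0 s 0 1 j (by omega) u
        simp only [l1, C_1, one_mul] at h₁
        rw [show (C u * X ^ (j + 1) : S[X]) = X * (C u * X ^ j) by ring, h₁, C_mul]
        congr 1; ring

/-- A biadditive map `τ` on (linear) × (degree at most `n`) polynomials with
`τ (a, b h) = τ (b, a h)` depends only on the product of its arguments. -/
theorem exists_degHom_of_balanced {n : ℕ} (hn : 1 ≤ n) {τ : S[X] → S[X] → Γ}
    (addl : ∀ a a' h, a.natDegree ≤ 1 → a'.natDegree ≤ 1 → h.natDegree ≤ n →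
      τ (a + a') h = τ a h * τ a' h)
    (addr : ∀ a h h', a.natDegree ≤ 1 → h.natDegree ≤ n → h'.natDegree ≤ n →
      τ a (h + h') = τ a h * τ a h')
    (comm : ∀ a h a' h', a.natDegree ≤ 1 → h.natDegree ≤ n → a'.natDegree ≤ 1 →
      h'.natDegree ≤ n → Commute (τ a h) (τ a' h'))
    (bal : ∀ a₀ a₁ b₀ b₁, ∀ j < n, ∀ u, τ (lin a₀ a₁) (lin b₀ b₁ * (C u * X ^ j)) =
      τ (lin b₀ b₁) (lin a₀ a₁ * (C u * X ^ j))) :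
    ∃ D : S[X] → Γ, DegHom (n + 1) D ∧
      (∀ k, ∃ h h', h.natDegree ≤ n ∧ h'.natDegree ≤ n ∧ D k = τ 1 h * τ X h') ∧
      ∀ a h, a.natDegree ≤ 1 → h.natDegree ≤ n → τ a h = D (a * h) := by
  have t := natDegree_truncDeg_le (S := S)
  have t1 : truncDeg 1 (1 : S[X]) = 1 := truncDeg_of_natDegree_le (by simp)
  have tX : truncDeg 1 (X : S[X]) = X := truncDeg_of_natDegree_le natDegree_X_le
  have z : ∀ a, τ (truncDeg 1 a) 0 = 1 := fun a => by
    simpa using addr (truncDeg 1 a) 0 0 (t _ _) (by simp) (by simp)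
  obtain ⟨D, hD, hv, hD'⟩ := exists_degHom_of_balanced_of_high (n := n) hn
    (τ := fun a h => τ (truncDeg 1 a) (truncDeg n h))
    (fun a a' h => by rw [truncDeg_add]; exact addl _ _ _ (t _ _) (t _ _) (t _ _))
    (fun a h h' => by rw [truncDeg_add]; exact addr _ _ _ (t _ _) (t _ _) (t _ _))
    (fun a h a' h' => comm _ _ _ _ (t _ _) (t _ _) (t _ _) (t _ _))
    (fun a j u hj => by simp only [truncDeg_high hj, z])
    (fun a₀ a₁ b₀ b₁ j hj u => by
      have e : ∀ s r : S, (lin s r * (C u * X ^ j)).natDegree ≤ n := fun s r =>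
        natDegree_mul_le.trans (by
          have := natDegree_lin_le s r
          have := natDegree_C_mul_X_pow_le u j
          omega)
      simp only [truncDeg_of_natDegree_le (natDegree_lin_le _ _), truncDeg_of_natDegree_le (e _ _)]
      exact bal a₀ a₁ b₀ b₁ j hj u)
  refine ⟨D, hD, fun k => ?_, fun a h ha hh => ?_⟩
  · obtain ⟨h, h', e⟩ := hv k
    simp only [t1, tX] at e
    exact ⟨_, _, t _ _, t _ _, e⟩
  · rw [← hD' a h ha hh, truncDeg_of_natDegree_le ha, truncDeg_of_natDegree_le hh]

end Polynomials

open Polynomial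
open scoped commutatorElement

/-! ### Commutator identities -/

section Commutators

variable {Γ : Type*} [Group Γ]

theorem conj_eq_commutator_mul (x y : Γ) : x * y * x⁻¹ = ⁅x, y⁆ * y := by
  rw [commutatorElement_def]; group

theorem conj_commutator (x y z : Γ) : x * ⁅y, z⁆ * x⁻¹ = ⁅x * y * x⁻¹, x * z * x⁻¹⁆ := by
  simp only [commutatorElement_def]; group

theorem conj_eq_of_commute {x y : Γ} (h : Commute x y) : x * y * x⁻¹ = y := by
  rw [h.eq, mul_inv_cancel_right]

theorem commute_of_conj_eq {x y : Γ} (h : x * y * x⁻¹ = y) : Commute x y :=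
  mul_inv_eq_iff_eq_mul.1 h

theorem commute_commutator {g x y : Γ} (hx : Commute g x) (hy : Commute g y) :
    Commute g ⁅x, y⁆ := by
  rw [commutatorElement_def]
  exact ((hx.mul_right hy).mul_right hx.inv_right).mul_right hy.inv_right

theorem commutator_mul_left_of_commute {x y z : Γ} (h : Commute x ⁅y, z⁆) :
    ⁅x * y, z⁆ = ⁅y, z⁆ * ⁅x, z⁆ := by
  have : ⁅x * y, z⁆ = x * ⁅y, z⁆ * x⁻¹ * ⁅x, z⁆ := by simp only [commutatorElement_def]; group
  rw [this, conj_eq_of_commute h]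

theorem commutator_mul_right_of_commute {x y z : Γ} (h : Commute y ⁅x, z⁆) :
    ⁅x, y * z⁆ = ⁅x, y⁆ * ⁅x, z⁆ := by
  have : ⁅x, y * z⁆ = ⁅x, y⁆ * (y * ⁅x, z⁆ * y⁻¹) := by
    simp only [commutatorElement_def]; group
  rw [this, conj_eq_of_commute h]

theorem commutator_eq_one {x y : Γ} (h : Commute x y) : ⁅x, y⁆ = 1 :=
  commutatorElement_eq_one_iff_commute.2 h

/-- A left factor commuting with `y` and `z` drops out of `⁅x * y, z⁆`. -/
theorem commutator_mul_left_cancel {x y z : Γ} (h : Commute x y) (h' : Commute x z) :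
    ⁅x * y, z⁆ = ⁅y, z⁆ := by
  rw [commutator_mul_left_of_commute (commute_commutator h h'), commutator_eq_one h', mul_one]

theorem commutator_mul_right_cancel {x y z : Γ} (h : Commute y x) (h' : Commute y z) :
    ⁅x, y * z⁆ = ⁅x, z⁆ := by
  rw [commutator_mul_right_of_commute (commute_commutator h h'), commutator_eq_one h.symm,
    one_mul]

theorem eq_mul_mul_of_commutator_eq {x y z : Γ} (h : ⁅x, y⁆ = z) : x * y * x⁻¹ = z * y := by
  rw [conj_eq_commutator_mul, h]

end Commutators

section PolynomialDegree

variable {S : Type*} [CommRing S]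

theorem C_mul_X_pow_eq_lin {i : ℕ} (hi : i ≤ 1) (s : S) :
    ∃ a b : S, C s * X ^ i = lin a b := by
  interval_cases i
  · exact ⟨s, 0, by simp [lin]⟩
  · exact ⟨0, s, by simp [lin]⟩

theorem C_mul_X_pow_eq_lin_mul {n i : ℕ} (hi : i ≤ n + 1) (s : S) :
    ∃ (a b : S) (f : S[X]), f.natDegree ≤ n ∧ C s * X ^ i = lin a b * f := by
  rcases i with _ | i
  · exact ⟨s, 0, 1, by simp, by simp [lin]⟩
  · exact ⟨0, s, X ^ i, (natDegree_X_pow_le i).trans (by omega), by simp only [lin, C_0]; ring⟩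

theorem C_mul_X_pow_eq_lin_mul_lin {i : ℕ} (hi : i ≤ 2) (s : S) :
    ∃ a b c d : S, C s * X ^ i = lin a b * lin c d := by
  interval_cases i
  · exact ⟨s, 0, 1, 0, by simp [lin]⟩
  · exact ⟨s, 0, 0, 1, by simp [lin]⟩
  · exact ⟨0, s, 0, 1, by simp only [lin, C_0, C_1]; ring⟩

theorem C_mul_X_pow_eq_lin_mul_lin_sq {i : ℕ} (hi : i ≤ 3) (s : S) :
    ∃ a b c d : S, C s * X ^ i = lin a b * lin c d ^ 2 := by
  interval_cases i
  · exact ⟨s, 0, 1, 0, by simp [lin]⟩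
  · exact ⟨0, s, 1, 0, by simp [lin]⟩
  · exact ⟨s, 0, 0, 1, by simp [lin]⟩
  · exact ⟨0, s, 0, 1, by simp only [lin, C_0, C_1]; ring⟩

theorem C_mul_lin (r s t : S) : C r * lin s t = lin (r * s) (r * t) := by
  simp only [lin, C_mul]; ring

theorem natDegree_mul_le_add {f g : S[X]} {m n k : ℕ} (hf : f.natDegree ≤ m)
    (hg : g.natDegree ≤ n) (h : m + n ≤ k) : (f * g).natDegree ≤ k :=
  natDegree_mul_le.trans (by omega)

end PolynomialDegree

/-! ### The rank two part of type `B_2` -/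

/-- Root elements for the roots `β`, `ψ`, `β + ψ`, `β + 2ψ` (the families `B`, `P`, `BP`, `Q`),
with arguments of degree at most the height of the root, and a scalar `κ` inverse to 2. -/
structure RankTwo (S : Type*) [CommRing S] (Γ : Type*) [Group Γ] where
  B : S[X] → Γ
  P : S[X] → Γ
  BP : S[X] → Γ
  Q : S[X] → Γ
  κ : S
  two_κ : 2 * κ = 1
  hB : DegHom 1 B
  hP : DegHom 1 P
  hBP : DegHom 2 BP
  hQ : DegHom 3 Q
  B_P : ∀ f g, f.natDegree ≤ 1 → g.natDegree ≤ 1 → ⁅B f, P g⁆ = BP (f * g) * Q (f * g ^ 2)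
  BP_P : ∀ f g, f.natDegree ≤ 2 → g.natDegree ≤ 1 → ⁅BP f, P g⁆ = Q (-2 * (f * g))
  B_BP : ∀ f g, Commute (B f) (BP g)
  B_Q : ∀ f g, Commute (B f) (Q g)
  P_Q : ∀ f g, Commute (P f) (Q g)
  BP_Q : ∀ f g, Commute (BP f) (Q g)

namespace RankTwo

variable {S : Type*} [CommRing S] {Γ : Type*} [Group Γ] (L : RankTwo S Γ)

include L in
theorem two_mul_C_κ : (2 : S[X]) * C L.κ = 1 := by
  rw [← C_ofNat, ← C_mul, L.two_κ, C_1]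

theorem P_BP {f g : S[X]} (hf : f.natDegree ≤ 2) (hg : g.natDegree ≤ 1) :
    L.P g * L.BP f * (L.P g)⁻¹ = L.Q (2 * (f * g)) * L.BP f := by
  rw [conj_eq_commutator_mul, ← commutatorElement_inv, L.BP_P f g hf hg, ← L.hQ.neg]
  congr 2; ring

end RankTwo

/-! ### The small link -/

/-- The present root elements of the small link: in addition to those of `RankTwo`, the
families `W`, `PW` belong to `ω` and `ψ + ω`. The last two fields are lifted relations. -/
structure SmallLink (S : Type*) [CommRing S] (Γ : Type*) [Group Γ] extends RankTwo S Γ where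
  W : S[X] → Γ
  PW : S[X] → Γ
  hW : DegHom 1 W
  hPW : DegHom 2 PW
  B_W : ∀ f g, Commute (B f) (W g)
  P_W : ∀ f g, f.natDegree ≤ 1 → g.natDegree ≤ 1 → ⁅P f, W g⁆ = PW (2 * (f * g))
  P_PW : ∀ f g, Commute (P f) (PW g)
  W_PW : ∀ f g, Commute (W f) (PW g)
  lift_Q_W : ∀ a₀ a₁ b₀ b₁ c₀ c₁,
    Commute (Q (lin a₀ a₁ * lin b₀ b₁ ^ 2)) (W (lin c₀ c₁))
  lift_BP_PW : ∀ a₀ a₁ b₀ b₁ c₀ c₁,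
    Commute (BP (lin a₀ a₁ * lin b₀ b₁)) (PW (lin b₀ b₁ * lin c₀ c₁))

namespace SmallLink

variable {S : Type*} [CommRing S] {Γ : Type*} [Group Γ] (L : SmallLink S Γ)

theorem Q_W (f g : S[X]) : Commute (L.Q f) (L.W g) := by
  refine commute_of_monomials L.hQ L.hW (fun i hi j hj s u => ?_) f g
  obtain ⟨a, b, c, d, e⟩ := C_mul_X_pow_eq_lin_mul_lin_sq hi s
  obtain ⟨a', b', e'⟩ := C_mul_X_pow_eq_lin hj u
  rw [e, e']
  exact L.lift_Q_W _ _ _ _ _ _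

theorem BP_PW (f g : S[X]) : Commute (L.BP f) (L.PW g) :=
  commute_of_monomials L.hBP L.hPW
    (BiClosed.of_mul_mul (BiClosed.commute L.hBP L.hPW) L.lift_BP_PW) f g

theorem PW_lin_mul_lin (b₀ b₁ c₀ c₁ : S) : L.PW (lin b₀ b₁ * lin c₀ c₁) =
    ⁅L.P (lin b₀ b₁), L.W (lin (L.κ * c₀) (L.κ * c₁))⁆ := by
  rw [L.P_W _ _ (natDegree_lin_le _ _) (natDegree_lin_le _ _), ← C_mul_lin]
  congr 1
  linear_combination (-lin b₀ b₁ * lin c₀ c₁) * L.two_mul_C_κ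

theorem Q_PW (f g : S[X]) : Commute (L.Q f) (L.PW g) := by
  refine L.hPW.commute_of_mono (fun i hi s => ?_) g
  obtain ⟨a, b, c, d, e⟩ := C_mul_X_pow_eq_lin_mul_lin hi s
  rw [e, L.PW_lin_mul_lin]
  exact commute_commutator (L.P_Q _ _).symm (L.Q_W _ _)

/-- Commuting with all present root elements. -/
structure IsCentral (x : Γ) : Prop where
  B : ∀ f, Commute x (L.B f)
  P : ∀ f, Commute x (L.P f)
  W : ∀ f, Commute x (L.W f)
  BP : ∀ f, Commute x (L.BP f)
  Q : ∀ f, Commute x (L.Q f)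
  PW : ∀ f, Commute x (L.PW f)

variable {L}

theorem IsCentral.mul {x y : Γ} (hx : L.IsCentral x) (hy : L.IsCentral y) :
    L.IsCentral (x * y) where
  B f := (hx.B f).mul_left (hy.B f)
  P f := (hx.P f).mul_left (hy.P f)
  W f := (hx.W f).mul_left (hy.W f)
  BP f := (hx.BP f).mul_left (hy.BP f)
  Q f := (hx.Q f).mul_left (hy.Q f)
  PW f := (hx.PW f).mul_left (hy.PW f)

variable (L)

/-- Conjugating `PW (2bc) = ⁅P b, W c⁆` by `B a` yields the two expressions for the missing
root element. -/
theorem B_PW_eq_BP_W {a b c : S[X]} (ha : a.natDegree ≤ 1) (hb : b.natDegree ≤ 1)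
    (hc : c.natDegree ≤ 1) : ⁅L.B a, L.PW (2 * (b * c))⁆ = ⁅L.BP (a * b), L.W c⁆ := by
  have h₁ : L.B a * L.PW (2 * (b * c)) * (L.B a)⁻¹ =
      L.PW (2 * (b * c)) * ⁅L.BP (a * b), L.W c⁆ := by
    rw [← L.P_W b c hb hc, conj_commutator, conj_eq_of_commute (L.B_W _ _), conj_eq_commutator_mul,
      L.B_P a b ha hb, mul_assoc, commutator_mul_left_of_commute, commutator_mul_left_cancel]
    · exact (L.P_Q _ _).symm
    · exact L.Q_W _ _
    · rw [commutator_mul_left_cancel (L.P_Q _ _).symm (L.Q_W _ _), L.P_W b c hb hc]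
      exact L.BP_PW _ _
  rw [commutatorElement_def, h₁, mul_inv_eq_iff_eq_mul]
  exact commute_commutator (L.BP_PW _ _).symm (L.W_PW _ _).symm

theorem isCentral_B_PW_mul {a b c : S[X]} (ha : a.natDegree ≤ 1) (hb : b.natDegree ≤ 1)
    (hc : c.natDegree ≤ 1) : L.IsCentral ⁅L.B a, L.PW (2 * (b * c))⁆ := by
  have e := L.B_PW_eq_BP_W ha hb hc
  refine ⟨fun f => ?_, fun f => ?_, fun f => ?_, fun f => ?_, fun f => ?_, fun f => ?_⟩
  · rw [e]; exact (commute_commutator (L.B_BP _ _) (L.B_W _ _)).symm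
  · obtain ⟨d, hd, e'⟩ := L.hP.exists_natDegree_le f
    rw [e', e]
    refine (commute_of_conj_eq ?_).symm
    rw [conj_commutator, L.P_BP (natDegree_mul_le_add ha hb le_rfl) hd,
      eq_mul_mul_of_commutator_eq (L.P_W d c hd hc), commutator_mul_left_cancel (L.BP_Q _ _).symm,
      commutator_mul_right_cancel (L.BP_PW _ _).symm (L.W_PW _ _).symm]
    exact (L.Q_PW _ _).mul_right (L.Q_W _ _)
  · exact (commute_commutator (L.B_W _ _).symm (L.W_PW _ _)).symm
  · exact (commute_commutator (L.B_BP _ _).symm (L.BP_PW _ _)).symm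
  · exact (commute_commutator (L.B_Q _ _).symm (L.Q_PW _ _)).symm
  · rw [e]; exact (commute_commutator (L.BP_PW _ _).symm (L.W_PW _ _).symm).symm

theorem isCentral_B_PW_and_add {a : S[X]} (ha : a.natDegree ≤ 1) {g : S[X]}
    (hg : g.natDegree ≤ 2) : L.IsCentral ⁅L.B a, L.PW g⁆ := by
  refine polynomial_induction_of_natDegree_le (P := fun g => L.IsCentral ⁅L.B a, L.PW g⁆) 2
    (fun f g hf hg => ?_) (fun i hi s => ?_) hg
  · rw [L.hPW.add, commutator_mul_right_of_commute (hg.PW _).symm]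
    exact hf.mul hg
  · obtain ⟨b₀, b₁, c₀, c₁, e⟩ := C_mul_X_pow_eq_lin_mul_lin hi s
    convert L.isCentral_B_PW_mul ha (natDegree_lin_le b₀ b₁)
      (natDegree_lin_le (L.κ * c₀) (L.κ * c₁)) using 3
    rw [e, ← C_mul_lin]
    linear_combination (-lin b₀ b₁ * lin c₀ c₁) * L.two_mul_C_κ

/-- The family `T` of root elements for the missing root `β + ψ + ω` exists and satisfies
all commutation relations. -/
theorem exists_completion : ∃ T : S[X] → Γ, DegHom 3 T ∧ (∀ f, L.IsCentral (T f)) ∧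
    (∀ a g, a.natDegree ≤ 1 → g.natDegree ≤ 2 → ⁅L.B a, L.PW g⁆ = T (a * g)) ∧
    (∀ g c, g.natDegree ≤ 2 → c.natDegree ≤ 1 → ⁅L.BP g, L.W c⁆ = T (2 * (g * c))) := by
  have cen {a g : S[X]} (ha : a.natDegree ≤ 1) (hg : g.natDegree ≤ 2) :=
    L.isCentral_B_PW_and_add ha hg
  have comm {a g : S[X]} {x : Γ} (hx : L.IsCentral x) : Commute x ⁅L.B a, L.PW g⁆ :=
    commute_commutator (hx.B _) (hx.PW _)
  obtain ⟨T, hT, hv, hBT⟩ := exists_degHom_of_balanced (n := 2) (by norm_num)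
    (τ := fun a g => ⁅L.B a, L.PW g⁆)
    (fun a a' h ha ha' hh => by
      rw [L.hB.add, commutator_mul_left_of_commute ((cen ha' hh).B _).symm]
      exact comm (cen ha' hh))
    (fun a h h' ha hh hh' => by
      rw [L.hPW.add, commutator_mul_right_of_commute ((cen ha hh').PW _).symm])
    (fun a h a' h' ha hh ha' hh' => comm (cen ha hh))
    (fun a₀ a₁ b₀ b₁ j hj u => by
      obtain ⟨c₀, c₁, e⟩ := C_mul_X_pow_eq_lin (Nat.le_of_lt_succ hj) (L.κ * u)
      have e' : ∀ p : S[X], p * (C u * X ^ j) = 2 * (p * lin c₀ c₁) := fun p => by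
        rw [← e, C_mul]
        linear_combination (-p * (C u * X ^ j)) * L.two_mul_C_κ
      rw [e', e', L.B_PW_eq_BP_W, L.B_PW_eq_BP_W, mul_comm (lin a₀ a₁)] <;>
        exact natDegree_lin_le _ _)
  refine ⟨T, hT, fun k => ?_, hBT, fun g c hg hc => ?_⟩
  · obtain ⟨h, h', hh, hh', e⟩ := hv k
    rw [e]
    exact (cen (by simp) hh).mul (cen natDegree_X_le hh')
  · refine polynomial_induction_of_natDegree_le
      (P := fun g => ⁅L.BP g, L.W c⁆ = T (2 * (g * c))) 2 (fun f g hf hg => ?_)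
      (fun i hi s => ?_) hg
    · have h : L.IsCentral (T (2 * (g * c))) := by
        obtain ⟨h, h', hh, hh', e⟩ := hv (2 * (g * c))
        rw [e]
        exact (cen (by simp) hh).mul (cen natDegree_X_le hh')
      rw [L.hBP.add, commutator_mul_left_of_commute (by rw [hg]; exact (h.BP _).symm), hf, hg,
        ← hT.add]
      congr 1; ring
    · obtain ⟨a₀, a₁, b₀, b₁, e⟩ := C_mul_X_pow_eq_lin_mul_lin hi s
      have hl := fun s t : S => natDegree_lin_le s t
      have hd : (2 * (lin b₀ b₁ * c)).natDegree ≤ 2 :=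
        natDegree_mul_le_add (m := 0) (by rw [← C_ofNat, natDegree_C])
          (natDegree_mul_le_add (hl _ _) hc le_rfl) (by norm_num)
      rw [e, ← L.B_PW_eq_BP_W (hl _ _) (hl _ _) hc, hBT _ _ (hl _ _) hd]
      congr 1; ring

end SmallLink

/-! ### The large link -/

/-- The present root elements of the large link: in addition to those of `RankTwo`, the
families `A`, `AB` belong to `α` and `α + β`. The last six fields are lifted relations. -/
structure LargeLink (S : Type*) [CommRing S] (Γ : Type*) [Group Γ] extends RankTwo S Γ where
  A : S[X] → Γ
  AB : S[X] → Γ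
  hA : DegHom 1 A
  hAB : DegHom 2 AB
  A_B : ∀ f g, f.natDegree ≤ 1 → g.natDegree ≤ 1 → ⁅A f, B g⁆ = AB (f * g)
  A_P : ∀ f g, Commute (A f) (P g)
  A_AB : ∀ f g, Commute (A f) (AB g)
  B_AB : ∀ f g, Commute (B f) (AB g)
  lift_AB_BP : ∀ a₀ a₁ b₀ b₁ c₀ c₁,
    Commute (AB (lin a₀ a₁ * lin b₀ b₁)) (BP (lin b₀ b₁ * lin c₀ c₁))
  lift_short : ∀ a₀ a₁ b₀ b₁ c₀ c₁,
    BP (-(C κ * (lin b₀ b₁ * lin c₀ c₁))) * A (lin a₀ a₁) * BP (lin b₀ b₁ * lin c₀ c₁) *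
        A (-lin a₀ a₁) * BP (-(C κ * (lin b₀ b₁ * lin c₀ c₁))) =
      P (-(C κ * lin c₀ c₁)) * ⁅AB (lin a₀ a₁ * lin b₀ b₁), P (lin c₀ c₁)⁆ *
        P (C κ * lin c₀ c₁)
  lift_short_P : ∀ a₀ a₁ b₀ b₁ c₀ c₁,
    ⁅P (-(C κ * lin c₀ c₁)) * ⁅AB (lin a₀ a₁ * lin b₀ b₁), P (lin c₀ c₁)⁆ *
      P (C κ * lin c₀ c₁), P (lin c₀ c₁)⁆ =
      ⁅A (lin a₀ a₁), Q (-2 * (lin b₀ b₁ * lin c₀ c₁ ^ 2))⁆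
  lift_Q_conj_BP : ∀ a₀ a₁ b₀ b₁ c₀ c₁, Commute (Q (lin b₀ b₁ * lin c₀ c₁ ^ 2))
    (A (lin a₀ a₁) * BP (lin b₀ b₁ * lin c₀ c₁) * (A (lin a₀ a₁))⁻¹)
  lift_AB_comm : ∀ a₀ a₁ b₀ b₁ c₀ c₁, Commute (AB (lin a₀ a₁ * lin b₀ b₁))
    ⁅A (lin a₀ a₁), Q (lin b₀ b₁ * lin c₀ c₁ ^ 2)⁆
  lift_BP_comm : ∀ a₀ a₁ b₀ b₁ c₀ c₁, Commute (BP (lin b₀ b₁ * lin c₀ c₁))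
    ⁅A (lin a₀ a₁), Q (lin b₀ b₁ * lin c₀ c₁ ^ 2)⁆

theorem DegHom.exists_lin {S : Type*} [CommRing S] {Γ : Type*} [Group Γ] {φ : S[X] → Γ}
    (h : DegHom 1 φ) (f : S[X]) : ∃ s t, φ f = φ (lin s t) := by
  obtain ⟨f', hf, e⟩ := h.exists_natDegree_le f
  exact ⟨_, _, e.trans (congrArg φ (eq_lin_of_natDegree_le hf))⟩

theorem DegHom.mul_self_κ {S : Type*} [CommRing S] {Γ : Type*} [Group Γ] {φ : S[X] → Γ} {n : ℕ}
    (h : DegHom n φ) {κ : S} (hκ : 2 * κ = 1) (f : S[X]) :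
    φ (C κ * f) * φ (C κ * f) = φ f := by
  have : (2 : S[X]) * C κ = 1 := by rw [← C_ofNat, ← C_mul, hκ, C_1]
  rw [← h.add]
  congr 1
  linear_combination f * this

namespace LargeLink

variable {S : Type*} [CommRing S] {Γ : Type*} [Group Γ] (L : LargeLink S Γ)

theorem AB_BP (f g : S[X]) : Commute (L.AB f) (L.BP g) :=
  commute_of_monomials L.hAB L.hBP
    (BiClosed.of_mul_mul (BiClosed.commute L.hAB L.hBP) L.lift_AB_BP) f g

/-! #### The root `α + β + 2ψ` -/

/-- Conjugating the lifted relation between `β + 2ψ` and `β + ψ` by `P d`. -/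
theorem Q_conj_Q_aux (a₀ a₁ b₀ b₁ c₀ c₁ d₀ d₁ : S) :
    Commute (L.Q (lin b₀ b₁ * lin c₀ c₁ ^ 2)) (L.A (lin a₀ a₁) *
      L.Q (lin b₀ b₁ * lin c₀ c₁ * lin d₀ d₁) * (L.A (lin a₀ a₁))⁻¹) := by
  have h := L.lift_Q_conj_BP a₀ a₁ b₀ b₁ c₀ c₁
  have hbc : (lin b₀ b₁ * lin c₀ c₁).natDegree ≤ 2 :=
    natDegree_mul_le_add (natDegree_lin_le b₀ b₁) (natDegree_lin_le c₀ c₁) le_rfl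
  generalize lin a₀ a₁ = a, lin b₀ b₁ = b, lin c₀ c₁ = c at h hbc ⊢
  obtain ⟨d, hd⟩ : ∃ d, d = C L.κ * lin d₀ d₁ := ⟨_, rfl⟩
  have hdd : d.natDegree ≤ 1 := by rw [hd, C_mul_lin]; exact natDegree_lin_le _ _
  have h₁ : L.P d * (L.A a * L.BP (b * c) * (L.A a)⁻¹) * (L.P d)⁻¹ =
      L.A a * L.Q (b * c * lin d₀ d₁) * (L.A a)⁻¹ * (L.A a * L.BP (b * c) * (L.A a)⁻¹) := by
    have e : b * c * lin d₀ d₁ = 2 * (b * c * d) := by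
      rw [hd]; linear_combination (-b * c * lin d₀ d₁) * L.two_mul_C_κ
    have h₂ := L.P_BP hbc hdd
    rw [← e] at h₂
    calc _ = L.P d * L.A a * L.BP (b * c) * (L.P d * L.A a)⁻¹ := by group
      _ = L.A a * (L.P d * L.BP (b * c) * (L.P d)⁻¹) * (L.A a)⁻¹ := by
        rw [← (L.A_P a d).eq]; group
      _ = _ := by rw [h₂]; group
  have h₂ : Commute (L.Q (b * c ^ 2)) (L.P d * (L.A a * L.BP (b * c) * (L.A a)⁻¹) * (L.P d)⁻¹) :=
    have := (L.P_Q d (b * c ^ 2)).symm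
    (this.mul_right h).mul_right this.inv_right
  rw [h₁] at h₂
  have h₃ := h₂.mul_right h.inv_right
  rwa [mul_inv_cancel_right] at h₃

theorem Q_conj_Q [OddScalars S] (a u v : S[X]) :
    Commute (L.Q u) (L.A a * L.Q v * (L.A a)⁻¹) := by
  obtain ⟨a₀, a₁, e⟩ := L.hA.exists_lin a
  rw [e]
  refine commute_of_monomials L.hQ (L.hQ.conj _) (BiClosed.of_mul_sq
    (BiClosed.commute L.hQ (L.hQ.conj _)) (fun b₀ b₁ c₀ c₁ d₀ d₁ => ?_)
    (fun b₀ b₁ c₀ c₁ d₀ d₁ => ?_)) u v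
  · exact L.Q_conj_Q_aux _ _ _ _ _ _ _ _
  · have h := L.Q_conj_Q_aux (-a₀) (-a₁) b₀ b₁ c₀ c₁ d₀ d₁
    have e : L.A (lin (-a₀) (-a₁)) = (L.A (lin a₀ a₁))⁻¹ := by
      rw [← L.hA.neg]; congr 1; simp only [lin, C_neg]; ring
    rw [e, inv_inv] at h
    have h' := (Commute.conj_iff (L.A (lin a₀ a₁))).2 h
    simpa [mul_assoc] using h'.symm

theorem Q_comm_AQ [OddScalars S] (u a v : S[X]) : Commute (L.Q u) ⁅L.A a, L.Q v⁆ := by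
  rw [commutatorElement_def]
  exact (L.Q_conj_Q a u v).mul_right (L.hQ.comm _ _).inv_right

theorem degHom_AQ [OddScalars S] (a : S[X]) : DegHom 3 fun h => ⁅L.A a, L.Q h⁆ where
  add f g := by
    rw [L.hQ.add, commutator_mul_right_of_commute (L.Q_comm_AQ _ _ _)]
  high i s hi := by rw [L.hQ.high i s hi]; exact commutator_eq_one (Commute.one_right _)

/-- The elements `⁅A a, Q (-2 b c²)⁆` are expressed by `AB (a b)` and `P c`, which commute with
all `A a'`, and the arguments `-2 b c²` span. -/
theorem A_comm_AQ [OddScalars S] (a' a h : S[X]) : Commute (L.A a') ⁅L.A a, L.Q h⁆ := by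
  obtain ⟨a₀, a₁, e⟩ := L.hA.exists_lin a
  rw [e]
  refine (L.degHom_AQ _).commute_of_mono (fun i hi s => ?_) h
  obtain ⟨b₀, b₁, c₀, c₁, e'⟩ := C_mul_X_pow_eq_lin_mul_lin_sq hi (-L.κ * s)
  have := L.lift_short_P a₀ a₁ b₀ b₁ c₀ c₁
  have e₂ : C s * X ^ i = -2 * (lin b₀ b₁ * lin c₀ c₁ ^ 2) := by
    rw [← e', C_mul, C_neg]; linear_combination (-C s * X ^ i) * L.two_mul_C_κ
  rw [e₂, ← this]
  have hP := fun f => L.A_P a' f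
  exact commute_commutator (((hP _).mul_right
    (commute_commutator (L.A_AB _ _) (hP _))).mul_right (hP _)) (hP _)

theorem AQ_comm_AQ [OddScalars S] (a h a' h' : S[X]) :
    Commute ⁅L.A a, L.Q h⁆ ⁅L.A a', L.Q h'⁆ :=
  commute_commutator (L.A_comm_AQ _ _ _).symm (L.Q_comm_AQ _ _ _).symm

theorem AQ_add_left [OddScalars S] (a a' h : S[X]) :
    ⁅L.A (a + a'), L.Q h⁆ = ⁅L.A a, L.Q h⁆ * ⁅L.A a', L.Q h⁆ := by
  rw [L.hA.add, commutator_mul_left_of_commute (L.A_comm_AQ _ _ _)]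
  exact L.AQ_comm_AQ _ _ _ _

/-- The expression of `⁅A a, Q (-2 b c²)⁆` by `AB (a b)` and `P c` is symmetric in `a` and `b`. -/
theorem AQ_balanced [OddScalars S] (a₀ a₁ b₀ b₁ : S) : ∀ j < 3, ∀ u : S,
    ⁅L.A (lin a₀ a₁), L.Q (lin b₀ b₁ * (C u * X ^ j))⁆ =
      ⁅L.A (lin b₀ b₁), L.Q (lin a₀ a₁ * (C u * X ^ j))⁆ := by
  intro j hj u
  have := square_induction (P := fun k => ⁅L.A (lin a₀ a₁), L.Q (-2 * (lin b₀ b₁ * k))⁆ =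
      ⁅L.A (lin b₀ b₁), L.Q (-2 * (lin a₀ a₁ * k))⁆)
    (fun f g hf hg => by
      simp only [mul_sub, (L.degHom_AQ (lin a₀ a₁)).sub, (L.degHom_AQ (lin b₀ b₁)).sub, hf, hg])
    (fun c₀ c₁ => by rw [← L.lift_short_P, ← L.lift_short_P, mul_comm (lin a₀ a₁)])
    j (by omega) (-L.κ * u)
  have e : ∀ p : S[X], -2 * (p * (C (-L.κ * u) * X ^ j)) = p * (C u * X ^ j) := fun p => by
    rw [C_mul, C_neg]; linear_combination (p * C u * X ^ j) * L.two_mul_C_κ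
  simpa only [e] using this

/-- The root elements `D` of `α + β + 2ψ`, with those of their commutation relations that follow
from `D (a h) = ⁅A a, Q h⁆` and the lifted relations. -/
structure IsD (D : S[X] → Γ) : Prop where
  hD : DegHom 4 D
  A_Q : ∀ a h, a.natDegree ≤ 1 → h.natDegree ≤ 3 → ⁅L.A a, L.Q h⁆ = D (a * h)
  A_D : ∀ f g, Commute (L.A f) (D g)
  P_D : ∀ f g, Commute (L.P f) (D g)
  Q_D : ∀ f g, Commute (L.Q f) (D g)
  AB_D : ∀ f g, Commute (L.AB f) (D g)
  BP_D : ∀ f g, Commute (L.BP f) (D g)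

theorem exists_D [OddScalars S] : ∃ D, L.IsD D := by
  obtain ⟨D, hD, hv, hAQ⟩ := exists_degHom_of_balanced (n := 3) (by norm_num)
    (τ := fun a h => ⁅L.A a, L.Q h⁆)
    (fun a a' h _ _ _ => L.AQ_add_left a a' h)
    (fun a h h' _ _ _ => (L.degHom_AQ a).add h h')
    (fun a h a' h' _ _ _ _ => L.AQ_comm_AQ a h a' h')
    L.AQ_balanced
  have hl := fun s t : S => natDegree_lin_le s t
  have hd : ∀ b₀ b₁ c₀ c₁ : S, (lin b₀ b₁ * lin c₀ c₁ ^ 2).natDegree ≤ 3 :=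
    fun b₀ b₁ c₀ c₁ => natDegree_mul_le_add (n := 2) (hl _ _)
      (natDegree_pow_le_of_le 2 (hl _ _)) le_rfl
  refine ⟨D, hD, hAQ, fun f g => ?_, fun f g => ?_, fun f g => ?_, ?_, ?_⟩
  · obtain ⟨h, h', -, -, e⟩ := hv g
    rw [e]
    exact (L.A_comm_AQ _ _ _).mul_right (L.A_comm_AQ _ _ _)
  · obtain ⟨h, h', -, -, e⟩ := hv g
    rw [e]
    have := fun a h => commute_commutator (L.A_P a f).symm (L.P_Q f h)
    exact (this _ _).mul_right (this _ _)
  · obtain ⟨h, h', -, -, e⟩ := hv g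
    rw [e]
    exact (L.Q_comm_AQ _ _ _).mul_right (L.Q_comm_AQ _ _ _)
  · refine commute_of_monomials L.hAB hD (BiClosed.of_mul_self_sq
      (BiClosed.commute L.hAB hD) fun a₀ a₁ b₀ b₁ c₀ c₁ => ?_)
    rw [mul_assoc (lin a₀ a₁) (lin b₀ b₁) (lin c₀ c₁ ^ 2), ← hAQ _ _ (hl _ _) (hd _ _ _ _)]
    exact L.lift_AB_comm _ _ _ _ _ _
  · refine commute_of_monomials L.hBP hD (BiClosed.of_mul_mul_sq
      (BiClosed.commute L.hBP hD) fun b₀ b₁ c₀ c₁ a₀ a₁ => ?_)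
    rw [mul_comm _ (lin a₀ a₁), ← hAQ _ _ (hl _ _) (hd _ _ _ _), pow_one]
    exact L.lift_BP_comm _ _ _ _ _ _

/-! #### The root `α + 2β + 2ψ` -/

section Highest

variable {L} {D : S[X] → Γ} (hD : L.IsD D)

include hD

theorem IsD.AQ_eq (a h : S[X]) : ∃ k, ⁅L.A a, L.Q h⁆ = D k := by
  obtain ⟨a', ha, e⟩ := L.hA.exists_natDegree_le a
  obtain ⟨h', hh, e'⟩ := L.hQ.exists_natDegree_le h
  exact ⟨_, by rw [e, e', hD.A_Q _ _ ha hh]⟩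

theorem IsD.Q_conj_A {a h : S[X]} (ha : a.natDegree ≤ 1) (hh : h.natDegree ≤ 3) :
    L.Q h * L.A a * (L.Q h)⁻¹ = D (-(a * h)) * L.A a := by
  rw [conj_eq_commutator_mul, ← commutatorElement_inv, hD.A_Q _ _ ha hh, hD.hD.neg]

/-- Conjugating `⁅A a, B b⁆ = AB (a b)` by `Q h`. -/
theorem IsD.AB_Q_mul {a b h : S[X]} (ha : a.natDegree ≤ 1) (hb : b.natDegree ≤ 1)
    (hh : h.natDegree ≤ 3) : ⁅L.AB (a * b), L.Q h⁆ = (⁅L.B b, D (a * h)⁆)⁻¹ := by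
  have h₁ : L.Q h * L.AB (-(a * b)) * (L.Q h)⁻¹ = L.AB (-(a * b)) * ⁅D (a * h), L.B b⁆ := by
    have e : -(a * b) = -a * b := by ring
    have e' : a * h = -(-a * h) := by ring
    have hd : (-a).natDegree ≤ 1 := by rwa [natDegree_neg]
    rw [e, ← L.A_B _ _ hd hb, conj_commutator, conj_eq_of_commute (L.B_Q _ _).symm,
      hD.Q_conj_A hd hh, ← e']
    have : ⁅D (a * h) * L.A (-a), L.B b⁆ =
        D (a * h) * ⁅L.A (-a), L.B b⁆ * (D (a * h))⁻¹ * ⁅D (a * h), L.B b⁆ := by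
      simp only [commutatorElement_def]; group
    rw [this, conj_eq_of_commute]
    rw [L.A_B _ _ hd hb]
    exact (hD.AB_D _ _).symm
  rw [commutatorElement_inv, ← mul_right_inj (L.AB (-(a * b))), ← h₁, L.hAB.neg]
  simp only [commutatorElement_def]; group

theorem IsD.D_conj_B (b k k' : S[X]) : Commute (D k') (L.B b * D k * (L.B b)⁻¹) := by
  obtain ⟨b₀, b₁, e⟩ := L.hB.exists_lin b
  rw [e]
  refine (hD.hD.conj _).commute_of_mono (fun i hi s => ?_) k
  obtain ⟨a₀, a₁, h, hh, e'⟩ := C_mul_X_pow_eq_lin_mul hi s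
  rw [e', conj_eq_commutator_mul, ← inv_inv ⁅L.B _, D _⁆,
    ← hD.AB_Q_mul (natDegree_lin_le _ _) (natDegree_lin_le _ _) hh]
  exact (commute_commutator (hD.AB_D _ _).symm (hD.Q_D _ _).symm).inv_right.mul_right
    (hD.hD.comm _ _)

theorem IsD.D_comm_BD (b k k' : S[X]) : Commute (D k') ⁅L.B b, D k⁆ := by
  rw [commutatorElement_def]
  exact (hD.D_conj_B _ _ _).mul_right (hD.hD.comm _ _).inv_right

theorem IsD.degHom_BD (b : S[X]) : DegHom 4 fun k => ⁅L.B b, D k⁆ where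
  add f g := by rw [hD.hD.add, commutator_mul_right_of_commute (hD.D_comm_BD _ _ _)]
  high i s hi := by rw [hD.hD.high i s hi]; exact commutator_eq_one (Commute.one_right _)

variable (L) in
/-- Commuting with all present root elements and with those of `α + β + 2ψ`. -/
structure IsCentral (D : S[X] → Γ) (x : Γ) : Prop where
  A : ∀ f, Commute x (L.A f)
  B : ∀ f, Commute x (L.B f)
  P : ∀ f, Commute x (L.P f)
  AB : ∀ f, Commute x (L.AB f)
  BP : ∀ f, Commute x (L.BP f)
  Q : ∀ f, Commute x (L.Q f)
  D : ∀ f, Commute x (D f)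

omit hD in
theorem IsCentral.mul {x y : Γ} (hx : L.IsCentral D x) (hy : L.IsCentral D y) :
    L.IsCentral D (x * y) where
  A f := (hx.A f).mul_left (hy.A f)
  B f := (hx.B f).mul_left (hy.B f)
  P f := (hx.P f).mul_left (hy.P f)
  AB f := (hx.AB f).mul_left (hy.AB f)
  BP f := (hx.BP f).mul_left (hy.BP f)
  Q f := (hx.Q f).mul_left (hy.Q f)
  D f := (hx.D f).mul_left (hy.D f)

/-- Commutation with `A`, `P` follows from conjugating the commutator `⁅B b, D k⁆`, commutation
with `B` from its expression as a commutator of elements of the families `AB` and `Q`. -/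
theorem IsD.isCentral_BD (b k : S[X]) : L.IsCentral D ⁅L.B b, D k⁆ := by
  obtain ⟨b₀, b₁, e⟩ := L.hB.exists_lin b
  rw [e]
  have hAB : ∀ f, Commute (L.AB f) ⁅L.B (lin b₀ b₁), D k⁆ := fun f =>
    commute_commutator (L.B_AB _ _).symm (hD.AB_D _ _)
  have hBP : ∀ f, Commute (L.BP f) ⁅L.B (lin b₀ b₁), D k⁆ := fun f =>
    commute_commutator (L.B_BP _ _).symm (hD.BP_D _ _)
  have hQ : ∀ f, Commute (L.Q f) ⁅L.B (lin b₀ b₁), D k⁆ := fun f =>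
    commute_commutator (L.B_Q _ _).symm (hD.Q_D _ _)
  refine ⟨fun f => ?_, fun f => ?_, fun f => ?_, fun f => (hAB f).symm, fun f => (hBP f).symm,
    fun f => (hQ f).symm, fun f => (hD.D_comm_BD _ _ _).symm⟩
  · obtain ⟨a, ha, e'⟩ := L.hA.exists_natDegree_le f
    rw [e']
    refine (commute_of_conj_eq ?_).symm
    rw [conj_commutator, conj_eq_of_commute (hD.A_D _ _), conj_eq_commutator_mul,
      L.A_B _ _ ha (natDegree_lin_le _ _)]
    exact commutator_mul_left_cancel (L.B_AB _ _).symm (hD.AB_D _ _)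
  · symm
    refine (hD.degHom_BD _).commute_of_mono (fun i hi s => ?_) k
    obtain ⟨a₀, a₁, h, hh, e'⟩ := C_mul_X_pow_eq_lin_mul hi s
    rw [e', ← inv_inv ⁅L.B (lin _ _), D _⁆,
      ← hD.AB_Q_mul (natDegree_lin_le _ _) (natDegree_lin_le _ _) hh]
    exact (commute_commutator (L.B_AB _ _) (L.B_Q _ _)).inv_right
  · obtain ⟨d, hd, e'⟩ := L.hP.exists_natDegree_le f
    rw [e']
    refine (commute_of_conj_eq ?_).symm
    rw [conj_commutator, conj_eq_of_commute (hD.P_D _ _), conj_eq_commutator_mul,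
      ← commutatorElement_inv (L.B _) (L.P d), L.B_P _ _ (natDegree_lin_le _ _) hd]
    exact commutator_mul_left_cancel ((L.B_BP _ _).mul_right (L.B_Q _ _)).inv_right.symm
      ((hD.BP_D _ _).mul_left (hD.Q_D _ _)).inv_left

/-- The root elements `E` of `α + 2β + 2ψ`; they are central. -/
structure IsE (D E : S[X] → Γ) : Prop where
  hE : DegHom 5 E
  central : ∀ k, L.IsCentral D (E k)
  E_E : ∀ k k', Commute (E k) (E k')
  B_D : ∀ b k, b.natDegree ≤ 1 → k.natDegree ≤ 4 → ⁅L.B b, D k⁆ = E (b * k)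
  AB_Q : ∀ f h, f.natDegree ≤ 2 → h.natDegree ≤ 3 → ⁅L.AB f, L.Q h⁆ = E (-(f * h))

theorem IsD.exists_E : ∃ E, L.IsE D E := by
  have comm : ∀ {x : Γ}, L.IsCentral D x → ∀ b k, Commute x ⁅L.B b, D k⁆ := fun hx b k =>
    commute_commutator (hx.B _) (hx.D _)
  have cen := hD.isCentral_BD
  obtain ⟨E, hE, hv, hBD⟩ := exists_degHom_of_balanced (n := 4) (by norm_num)
    (τ := fun b k => ⁅L.B b, D k⁆)
    (fun b b' k _ _ _ => by
      rw [L.hB.add, commutator_mul_left_of_commute ((cen _ _).B _).symm]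
      exact comm (cen _ _) _ _)
    (fun b h h' _ _ _ => (hD.degHom_BD b).add h h')
    (fun a h a' h' _ _ _ _ => comm (cen _ _) _ _)
    -- Both sides are the inverse of the commutator of `AB (a b)` with one element of `Q`.
    (fun a₀ a₁ b₀ b₁ j hj u => by
      have hh : (C u * X ^ j).natDegree ≤ 3 := (natDegree_C_mul_X_pow_le _ _).trans (by omega)
      rw [← inv_inj, ← hD.AB_Q_mul (natDegree_lin_le _ _) (natDegree_lin_le _ _) hh,
        ← hD.AB_Q_mul (natDegree_lin_le _ _) (natDegree_lin_le _ _) hh, mul_comm (lin a₀ a₁)])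
  have hcE : ∀ k, L.IsCentral D (E k) := fun k => by
    obtain ⟨h, h', -, -, e⟩ := hv k
    rw [e]
    exact (cen _ _).mul (cen _ _)
  refine ⟨E, hE, hcE, hE.comm, hBD, fun f h hf hh => ?_⟩
  refine polynomial_induction_of_natDegree_le
    (P := fun f => ⁅L.AB f, L.Q h⁆ = E (-(f * h))) 2 (fun f g hf hg => ?_) (fun i hi s => ?_) hf
  · rw [L.hAB.add, commutator_mul_left_of_commute (by rw [hg]; exact ((hcE _).AB _).symm), hf, hg,
      ← hE.add]
    congr 1; ring
  · obtain ⟨a₀, a₁, b₀, b₁, e⟩ := C_mul_X_pow_eq_lin_mul_lin hi s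
    have hl := fun s t : S => natDegree_lin_le s t
    rw [e, hD.AB_Q_mul (hl _ _) (hl _ _) hh,
      hBD _ _ (hl _ _) (natDegree_mul_le_add (hl _ _) hh (by norm_num)), ← hE.neg]
    congr 1; ring

end Highest

end LargeLink

namespace LargeLink

/-! #### The root `α + β + ψ` -/

section Short

variable {S : Type*} [CommRing S] {Γ : Type*} [Group Γ] (L : LargeLink S Γ)

/-- The symmetric form of the commutator of `A a` and `BP g`, in which the contribution of
`α + 2β + 2ψ` cancels. -/
noncomputable def short (a g : S[X]) : Γ :=
  L.BP (-(C L.κ * g)) * L.A a * L.BP g * L.A (-a) * L.BP (-(C L.κ * g))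

theorem short_eq_conj (a g : S[X]) : L.short a g =
    L.BP (-(C L.κ * g)) * (L.A a * L.BP g * (L.A a)⁻¹) * L.BP (-(C L.κ * g)) := by
  rw [short, L.hA.neg]; group

theorem short_eq_commutator (a g : S[X]) : L.short a g =
    L.BP (-(C L.κ * g)) * ⁅L.A a, L.BP g⁆ * (L.BP (-(C L.κ * g)))⁻¹ := by
  have : L.BP (-(C L.κ * g)) * L.BP (-(C L.κ * g)) = (L.BP g)⁻¹ := by
    rw [L.hBP.neg, ← mul_inv_rev, L.hBP.mul_self_κ L.two_κ]
  rw [short_eq_conj, commutatorElement_def, ← this]; group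

theorem B_comm_conj_BP (b a g : S[X]) : Commute (L.B b) (L.A a * L.BP g * (L.A a)⁻¹) := by
  obtain ⟨a', ha, e⟩ := L.hA.exists_natDegree_le a
  obtain ⟨b', hb, e'⟩ := L.hB.exists_natDegree_le b
  rw [e, e']
  have h := (Commute.conj_iff (L.A a')).2 (L.B_BP b' g)
  rw [eq_mul_mul_of_commutator_eq (L.A_B a' b' ha hb)] at h
  have h' : Commute (L.AB (a' * b')) (L.A a' * L.BP g * (L.A a')⁻¹) :=
    ((L.A_AB _ _).symm.mul_right (L.AB_BP _ _)).mul_right (L.A_AB _ _).symm.inv_right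
  simpa using h'.inv_left.mul_left h

theorem B_short (b a g : S[X]) : Commute (L.B b) (L.short a g) := by
  rw [short_eq_conj]
  exact ((L.B_BP _ _).mul_right (L.B_comm_conj_BP _ _ _)).mul_right (L.B_BP _ _)

theorem AB_short (f a g : S[X]) : Commute (L.AB f) (L.short a g) :=
  ((((L.AB_BP _ _).mul_right (L.A_AB _ _).symm).mul_right (L.AB_BP _ _)).mul_right
    (L.A_AB _ _).symm).mul_right (L.AB_BP _ _)

theorem A_short_mul (f : S[X]) (a₀ a₁ b₀ b₁ c₀ c₁ : S) :
    Commute (L.A f) (L.short (lin a₀ a₁) (lin b₀ b₁ * lin c₀ c₁)) := by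
  rw [short, L.lift_short]
  have hP := fun g => L.A_P f g
  exact ((hP _).mul_right (commute_commutator (L.A_AB _ _) (hP _))).mul_right (hP _)

variable {L} {D : S[X] → Γ} (hD : L.IsD D)

include hD

theorem IsD.Q_AQ_BP (h a g : S[X]) : Commute (L.Q h) (L.A a * L.BP g * (L.A a)⁻¹) := by
  obtain ⟨k, hk⟩ := hD.AQ_eq (-a) h
  have h₁ : Commute ((L.A a)⁻¹ * L.Q h * L.A a) (L.BP g) := by
    have : (L.A a)⁻¹ * L.Q h * L.A a = D k * L.Q h := by
      rw [← hk, ← conj_eq_commutator_mul, L.hA.neg, inv_inv]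
    rw [this]
    exact (hD.BP_D _ _).symm.mul_left (L.BP_Q _ _).symm
  simpa [mul_assoc] using (Commute.conj_iff (L.A a)).2 h₁

theorem IsD.Q_short (h a g : S[X]) : Commute (L.Q h) (L.short a g) := by
  rw [short_eq_conj]
  exact ((L.BP_Q _ _).symm.mul_right (hD.Q_AQ_BP _ _ _)).mul_right (L.BP_Q _ _).symm

theorem IsD.D_short (k a g : S[X]) : Commute (D k) (L.short a g) :=
  have h₁ := fun f => (hD.BP_D f k).symm
  have h₂ := fun f => (hD.A_D f k).symm
  ((((h₁ _).mul_right (h₂ _)).mul_right (h₁ _)).mul_right (h₂ _)).mul_right (h₁ _)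

theorem IsD.P_conj_short {a g d : S[X]} (ha : a.natDegree ≤ 1) (hg : g.natDegree ≤ 2)
    (hd : d.natDegree ≤ 1) :
    L.P d * L.short a g * (L.P d)⁻¹ = D (2 * (a * g * d)) * L.short a g := by
  have hκ : (-(C L.κ * g)).natDegree ≤ 2 := by
    rw [natDegree_neg]; exact (natDegree_C_mul_le _ _).trans hg
  have h2 : (2 * (g * d)).natDegree ≤ 3 :=
    natDegree_mul_le_add (m := 0) (by rw [← C_ofNat, natDegree_C])
      (natDegree_mul_le_add hg hd le_rfl) (by norm_num)
  have e₁ := L.P_BP hg hd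
  have e₂ := L.P_BP hκ hd
  have e₃ : L.A a * L.Q (2 * (g * d)) * (L.A a)⁻¹ =
      D (2 * (a * g * d)) * L.Q (2 * (g * d)) := by
    rw [conj_eq_commutator_mul, hD.A_Q _ _ ha h2]
    congr 2; ring
  have e₄ : L.Q (2 * (-(C L.κ * g) * d)) = (L.Q (g * d))⁻¹ := by
    rw [← L.hQ.neg]; congr 1; linear_combination (-g * d) * L.two_mul_C_κ
  have e₅ : L.P d * (L.A a * L.BP g * (L.A a)⁻¹) * (L.P d)⁻¹ =
      D (2 * (a * g * d)) * L.Q (2 * (g * d)) * (L.A a * L.BP g * (L.A a)⁻¹) := by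
    calc _ = L.P d * L.A a * L.BP g * (L.P d * L.A a)⁻¹ := by group
      _ = L.A a * (L.P d * L.BP g * (L.P d)⁻¹) * (L.A a)⁻¹ := by
        rw [← (L.A_P a d).eq]; group
      _ = (L.A a * L.Q (2 * (g * d)) * (L.A a)⁻¹) * (L.A a * L.BP g * (L.A a)⁻¹) := by
        rw [e₁]; group
      _ = _ := by rw [e₃]
  have e₆ : L.Q (2 * (g * d)) = L.Q (g * d) * L.Q (g * d) := by
    rw [← L.hQ.add]; congr 1; ring
  have c₁ := L.BP_Q (-(C L.κ * g)) (g * d)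
  have c₂ := hD.Q_AQ_BP (g * d) a g
  have c₃ := hD.BP_D (-(C L.κ * g)) (2 * (a * g * d))
  have c₄ := hD.Q_D (g * d) (2 * (a * g * d))
  rw [e₆] at e₅
  rw [e₄] at e₂
  rw [short_eq_conj]
  generalize L.A a * L.BP g * (L.A a)⁻¹ = Y, L.BP (-(C L.κ * g)) = y, L.Q (g * d) = q,
    D (2 * (a * g * d)) = z, L.P d = p at *
  calc p * (y * Y * y) * p⁻¹ = (p * y * p⁻¹) * (p * Y * p⁻¹) * (p * y * p⁻¹) := by group
    _ = q⁻¹ * (y * (z * q)) * (q * Y * q⁻¹) * y := by rw [e₂, e₅]; group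
    _ = q⁻¹ * (z * q) * (y * Y * y) := by
      rw [conj_eq_of_commute c₂, (c₃.mul_right c₁).eq]; group
    _ = z * (y * Y * y) := by rw [← c₄.eq]; group

theorem IsD.short_P {a g d : S[X]} (ha : a.natDegree ≤ 1) (hg : g.natDegree ≤ 2)
    (hd : d.natDegree ≤ 1) : ⁅L.short a g, L.P d⁆ = D (-2 * (a * g * d)) := by
  rw [← commutatorElement_inv, commutatorElement_def, hD.P_conj_short ha hg hd,
    mul_inv_cancel_right, ← hD.hD.neg]
  congr 1; ring

/-- The commutator of `AB (a b)` and `P c` differs from `short a (b c)` by an element of the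
family `D`. -/
theorem IsD.AB_P_mul (a₀ a₁ b₀ b₁ c₀ c₁ : S) :
    ⁅L.AB (lin a₀ a₁ * lin b₀ b₁), L.P (lin c₀ c₁)⁆ =
      D (lin a₀ a₁ * lin b₀ b₁ * lin c₀ c₁ ^ 2) *
        L.short (lin a₀ a₁) (lin b₀ b₁ * lin c₀ c₁) := by
  have hc : (C L.κ * lin c₀ c₁).natDegree ≤ 1 := by rw [C_mul_lin]; exact natDegree_lin_le _ _
  have h := hD.P_conj_short (natDegree_lin_le a₀ a₁) (natDegree_mul_le_add
    (natDegree_lin_le b₀ b₁) (natDegree_lin_le c₀ c₁) le_rfl) hc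
  have e : 2 * (lin a₀ a₁ * (lin b₀ b₁ * lin c₀ c₁) * (C L.κ * lin c₀ c₁)) =
      lin a₀ a₁ * lin b₀ b₁ * lin c₀ c₁ ^ 2 := by
    linear_combination (lin a₀ a₁ * lin b₀ b₁ * lin c₀ c₁ ^ 2) * L.two_mul_C_κ
  rw [e] at h
  rw [← h, short, L.lift_short, L.hP.neg]
  group

variable {E : S[X] → Γ} (hE : L.IsE D E)

include hE

/-- Conjugating `⁅P c, BP g⁆ = Q (2 g c)` by `AB (a b)`. -/
theorem IsE.short_mul_BP (a₀ a₁ b₀ b₁ c₀ c₁ : S) {g : S[X]} (hg : g.natDegree ≤ 2) :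
    ⁅L.short (lin a₀ a₁) (lin b₀ b₁ * lin c₀ c₁), L.BP g⁆ =
      E (-2 * (lin a₀ a₁ * (lin b₀ b₁ * lin c₀ c₁) * g)) := by
  have hl := fun s t : S => natDegree_lin_le s t
  have hab : (lin a₀ a₁ * lin b₀ b₁).natDegree ≤ 2 := natDegree_mul_le_add (hl _ _) (hl _ _) le_rfl
  have hG := hD.AB_P_mul a₀ a₁ b₀ b₁ c₀ c₁
  have hQG : Commute (L.Q (2 * (g * lin c₀ c₁)))
      ⁅L.AB (lin a₀ a₁ * lin b₀ b₁), L.P (lin c₀ c₁)⁆ := by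
    rw [hG]; exact (hD.Q_D _ _).mul_right (hD.Q_short _ _ _)
  have hPBP : ⁅L.P (lin c₀ c₁), L.BP g⁆ = L.Q (2 * (g * lin c₀ c₁)) := by
    rw [← commutatorElement_inv, L.BP_P _ _ hg (hl _ _), ← L.hQ.neg]; congr 1; ring
  have h2 : (2 * (g * lin c₀ c₁)).natDegree ≤ 3 :=
    natDegree_mul_le_add (m := 0) (by rw [← C_ofNat, natDegree_C])
      (natDegree_mul_le_add hg (hl _ _) le_rfl) (by norm_num)
  have h₁ := conj_commutator (L.AB (lin a₀ a₁ * lin b₀ b₁)) (L.P (lin c₀ c₁)) (L.BP g)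
  rw [hPBP, conj_eq_of_commute (L.AB_BP _ _), conj_eq_commutator_mul, hE.AB_Q _ _ hab h2,
    conj_eq_commutator_mul, commutator_mul_left_of_commute (by rw [hPBP]; exact hQG.symm), hPBP,
    ((hE.central _).Q _).eq, mul_right_inj, hG,
    commutator_mul_left_cancel (hD.D_short _ _ _) (hD.BP_D _ _).symm] at h₁
  rw [← h₁]; congr 1; ring

omit hD in
theorem IsE.commutator_A_BP_add {a g g' : S[X]}
    (h : ⁅⁅L.A a, L.BP g'⁆, L.BP g⁆ = E (-2 * (a * g' * g))) :
    ⁅L.A a, L.BP (g + g')⁆ = E (2 * (a * g * g')) * (⁅L.A a, L.BP g⁆ * ⁅L.A a, L.BP g'⁆) := by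
  have h₁ : L.BP g * ⁅L.A a, L.BP g'⁆ * (L.BP g)⁻¹ =
      E (2 * (a * g * g')) * ⁅L.A a, L.BP g'⁆ := by
    rw [conj_eq_commutator_mul, ← commutatorElement_inv, h, ← hE.hE.neg]
    congr 2; ring
  have h₂ : ⁅L.A a, L.BP g * L.BP g'⁆ =
      ⁅L.A a, L.BP g⁆ * (L.BP g * ⁅L.A a, L.BP g'⁆ * (L.BP g)⁻¹) := by
    simp only [commutatorElement_def]; group
  have h₃ := commute_commutator ((hE.central (2 * (a * g * g'))).A a) ((hE.central _).BP g)
  rw [L.hBP.add, h₂, h₁, ← mul_assoc, ← h₃.eq, mul_assoc]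

/-- The commutation relations of `⁅A a, BP g⁆` used to expand sums. They hold for `g = b c`, where
the commutator is `short a g` up to a central element, and both extend to sums together. -/
theorem IsE.commutator_A_BP {a g : S[X]} (ha : a.natDegree ≤ 1) (hg : g.natDegree ≤ 2) :
    (∀ a', Commute (L.A a') ⁅L.A a, L.BP g⁆) ∧
    ∀ g', g'.natDegree ≤ 2 → ⁅⁅L.A a, L.BP g⁆, L.BP g'⁆ = E (-2 * (a * g * g')) := by
  have cE := hE.central
  have key := polynomial_induction_of_natDegree_le (P := fun g => g.natDegree ≤ 2 ∧
    (∀ a', Commute (L.A a') ⁅L.A a, L.BP g⁆) ∧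
    ∀ g', g'.natDegree ≤ 2 → ⁅⁅L.A a, L.BP g⁆, L.BP g'⁆ = E (-2 * (a * g * g'))) 2 ?_ ?_ hg
  · exact key.2
  · intro f g hf hg
    have e := hE.commutator_A_BP_add (hg.2.2 f hf.1)
    refine ⟨natDegree_add_le_of_degree_le hf.1 hg.1, fun a' => ?_, fun g' hg' => ?_⟩
    · rw [e]
      exact ((cE _).A _).symm.mul_right ((hf.2.1 a').mul_right (hg.2.1 a'))
    · rw [e, commutator_mul_left_cancel
        (commute_commutator ((cE _).A _) ((cE _).BP _) |>.mul_right
          (commute_commutator ((cE _).A _) ((cE _).BP _))) ((cE _).BP _),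
        commutator_mul_left_of_commute, hf.2.2 g' hg', hg.2.2 g' hg', ← hE.hE.add]
      · congr 1; ring
      · rw [hg.2.2 g' hg']
        exact (commute_commutator ((cE _).A _) ((cE _).BP _)).symm
  · intro i hi s
    obtain ⟨b₀, b₁, c₀, c₁, e⟩ := C_mul_X_pow_eq_lin_mul_lin hi s
    have hbc : (lin b₀ b₁ * lin c₀ c₁).natDegree ≤ 2 :=
      natDegree_mul_le_add (natDegree_lin_le _ _) (natDegree_lin_le _ _) le_rfl
    have ea := eq_lin_of_natDegree_le ha
    have hκ : (-(C L.κ * (lin b₀ b₁ * lin c₀ c₁))).natDegree ≤ 2 := by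
      rw [natDegree_neg]; exact (natDegree_C_mul_le _ _).trans hbc
    have hs := fun g hg => hE.short_mul_BP hD (a.coeff 0) (a.coeff 1) b₀ b₁ c₀ c₁ (g := g) hg
    have hA := fun f => L.A_short_mul f (a.coeff 0) (a.coeff 1) b₀ b₁ c₀ c₁
    rw [← ea] at hs hA
    have hF : ⁅L.A a, L.BP (lin b₀ b₁ * lin c₀ c₁)⁆ =
        E (a * (lin b₀ b₁ * lin c₀ c₁) ^ 2) * L.short a (lin b₀ b₁ * lin c₀ c₁) := by
      have h₁ := conj_eq_commutator_mul (L.BP (-(C L.κ * (lin b₀ b₁ * lin c₀ c₁))))⁻¹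
        (L.short a (lin b₀ b₁ * lin c₀ c₁))
      rw [← L.hBP.neg, ← commutatorElement_inv, hs _ (by rwa [natDegree_neg]), ← hE.hE.neg] at h₁
      have h₂ : E (a * (lin b₀ b₁ * lin c₀ c₁) ^ 2) = E (-(-2 * (a * (lin b₀ b₁ * lin c₀ c₁) *
          - -(C L.κ * (lin b₀ b₁ * lin c₀ c₁))))) := by
        congr 1
        linear_combination (-a * (lin b₀ b₁ * lin c₀ c₁) ^ 2) * L.two_mul_C_κ
      rw [h₂, ← h₁, short_eq_commutator, L.hBP.neg (-_)]
      group
    rw [e]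
    refine ⟨hbc, fun a' => ?_, fun g' hg' => ?_⟩
    · rw [hF]; exact ((cE _).A _).symm.mul_right (hA _)
    · have hc : ∀ k g, Commute (E k) (L.short a g) := fun k g =>
        (((((cE k).BP _).mul_right ((cE k).A _)).mul_right ((cE k).BP _)).mul_right
          ((cE k).A _)).mul_right ((cE k).BP _)
      rw [hF, commutator_mul_left_cancel (hc _ _) ((cE _).BP _), hs _ hg']

theorem IsE.commutator_A_BP_comm {a g a' g' : S[X]} (ha : a.natDegree ≤ 1) (hg : g.natDegree ≤ 2)
    (hg' : g'.natDegree ≤ 2) : Commute ⁅L.A a, L.BP g⁆ ⁅L.A a', L.BP g'⁆ := by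
  have h := hE.commutator_A_BP hD ha hg
  refine commute_of_conj_eq ?_
  rw [conj_commutator, conj_eq_of_commute (h.1 a').symm, conj_eq_commutator_mul, h.2 g' hg',
    commutator_mul_right_cancel ((hE.central _).A _) ((hE.central _).BP _)]

theorem IsE.short_eq {a g : S[X]} (ha : a.natDegree ≤ 1) (hg : g.natDegree ≤ 2) :
    L.short a g = E (-(a * g ^ 2)) * ⁅L.A a, L.BP g⁆ := by
  have hκ : (-(C L.κ * g)).natDegree ≤ 2 := by
    rw [natDegree_neg]; exact (natDegree_C_mul_le _ _).trans hg
  rw [short_eq_commutator, conj_eq_commutator_mul, ← commutatorElement_inv,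
    (hE.commutator_A_BP hD ha hg).2 _ hκ, ← hE.hE.neg]
  congr 2
  linear_combination (-a * g ^ 2) * L.two_mul_C_κ

/-- The root elements `T` of `α + β + ψ` and their commutation relations. -/
structure IsT (D E T : S[X] → Γ) : Prop where
  hT : DegHom 3 T
  short_eq : ∀ a g, a.natDegree ≤ 1 → g.natDegree ≤ 2 → L.short a g = T (a * g)
  A_BP : ∀ a g, a.natDegree ≤ 1 → g.natDegree ≤ 2 → ⁅L.A a, L.BP g⁆ = T (a * g) * E (a * g ^ 2)
  AB_P : ∀ f c, f.natDegree ≤ 2 → c.natDegree ≤ 1 → ⁅L.AB f, L.P c⁆ = T (f * c) * D (f * c ^ 2)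
  T_P : ∀ f d, f.natDegree ≤ 3 → d.natDegree ≤ 1 → ⁅T f, L.P d⁆ = D (-2 * (f * d))
  T_BP : ∀ f g, f.natDegree ≤ 3 → g.natDegree ≤ 2 → ⁅T f, L.BP g⁆ = E (-2 * (f * g))
  A_T : ∀ f g, Commute (L.A f) (T g)
  B_T : ∀ f g, Commute (L.B f) (T g)
  AB_T : ∀ f g, Commute (L.AB f) (T g)
  Q_T : ∀ f g, Commute (L.Q f) (T g)
  D_T : ∀ f g, Commute (D f) (T g)
  E_T : ∀ f g, Commute (E f) (T g)

theorem IsE.exists_T : ∃ T, L.IsT D E T := by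
  have cE := hE.central
  have hF {a g : S[X]} (ha : a.natDegree ≤ 1) (hg : g.natDegree ≤ 2) := hE.commutator_A_BP hD ha hg
  have hs {a g : S[X]} (ha : a.natDegree ≤ 1) (hg : g.natDegree ≤ 2) := hE.short_eq hD ha hg
  have EF : ∀ k a g, Commute (E k) ⁅L.A a, L.BP g⁆ := fun k a g =>
    commute_commutator ((cE k).A _) ((cE k).BP _)
  have hl := fun s t : S => natDegree_lin_le s t
  obtain ⟨T, hT, hv, hsT⟩ := exists_degHom_of_balanced (n := 2) (by norm_num) (τ := L.short)
    (fun a a' g ha ha' hg => by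
      rw [hs ha hg, hs ha' hg, hs (natDegree_add_le_of_degree_le ha ha') hg, L.hA.add,
        commutator_mul_left_of_commute ((hF ha' hg).1 a),
        (hE.commutator_A_BP_comm hD ha' hg hg).eq, (EF _ _ _).symm.mul_mul_mul_comm, ← hE.hE.add]
      congr 2; ring)
    (fun a g g' ha hg hg' => by
      rw [hs ha hg, hs ha hg', hs ha (natDegree_add_le_of_degree_le hg hg'),
        hE.commutator_A_BP_add ((hF ha hg').2 g hg), (EF _ _ _).symm.mul_mul_mul_comm,
        ← mul_assoc, ← hE.hE.add, ← hE.hE.add]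
      congr 2; ring)
    (fun a g a' g' ha hg ha' hg' => by
      rw [hs ha hg, hs ha' hg']
      exact ((hE.E_E _ _).mul_right (EF _ _ _)).mul_left
        ((EF _ _ _).symm.mul_right (hE.commutator_A_BP_comm hD ha hg hg')))
    -- The lifted expression of `short a (b c)` involves `a`, `b` only through `AB (a b)`.
    (fun a₀ a₁ b₀ b₁ j hj u => by
      obtain ⟨c₀, c₁, e⟩ := C_mul_X_pow_eq_lin (Nat.le_of_lt_succ hj) u
      rw [e, short, short, L.lift_short, L.lift_short, mul_comm (lin a₀ a₁)])
  have hcT : ∀ {x : Γ}, (∀ a g, a.natDegree ≤ 1 → g.natDegree ≤ 2 → Commute x (L.short a g)) →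
      ∀ k, Commute x (T k) := fun hx k => by
    obtain ⟨h, h', hh, hh', e⟩ := hv k
    rw [e]
    exact (hx _ _ (by simp) hh).mul_right (hx _ _ natDegree_X_le hh')
  have DT : ∀ f g, Commute (D f) (T g) := fun f => hcT fun a g _ _ => hD.D_short _ _ _
  have ET : ∀ f g, Commute (E f) (T g) := fun f => hcT fun a g ha hg => by
    rw [hs ha hg]; exact (hE.E_E _ _).mul_right (EF _ _ _)
  have ABT : ∀ f g, Commute (L.AB f) (T g) := fun f => hcT fun a g _ _ => L.AB_short _ _ _
  have hTF {f : S[X]} (hf : f.natDegree ≤ 3) {P : S[X] → Prop}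
      (hadd : ∀ f g, P f → P g → P (f + g))
      (hmul : ∀ a g, a.natDegree ≤ 1 → g.natDegree ≤ 2 → P (a * g)) : P f :=
    polynomial_induction_of_natDegree_le 3 hadd (fun i hi s => by
      obtain ⟨a₀, a₁, g, hg, e⟩ := C_mul_X_pow_eq_lin_mul hi s
      rw [e]; exact hmul _ _ (hl _ _) hg) hf
  have hBP : ∀ a g, a.natDegree ≤ 1 → g.natDegree ≤ 2 →
      ⁅L.A a, L.BP g⁆ = T (a * g) * E (a * g ^ 2) := fun a g ha hg => by
    rw [← hsT a g ha hg, hs ha hg, (EF _ _ _).eq, mul_assoc, ← hE.hE.add, neg_add_cancel,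
      hE.hE.zero, mul_one]
  refine ⟨T, hT, hsT, hBP, fun f c hf hc => ?_, fun f d hf hd => ?_, fun f g hf hg => ?_,
    fun f => hcT fun a g ha hg => ?_, fun f => hcT fun a g _ _ => L.B_short _ _ _, ABT,
    fun f => hcT fun a g _ _ => hD.Q_short _ _ _, DT, ET⟩
  · refine polynomial_induction_of_natDegree_le
      (P := fun f => ⁅L.AB f, L.P c⁆ = T (f * c) * D (f * c ^ 2)) 2 (fun f g hf hg => ?_)
      (fun i hi s => ?_) hf
    · rw [L.hAB.add, commutator_mul_left_of_commute (by
        rw [hg]; exact (ABT _ _).mul_right (hD.AB_D _ _)), hf, hg,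
        (DT _ _).mul_mul_mul_comm, ← hT.add, ← hD.hD.add]
      congr 2 <;> ring
    · obtain ⟨a₀, a₁, b₀, b₁, e⟩ := C_mul_X_pow_eq_lin_mul_lin hi s
      rw [e, eq_lin_of_natDegree_le hc, hD.AB_P_mul,
        hsT _ _ (hl _ _) (natDegree_mul_le_add (hl _ _) (hl _ _) le_rfl), (DT _ _).eq,
        mul_assoc (lin a₀ a₁) (lin b₀ b₁) (lin _ _)]
  · refine hTF (P := fun f => ⁅T f, L.P d⁆ = D (-2 * (f * d))) hf (fun f g hf hg => ?_)
      fun a g ha hg => ?_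
    · rw [hT.add, commutator_mul_left_of_commute (by rw [hg]; exact (DT _ _).symm), hf, hg,
        ← hD.hD.add]
      congr 1; ring
    · rw [← hsT a g ha hg, hD.short_P ha hg hd]
  · refine hTF (P := fun f => ⁅T f, L.BP g⁆ = E (-2 * (f * g))) hf (fun f g' hf hg' => ?_)
      fun a g' ha hg' => ?_
    · rw [hT.add, commutator_mul_left_of_commute (by rw [hg']; exact (ET _ _).symm), hf, hg',
        ← hE.hE.add]
      congr 1; ring
    · rw [← hsT a g' ha hg', hs ha hg',
        commutator_mul_left_cancel (EF _ _ _) ((cE _).BP _), (hF ha hg').2 g hg]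
  · rw [hs ha hg]
    exact ((cE _).A _).symm.mul_right ((hF ha hg).1 f)

end Short

end LargeLink

/-! ### The Steinberg relations in the Chevalley group -/

section Chevalley

variable {R : Type*} [Field R]

theorem xr_of_not_isRoot {v : Vec} (hv : ¬ IsRoot v) (t : R) : xr v t = 1 := by
  simp [xr, fx, hv]

theorem xr_add (v : Vec) (t u : R) : xr v (t + u) = xr v t * xr v u := by
  by_cases hv : IsRoot v
  · have h := PresentedGroup.one_of_mem (rels := {r | IsChevRel R r}) (IsChevRel.linear v hv t u)
    exact (mul_inv_eq_one.1 h).symm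
  · simp [xr_of_not_isRoot hv]

theorem xr_zero (v : Vec) : xr v (0 : R) = 1 := by
  have h := xr_add v (0 : R) 0
  rwa [add_zero, left_eq_mul] at h

theorem xr_neg (v : Vec) (t : R) : xr v (-t) = (xr v t)⁻¹ :=
  eq_inv_of_mul_eq_one_left (by rw [← xr_add, neg_add_cancel, xr_zero])

theorem commutator_xr {v w : Vec} (hv : IsRoot v) (hw : IsRoot w) (hne : v ≠ -w) (t u : R) :
    ⁅xr v t, xr w u⁆ = (pairs.map fun ab =>
      xr (ab.1 • v + ab.2 • w) ((chevC ab.1 ab.2 v w : R) * (t ^ ab.1 * u ^ ab.2))).prod := by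
  have h := PresentedGroup.one_of_mem (rels := {r | IsChevRel R r})
    (IsChevRel.comm v w hv hw hne t u)
  simp only [map_mul, map_inv, map_list_prod, List.map_map] at h
  exact mul_inv_eq_one.1 h

theorem comb_add (b : Fin 3 → Vec) (c d : Fin 3 → ℕ) : comb b (c + d) = comb b c + comb b d := by
  simp [comb, add_smul, Finset.sum_add_distrib]

theorem comb_smul (b : Fin 3 → Vec) (n : ℕ) (c : Fin 3 → ℕ) : comb b (n • c) = n • comb b c := by
  simp [comb, mul_smul, Finset.smul_sum]

/-- The terms of the commutator of the root elements with coefficients `c` and `d`: the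
coefficients of the root, the structure constant, and the exponents of the two arguments. -/
def commTerms (b : Fin 3 → Vec) (c d : Fin 3 → ℕ) : List ((Fin 3 → ℕ) × ℤ × ℕ × ℕ) :=
  (pairs.filter fun ab => IsRoot (comb b (ab.1 • c + ab.2 • d))).map fun ab =>
    (ab.1 • c + ab.2 • d, chevC ab.1 ab.2 (comb b c) (comb b d), ab.1, ab.2)

theorem prod_map_filter_of_eq_one {M T : Type*} [Monoid M] (f : T → M) (p : T → Bool) :
    ∀ (l : List T), (∀ x ∈ l, p x = false → f x = 1) → ((l.filter p).map f).prod = (l.map f).prod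
  | [], _ => rfl
  | x :: l, h => by
    have ih := prod_map_filter_of_eq_one f p l fun y hy => h y (List.mem_cons_of_mem _ hy)
    cases hp : p x
    · simp [hp, ih, h x List.mem_cons_self hp]
    · simp [hp, ih]

theorem commutator_xr_comb {b : Fin 3 → Vec} {c d : Fin 3 → ℕ} (hc : IsRoot (comb b c))
    (hd : IsRoot (comb b d)) (hne : comb b c ≠ -comb b d) (t u : R) :
    ⁅xr (comb b c) t, xr (comb b d) u⁆ = ((commTerms b c d).map fun e =>
      xr (comb b e.1) ((e.2.1 : R) * (t ^ e.2.2.1 * u ^ e.2.2.2))).prod := by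
  rw [commutator_xr hc hd hne, commTerms, List.map_map, prod_map_filter_of_eq_one]
  · simp only [Function.comp_def, comb_add, comb_smul]
  · intro ab _ h
    exact xr_of_not_isRoot (by simpa using h) _

theorem commutator_xr_of_terms {b : Fin 3 → Vec} {c d : Fin 3 → ℕ}
    {l : List ((Fin 3 → ℕ) × ℤ × ℕ × ℕ)} (hl : commTerms b c d = l) (hc : IsRoot (comb b c))
    (hd : IsRoot (comb b d)) (hne : comb b c ≠ -comb b d) (t u : R) :
    ⁅xr (comb b c) t, xr (comb b d) u⁆ = (l.map fun e =>
      xr (comb b e.1) ((e.2.1 : R) * (t ^ e.2.2.1 * u ^ e.2.2.2))).prod :=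
  hl ▸ commutator_xr_comb hc hd hne t u

theorem commute_xr_of_terms {b : Fin 3 → Vec} {c d : Fin 3 → ℕ} (hl : commTerms b c d = [])
    (hc : IsRoot (comb b c)) (hd : IsRoot (comb b d)) (hne : comb b c ≠ -comb b d) (t u : R) :
    Commute (xr (comb b c) t) (xr (comb b d) u) :=
  commutatorElement_eq_one_iff_commute.1 (commutator_xr_of_terms hl hc hd hne t u)

end Chevalley

/-! ### The base relations that are lifted -/

section BaseRelations

variable {R : Type*} [Field R]

/-- The root element of the large link with coefficients `c`. -/
abbrev xLg (c : Fin 3 → ℕ) (t : R) : Chev R := xr (comb baseLg c) t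

/-- The root element of the small link with coefficients `c`. -/
abbrev xSm (c : Fin 3 → ℕ) (t : R) : Chev R := xr (comb baseSm c) t

theorem commute_xSm_Q_W (t u : R) : Commute (xSm ![1, 2, 0] t) (xSm ![0, 0, 1] u) :=
  commute_xr_of_terms (by decide) (by decide) (by decide) (by decide) t u

theorem commute_xSm_BP_PW (t u : R) : Commute (xSm ![1, 1, 0] t) (xSm ![0, 1, 1] u) :=
  commute_xr_of_terms (by decide) (by decide) (by decide) (by decide) t u

theorem commute_xLg_AB_BP (t u : R) : Commute (xLg ![1, 1, 0] t) (xLg ![0, 1, 1] u) :=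
  commute_xr_of_terms (by decide) (by decide) (by decide) (by decide) t u

theorem xLg_A_BP (t u : R) : ⁅xLg ![1, 0, 0] t, xLg ![0, 1, 1] u⁆ =
    xLg ![1, 1, 1] (t * u) * xLg ![1, 2, 2] (t * u ^ 2) := by
  simpa using commutator_xr_of_terms (b := baseLg) (c := ![1, 0, 0]) (d := ![0, 1, 1])
    (l := [(![1, 1, 1], 1, 1, 1), (![1, 2, 2], 1, 1, 2)]) (by decide) (by decide) (by decide)
    (by decide) t u

theorem xLg_A_Q (t u : R) : ⁅xLg ![1, 0, 0] t, xLg ![0, 1, 2] u⁆ = xLg ![1, 1, 2] (t * u) := by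
  simpa using commutator_xr_of_terms (b := baseLg) (c := ![1, 0, 0]) (d := ![0, 1, 2])
    (l := [(![1, 1, 2], 1, 1, 1)]) (by decide) (by decide) (by decide) (by decide) t u

theorem xLg_AB_P (t u : R) : ⁅xLg ![1, 1, 0] t, xLg ![0, 0, 1] u⁆ =
    xLg ![1, 1, 1] (t * u) * xLg ![1, 1, 2] (t * u ^ 2) := by
  simpa using commutator_xr_of_terms (b := baseLg) (c := ![1, 1, 0]) (d := ![0, 0, 1])
    (l := [(![1, 1, 1], 1, 1, 1), (![1, 1, 2], 1, 1, 2)]) (by decide) (by decide) (by decide)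
    (by decide) t u

theorem xLg_T_P (t u : R) :
    ⁅xLg ![1, 1, 1] t, xLg ![0, 0, 1] u⁆ = xLg ![1, 1, 2] (-2 * (t * u)) := by
  simpa using commutator_xr_of_terms (b := baseLg) (c := ![1, 1, 1]) (d := ![0, 0, 1])
    (l := [(![1, 1, 2], -2, 1, 1)]) (by decide) (by decide) (by decide) (by decide) t u

theorem xLg_T_BP (t u : R) :
    ⁅xLg ![1, 1, 1] t, xLg ![0, 1, 1] u⁆ = xLg ![1, 2, 2] (-2 * (t * u)) := by
  simpa using commutator_xr_of_terms (b := baseLg) (c := ![1, 1, 1]) (d := ![0, 1, 1])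
    (l := [(![1, 2, 2], -2, 1, 1)]) (by decide) (by decide) (by decide) (by decide) t u

theorem xLg_neg (c : Fin 3 → ℕ) (t : R) : xLg c (-t) = (xLg c t)⁻¹ :=
  xr_neg _ t

theorem conj_mul_of_commutator_inv {Γ : Type*} [Group Γ] {t d p : Γ} (h : ⁅t, p⁻¹⁆ = d)
    (hp : Commute d p) (ht : Commute d t) : p⁻¹ * (t * d) * p = t := by
  have e : p⁻¹ * t * p = d⁻¹ * t := by rw [← h, commutatorElement_def]; group
  rw [mul_assoc, mul_assoc, hp.eq, ← mul_assoc, ← mul_assoc, e, mul_assoc, ← ht.eq,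
    inv_mul_cancel_left]

/-- A half-step conjugation removes the long term of the commutator of `α + β` and `ψ`. -/
theorem xLg_T_eq_conj_AB_P {h : R} (h2 : 2 * h = 1) :
    xLg ![0, 0, 1] (-h) * ⁅xLg ![1, 1, 0] (1 : R), xLg ![0, 0, 1] (1 : R)⁆ * xLg ![0, 0, 1] h =
      xLg ![1, 1, 1] (1 : R) := by
  rw [xLg_AB_P, mul_one, one_pow, mul_one, xLg_neg]
  refine conj_mul_of_commutator_inv ?_
    (commute_xr_of_terms (by decide) (by decide) (by decide) (by decide) _ _)
    (commute_xr_of_terms (by decide) (by decide) (by decide) (by decide) _ _)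
  rw [← xLg_neg, xLg_T_P]
  congr 1
  linear_combination h2

/-- A half-step conjugation removes the long term of the commutator of `α` and `β + ψ`. -/
theorem xLg_T_eq_conj_A_BP {h : R} (h2 : 2 * h = 1) :
    xLg ![0, 1, 1] (-h) * xLg ![1, 0, 0] (1 : R) * xLg ![0, 1, 1] (1 : R) *
      xLg ![1, 0, 0] (-1 : R) * xLg ![0, 1, 1] (-h) = xLg ![1, 1, 1] (1 : R) := by
  have e := eq_mul_mul_of_commutator_eq (xLg_A_BP (1 : R) 1)
  have e1 : xLg ![0, 1, 1] (1 : R) = xLg ![0, 1, 1] h * xLg ![0, 1, 1] h := by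
    rw [← xr_add, ← two_mul, h2]
  rw [mul_one, one_pow, mul_one] at e
  rw [mul_assoc (xLg _ (-h)), mul_assoc (xLg _ (-h)), xLg_neg ![1, 0, 0], e, e1,
    xLg_neg, mul_assoc, mul_assoc, mul_inv_cancel_right, ← mul_assoc]
  refine conj_mul_of_commutator_inv ?_
    (commute_xr_of_terms (by decide) (by decide) (by decide) (by decide) _ _)
    (commute_xr_of_terms (by decide) (by decide) (by decide) (by decide) _ _)
  rw [← xLg_neg, xLg_T_BP]
  congr 1
  linear_combination h2

theorem xLg_commutator_conj_AB_P {h : R} (h2 : 2 * h = 1) :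
    ⁅xLg ![0, 0, 1] (-h) * ⁅xLg ![1, 1, 0] (1 : R), xLg ![0, 0, 1] (1 : R)⁆ *
      xLg ![0, 0, 1] h, xLg ![0, 0, 1] (1 : R)⁆ =
      ⁅xLg ![1, 0, 0] (1 : R), xLg ![0, 1, 2] (-2 : R)⁆ := by
  rw [xLg_T_eq_conj_AB_P h2, xLg_T_P, xLg_A_Q]
  simp

theorem commute_xLg_Q_conj_BP (t u v : R) : Commute (xLg ![0, 1, 2] v)
    (xLg ![1, 0, 0] t * xLg ![0, 1, 1] u * (xLg ![1, 0, 0] t)⁻¹) := by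
  rw [eq_mul_mul_of_commutator_eq (xLg_A_BP t u)]
  exact ((commute_xr_of_terms (by decide) (by decide) (by decide) (by decide) _ _).mul_right
    (commute_xr_of_terms (by decide) (by decide) (by decide) (by decide) _ _)).mul_right
    (commute_xr_of_terms (by decide) (by decide) (by decide) (by decide) _ _)

theorem commute_xLg_AB_comm (t u v : R) :
    Commute (xLg ![1, 1, 0] v) ⁅xLg ![1, 0, 0] t, xLg ![0, 1, 2] u⁆ := by
  rw [xLg_A_Q]
  exact commute_xr_of_terms (by decide) (by decide) (by decide) (by decide) _ _

theorem commute_xLg_BP_comm (t u v : R) :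
    Commute (xLg ![0, 1, 1] v) ⁅xLg ![1, 0, 0] t, xLg ![0, 1, 2] u⁆ := by
  rw [xLg_A_Q]
  exact commute_xr_of_terms (by decide) (by decide) (by decide) (by decide) _ _

end BaseRelations

/-! ### Root elements with present roots in the designated subgroups -/

section Membership

variable {K E : Type*} [Field K] [Field E] [Algebra K E] {x : E} {b : Fin 3 → Vec}

theorem commutatorElement_mem {Γ : Type*} [Group Γ] {H : Subgroup Γ} {g h : Γ} (hg : g ∈ H)
    (hh : h ∈ H) : ⁅g, h⁆ ∈ H :=
  mul_mem (mul_mem (mul_mem hg hh) (inv_mem hg)) (inv_mem hh)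

theorem xr_mem_of_monomials {H : Subgroup (Chev E)} {v : Vec} {n : ℕ}
    (h : ∀ i ≤ n, ∀ s : K, xr v (aeval x (C s * X ^ i)) ∈ H) {f : K[X]} (hf : f.natDegree ≤ n) :
    xr v (aeval x f) ∈ H := by
  refine polynomial_induction_of_natDegree_le (P := fun f => xr v (aeval x f) ∈ H) n
    (fun f g hf hg => ?_) h hf
  rw [map_add, xr_add]
  exact mul_mem hf hg

theorem xr_simple_mem_sub {c : Fin 3 → ℕ} {k j : Fin 3} (hc : comb b c = b k) (hkj : k ≠ j)
    {f : K[X]} (hf : f.natDegree ≤ 1) : xr (comb b c) (aeval x f) ∈ sub K b x j := by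
  refine Subgroup.subset_closure ⟨b k, ⟨k, hkj, rfl⟩, _, ⟨f.coeff 0, f.coeff 1, rfl⟩, ?_⟩
  rw [hc, eq_lin_of_natDegree_le hf]
  simp [lin]

/-- Root elements for a sum of two roots whose commutator has one term. -/
theorem xr_mem_of_commutator {H : Subgroup (Chev E)} {c d : Fin 3 → ℕ} {k : ℤ}
    (ht : commTerms b c d = [(c + d, k, 1, 1)]) (hc : IsRoot (comb b c)) (hd : IsRoot (comb b d))
    (hne : comb b c ≠ -comb b d) {k' : K} (hk : (k : K) * k' = 1)
    (hcH : ∀ f : K[X], f.natDegree ≤ 1 → xr (comb b c) (aeval x f) ∈ H)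
    (hdH : ∀ f : K[X], f.natDegree ≤ 1 → xr (comb b d) (aeval x f) ∈ H) (f : K[X])
    (hf : f.natDegree ≤ 2) : xr (comb b (c + d)) (aeval x f) ∈ H := by
  refine xr_mem_of_monomials (fun i hi s => ?_) hf
  obtain ⟨s₀, s₁, t₀, t₁, e⟩ := C_mul_X_pow_eq_lin_mul_lin hi (k' * s)
  have h := commutator_xr_of_terms ht hc hd hne (aeval x (lin s₀ s₁)) (aeval x (lin t₀ t₁))
  simp only [List.map_cons, List.map_nil, List.prod_singleton, pow_one, ← map_mul, ← e] at h
  have e' : (k : E) * aeval x (C (k' * s) * X ^ i) = aeval x (C s * X ^ i) := by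
    have : (algebraMap K E ((k : K) * k')) = 1 := by rw [hk, map_one]
    rw [map_mul, map_intCast] at this
    simp only [map_mul, aeval_C]
    linear_combination algebraMap K E s * aeval x (X ^ i : K[X]) * this
  rw [e'] at h
  rw [← h]
  exact commutatorElement_mem (hcH _ (natDegree_lin_le _ _)) (hdH _ (natDegree_lin_le _ _))

/-- In rank two of type `B_2`, the long root elements appear first: the commutators of
`f`, `g` and of `f`, `-g` share their long term, while their short terms cancel. -/
theorem xr_mem_of_commutator_long {H : Subgroup (Chev E)} {c d : Fin 3 → ℕ}
    (ht : commTerms b c d = [(c + d, 1, 1, 1), (c + 2 • d, 1, 1, 2)])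
    (hcomm : commTerms b (c + d) (c + 2 • d) = [])
    (hc : IsRoot (comb b c)) (hd : IsRoot (comb b d)) (hcd : IsRoot (comb b (c + d)))
    (hcdd : IsRoot (comb b (c + 2 • d))) (hne : comb b c ≠ -comb b d)
    (hne' : comb b (c + d) ≠ -comb b (c + 2 • d)) {h : K} (hh : 2 * h = 1)
    (hcH : ∀ f : K[X], f.natDegree ≤ 1 → xr (comb b c) (aeval x f) ∈ H)
    (hdH : ∀ f : K[X], f.natDegree ≤ 1 → xr (comb b d) (aeval x f) ∈ H) :
    (∀ f : K[X], f.natDegree ≤ 2 → xr (comb b (c + d)) (aeval x f) ∈ H) ∧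
    ∀ f : K[X], f.natDegree ≤ 3 → xr (comb b (c + 2 • d)) (aeval x f) ∈ H := by
  have key : ∀ f g : K[X], f.natDegree ≤ 1 → g.natDegree ≤ 1 →
      xr (comb b (c + d)) (aeval x (f * g)) *
        xr (comb b (c + 2 • d)) (aeval x (f * g ^ 2)) ∈ H := by
    intro f g hf hg
    have e := commutator_xr_of_terms ht hc hd hne (aeval x f) (aeval x g)
    simp only [List.map_cons, List.map_nil, List.prod_cons, List.prod_nil, mul_one, pow_one,
      Int.cast_one, one_mul, ← map_mul, ← map_pow] at e
    rw [← e]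
    exact commutatorElement_mem (hcH f hf) (hdH g hg)
  have long : ∀ f : K[X], f.natDegree ≤ 3 → xr (comb b (c + 2 • d)) (aeval x f) ∈ H := by
    refine fun f hf => xr_mem_of_monomials (fun i hi s => ?_) hf
    obtain ⟨s₀, s₁, t₀, t₁, e⟩ := C_mul_X_pow_eq_lin_mul_lin_sq hi (h * s)
    have h₁ := key (lin s₀ s₁) (lin t₀ t₁) (natDegree_lin_le _ _) (natDegree_lin_le _ _)
    have h₂ := key (lin s₀ s₁) (-lin t₀ t₁) (natDegree_lin_le _ _)
      (by rw [natDegree_neg]; exact natDegree_lin_le _ _)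
    have hc' := commute_xr_of_terms (R := E) hcomm hcd hcdd hne'
    have := mul_mem h₁ h₂
    rw [mul_neg, neg_sq, map_neg, xr_neg, (hc' _ _).eq, mul_assoc, mul_inv_cancel_left,
      ← xr_add, ← map_add, ← e] at this
    have e' : C (h * s) * X ^ i + C (h * s) * X ^ i = C s * X ^ i := by
      rw [← add_mul, ← C_add, ← two_mul, ← mul_assoc, hh, one_mul]
    rwa [e'] at this
  refine ⟨fun f hf => xr_mem_of_monomials (fun i hi s => ?_) hf, long⟩
  obtain ⟨s₀, s₁, t₀, t₁, e⟩ := C_mul_X_pow_eq_lin_mul_lin hi s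
  rw [e]
  refine (mul_mem_cancel_right (long (lin s₀ s₁ * lin t₀ t₁ ^ 2) ?_)).1
    (key _ _ (natDegree_lin_le _ _) (natDegree_lin_le _ _))
  exact natDegree_mul_le_add (natDegree_lin_le _ _)
    (natDegree_pow_le_of_le 2 (natDegree_lin_le _ _)) (by norm_num)

theorem mem_of_isRoot_comb_baseLg {c : Fin 3 → ℕ} (hc : IsRoot (comb baseLg c)) :
    c ∈ [![1, 0, 0], ![0, 1, 0], ![0, 0, 1], ![1, 1, 0], ![0, 1, 1], ![0, 1, 2], ![1, 1, 1],
      ![1, 1, 2], ![1, 2, 2]] := by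
  obtain ⟨l, m, n, rfl⟩ : ∃ l m n, c = ![l, m, n] :=
    ⟨c 0, c 1, c 2, by ext i; fin_cases i <;> rfl⟩
  have e : sqLen (comb baseLg ![l, m, n]) = (l : ℤ) ^ 2 + (m - l : ℤ) ^ 2 + (n - m : ℤ) ^ 2 := by
    simp [sqLen, comb, baseLg, Fin.sum_univ_three]
    ring
  have hle : (l : ℤ) ^ 2 + (m - l : ℤ) ^ 2 + (n - m : ℤ) ^ 2 ≤ 2 := by
    rw [← e]; rcases hc with h | h <;> rw [h]; norm_num
  have h₁ : l ≤ 1 := by zify; nlinarith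
  have h₂ : m ≤ 2 := by zify; nlinarith
  have h₃ : n ≤ 3 := by zify; nlinarith
  interval_cases l <;> interval_cases m <;> interval_cases n <;>
    first | decide | exact absurd hc (by decide)

theorem mem_of_isRoot_comb_baseSm {c : Fin 3 → ℕ} (hc : IsRoot (comb baseSm c)) :
    c ∈ [![1, 0, 0], ![0, 1, 0], ![0, 0, 1], ![1, 1, 0], ![1, 2, 0], ![0, 1, 1],
      ![1, 1, 1]] := by
  obtain ⟨l, m, n, rfl⟩ : ∃ l m n, c = ![l, m, n] :=
    ⟨c 0, c 1, c 2, by ext i; fin_cases i <;> rfl⟩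
  have e : sqLen (comb baseSm ![l, m, n]) = (n : ℤ) ^ 2 + (l : ℤ) ^ 2 + (m - l : ℤ) ^ 2 := by
    simp [sqLen, comb, baseSm, Fin.sum_univ_three]
    ring
  have hle : (n : ℤ) ^ 2 + (l : ℤ) ^ 2 + (m - l : ℤ) ^ 2 ≤ 2 := by
    rw [← e]; rcases hc with h | h <;> rw [h]; norm_num
  have h₁ : l ≤ 1 := by zify; nlinarith
  have h₂ : m ≤ 2 := by zify; nlinarith
  have h₃ : n ≤ 1 := by zify; nlinarith
  interval_cases l <;> interval_cases m <;> interval_cases n <;>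
    first | decide | exact absurd hc (by decide)

theorem xr_mem_sub_baseSm (h2 : (2 : K) ≠ 0) {c : Fin 3 → ℕ} (hc : IsRoot (comb baseSm c))
    {j : Fin 3} (hj : c j = 0) {f : K[X]} (hf : f.natDegree ≤ ht c) :
    xr (comb baseSm c) (aeval x f) ∈ sub K baseSm x j := by
  have hB : j ≠ 0 → ∀ f : K[X], f.natDegree ≤ 1 →
      xr (comb baseSm ![1, 0, 0]) (aeval x f) ∈ sub K baseSm x j :=
    fun hj f hf => xr_simple_mem_sub (k := 0) (by decide) hj.symm hf
  have hP : j ≠ 1 → ∀ f : K[X], f.natDegree ≤ 1 →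
      xr (comb baseSm ![0, 1, 0]) (aeval x f) ∈ sub K baseSm x j :=
    fun hj f hf => xr_simple_mem_sub (k := 1) (by decide) hj.symm hf
  have hW : j ≠ 2 → ∀ f : K[X], f.natDegree ≤ 1 →
      xr (comb baseSm ![0, 0, 1]) (aeval x f) ∈ sub K baseSm x j :=
    fun hj f hf => xr_simple_mem_sub (k := 2) (by decide) hj.symm hf
  have hlong (h₀ : j ≠ 0) (h₁ : j ≠ 1) := xr_mem_of_commutator_long (b := baseSm)
    (c := ![1, 0, 0]) (d := ![0, 1, 0]) (by decide) (by decide) (by decide) (by decide)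
    (by decide) (by decide) (by decide) (by decide) (mul_inv_cancel₀ h2) (hB h₀) (hP h₁)
  have hPW (h₁ : j ≠ 1) (h₂ : j ≠ 2) := xr_mem_of_commutator (b := baseSm) (k := 2)
    (c := ![0, 1, 0]) (d := ![0, 0, 1]) (by decide) (by decide) (by decide) (by decide)
    (by simpa using mul_inv_cancel₀ h2) (hP h₁) (hW h₂)
  have hmem := mem_of_isRoot_comb_baseSm hc
  simp only [List.mem_cons, List.not_mem_nil, or_false] at hmem
  rcases hmem with rfl | rfl | rfl | rfl | rfl | rfl | rfl <;>
    simp only [ht, Fin.sum_univ_three, Matrix.cons_val] at hf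
  · exact hB (by rintro rfl; simp at hj) f hf
  · exact hP (by rintro rfl; simp at hj) f hf
  · exact hW (by rintro rfl; simp at hj) f hf
  · simpa using (hlong (by rintro rfl; simp at hj) (by rintro rfl; simp at hj)).1 f hf
  · simpa using (hlong (by rintro rfl; simp at hj) (by rintro rfl; simp at hj)).2 f hf
  · simpa using hPW (by rintro rfl; simp at hj) (by rintro rfl; simp at hj) f hf
  · fin_cases j <;> simp at hj

theorem xr_mem_sub_baseLg (h2 : (2 : K) ≠ 0) {c : Fin 3 → ℕ} (hc : IsRoot (comb baseLg c))
    {j : Fin 3} (hj : c j = 0) {f : K[X]} (hf : f.natDegree ≤ ht c) :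
    xr (comb baseLg c) (aeval x f) ∈ sub K baseLg x j := by
  have hA : j ≠ 0 → ∀ f : K[X], f.natDegree ≤ 1 →
      xr (comb baseLg ![1, 0, 0]) (aeval x f) ∈ sub K baseLg x j :=
    fun hj f hf => xr_simple_mem_sub (k := 0) (by decide) hj.symm hf
  have hB : j ≠ 1 → ∀ f : K[X], f.natDegree ≤ 1 →
      xr (comb baseLg ![0, 1, 0]) (aeval x f) ∈ sub K baseLg x j :=
    fun hj f hf => xr_simple_mem_sub (k := 1) (by decide) hj.symm hf
  have hP : j ≠ 2 → ∀ f : K[X], f.natDegree ≤ 1 →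
      xr (comb baseLg ![0, 0, 1]) (aeval x f) ∈ sub K baseLg x j :=
    fun hj f hf => xr_simple_mem_sub (k := 2) (by decide) hj.symm hf
  have hlong (h₁ : j ≠ 1) (h₂ : j ≠ 2) := xr_mem_of_commutator_long (b := baseLg)
    (c := ![0, 1, 0]) (d := ![0, 0, 1]) (by decide) (by decide) (by decide) (by decide)
    (by decide) (by decide) (by decide) (by decide) (mul_inv_cancel₀ h2) (hB h₁) (hP h₂)
  have hAB (h₀ : j ≠ 0) (h₁ : j ≠ 1) := xr_mem_of_commutator (b := baseLg) (k := 1)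
    (c := ![1, 0, 0]) (d := ![0, 1, 0]) (by decide) (by decide) (by decide) (by decide)
    (k' := (1 : K)) (by simp) (hA h₀) (hB h₁)
  have hmem := mem_of_isRoot_comb_baseLg hc
  simp only [List.mem_cons, List.not_mem_nil, or_false] at hmem
  rcases hmem with rfl | rfl | rfl | rfl | rfl | rfl | rfl | rfl | rfl <;>
    simp only [ht, Fin.sum_univ_three, Matrix.cons_val] at hf
  · exact hA (by rintro rfl; simp at hj) f hf
  · exact hB (by rintro rfl; simp at hj) f hf
  · exact hP (by rintro rfl; simp at hj) f hf
  · simpa using hAB (by rintro rfl; simp at hj) (by rintro rfl; simp at hj) f hf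
  · simpa using (hlong (by rintro rfl; simp at hj) (by rintro rfl; simp at hj)).1 f hf
  · simpa using (hlong (by rintro rfl; simp at hj) (by rintro rfl; simp at hj)).2 f hf
  all_goals fin_cases j <;> simp at hj

end Membership

/-! ### Families of root elements -/

section Families

variable {ι : Type*} (F K : ι → Type*) {E : ι → Type*} [∀ i, Field (F i)] [∀ i, Field (K i)]
  [∀ i, Field (E i)] [∀ i, Algebra (F i) (K i)] [∀ i, Algebra (K i) (E i)]
  {S : Type*} [CommRing S] (π : ∀ i, S →+* K i) (b : Fin 3 → Vec) (x : ∀ i, E i)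

theorem allowedRel_mono {F K E : Type*} [Field F] [Field K] [Field E] [Algebra F K] [Algebra K E]
    (b : Fin 3 → Vec) (x : E) {m n : ℕ} (h : m ≤ n) :
    allowedRel F K b x m ⊆ allowedRel F K b x n := by
  rintro w (⟨hw, h'⟩ | ⟨s, hs, h'⟩)
  · exact Or.inl ⟨hw.trans h, h'⟩
  · exact Or.inr ⟨s, hs.trans h, h'⟩

/-- The allowed relators of a family of links. -/
def allowedFamily : RelatorFamily fun i => Chev (E i) where
  rel n i := allowedRel (F i) (K i) b (x i) n
  mono h i := allowedRel_mono b (x i) h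

variable {K}

/-- Evaluation at `x i` of a polynomial over `S`, where `π i` sends the coefficients to `K i`. -/
noncomputable def evalAt (i : ι) : S[X] →+* E i :=
  (aeval (x i) : (K i)[X] →ₐ[K i] E i).toRingHom.comp (mapRingHom (π i))

/-- The family of root elements with argument the value of `f`. -/
noncomputable def rootFam (c : Fin 3 → ℕ) (f : S[X]) : ∀ i, Chev (E i) :=
  fun i => xr (comb b c) (evalAt π x i f)

/-- The letter of a family of root elements, the argument being truncated at the height of
the root. -/
noncomputable def rootLetter (c : Fin 3 → ℕ) (f : S[X]) : (allowedFamily F K b x).Grp :=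
  (allowedFamily F K b x).letter (rootFam π b x c (truncDeg (ht c) f))

variable (K)

/-- The designated subgroups contain the root elements of the present roots. -/
def PresentMem : Prop := ∀ (i : ι) (c : Fin 3 → ℕ) (j : Fin 3) (f : (K i)[X]),
  IsRoot (comb b c) → c j = 0 → f.natDegree ≤ ht c →
    xr (comb b c) (aeval (x i) f) ∈ sub (K i) b (x i) j

/-- Families of elements of the designated subgroup omitting `j`. -/
def subFam (j : Fin 3) : Subgroup (∀ i, Chev (E i)) :=
  Subgroup.pi Set.univ fun i => sub (K i) b (x i) j

variable {K π b x}

theorem mem_subFam {j : Fin 3} {g : ∀ i, Chev (E i)} :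
    g ∈ subFam K b x j ↔ ∀ i, g i ∈ sub (K i) b (x i) j := by
  simp [subFam, Subgroup.mem_pi]

theorem PresentMem.rootFam_mem (h : PresentMem K b x) {c : Fin 3 → ℕ} {j : Fin 3}
    (hc : IsRoot (comb b c)) (hj : c j = 0) {f : S[X]} (hf : f.natDegree ≤ ht c) :
    rootFam π b x c f ∈ subFam K b x j :=
  mem_subFam.2 fun i => h i c j _ hc hj (natDegree_map_le.trans hf)

variable {F}

theorem cancellable_of_mem_subFam {j : Fin 3} {g : ∀ i, Chev (E i)} (hg : g ∈ subFam K b x j) :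
    (allowedFamily F K b x).Cancellable g := by
  rw [mem_subFam] at hg
  refine ⟨2, fun i => ⟨Or.inl ⟨by simp, ⟨j, ?_⟩, by simp⟩, Or.inl ⟨by simp, ⟨j, ?_⟩, by simp⟩⟩⟩ <;>
    simp [hg i]

/-- On a designated subgroup, forming letters is multiplicative. -/
theorem letter_mul {j : Fin 3} {g h : ∀ i, Chev (E i)} (hg : g ∈ subFam K b x j)
    (hh : h ∈ subFam K b x j) : (allowedFamily F K b x).letter (g * h) =
      (allowedFamily F K b x).letter g * (allowedFamily F K b x).letter h := by
  have e := RelatorFamily.prod_letter_eq_one (𝓡 := allowedFamily F K b x) (l := [g, h, (g * h)⁻¹])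
    (by
      intro k hk
      simp only [List.mem_cons, List.not_mem_nil, or_false] at hk
      rcases hk with rfl | rfl | rfl
      exacts [cancellable_of_mem_subFam hg, cancellable_of_mem_subFam hh,
        cancellable_of_mem_subFam (inv_mem (mul_mem hg hh))])
    ⟨3, fun i => Or.inl ⟨by simp, ⟨j, by
      simpa [mem_subFam.1 hg i, mem_subFam.1 hh i] using
        inv_mem (mul_mem (mem_subFam.1 hg i) (mem_subFam.1 hh i))⟩, by simp⟩⟩
  simp only [List.map_cons, List.map_nil, List.prod_cons, List.prod_nil, mul_one,
    RelatorFamily.letter_inv (cancellable_of_mem_subFam (mul_mem hg hh)), ← mul_assoc] at e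
  exact (mul_inv_eq_one.1 e).symm

theorem letter_one : (allowedFamily F K b x).letter 1 = 1 := by
  have h := letter_mul (F := F) (one_mem (subFam K b x 0)) (one_mem (subFam K b x 0))
  rwa [mul_one, left_eq_mul] at h

theorem letter_list_prod {j : Fin 3} : ∀ {l : List (∀ i, Chev (E i))},
    (∀ g ∈ l, g ∈ subFam K b x j) → (allowedFamily F K b x).letter l.prod =
      (l.map (allowedFamily F K b x).letter).prod
  | [], _ => letter_one
  | g :: l, h => by
    have hl : ∀ g ∈ l, g ∈ subFam K b x j := fun g hg => h g (List.mem_cons_of_mem _ hg)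
    rw [List.prod_cons, letter_mul (h g List.mem_cons_self) (list_prod_mem hl),
      letter_list_prod hl, List.map_cons, List.prod_cons]

theorem letter_commutator {j : Fin 3} {g h : ∀ i, Chev (E i)} (hg : g ∈ subFam K b x j)
    (hh : h ∈ subFam K b x j) : (allowedFamily F K b x).letter ⁅g, h⁆ =
      ⁅(allowedFamily F K b x).letter g, (allowedFamily F K b x).letter h⁆ := by
  rw [commutatorElement_def, letter_mul (mul_mem (mul_mem hg hh) (inv_mem hg)) (inv_mem hh),
    letter_mul (mul_mem hg hh) (inv_mem hg), letter_mul hg hh,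
    RelatorFamily.letter_inv (cancellable_of_mem_subFam hg),
    RelatorFamily.letter_inv (cancellable_of_mem_subFam hh), commutatorElement_def]

theorem rootLetter_of_natDegree_le {c : Fin 3 → ℕ} {f : S[X]} (hf : f.natDegree ≤ ht c) :
    rootLetter F π b x c f = (allowedFamily F K b x).letter (rootFam π b x c f) := by
  rw [rootLetter, truncDeg_of_natDegree_le hf]

theorem degHom_rootLetter (h : PresentMem K b x) {c : Fin 3 → ℕ} (hc : IsRoot (comb b c))
    (hp : Present c) {n : ℕ} (hn : ht c = n) : DegHom n (rootLetter F π b x c) where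
  add f g := by
    obtain ⟨j, hj⟩ := hp
    have hf := natDegree_truncDeg_le (ht c) f
    have hg := natDegree_truncDeg_le (ht c) g
    rw [rootLetter, rootLetter, rootLetter, ← letter_mul (h.rootFam_mem hc hj hf)
      (h.rootFam_mem hc hj hg), truncDeg_add]
    congr 1
    funext i
    simp [rootFam, xr_add]
  high i s hi := by
    rw [← hn] at hi
    rw [rootLetter, truncDeg_high hi, ← letter_one]
    congr 1
    funext i
    simp [rootFam, xr_zero]

theorem cancellable_rootFam (h : PresentMem K b x) {c : Fin 3 → ℕ} (hc : IsRoot (comb b c))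
    (hp : Present c) {f : S[X]} (hf : f.natDegree ≤ ht c) :
    (allowedFamily F K b x).Cancellable (rootFam π b x c f) :=
  let ⟨_, hj⟩ := hp
  cancellable_of_mem_subFam (h.rootFam_mem hc hj hf)

theorem ht_smul_add_smul (m n : ℕ) (c d : Fin 3 → ℕ) :
    ht (m • c + n • d) = m * ht c + n * ht d := by
  simp [ht, Finset.sum_add_distrib, Finset.mul_sum]

theorem mem_commTerms {c d : Fin 3 → ℕ} {e : (Fin 3 → ℕ) × ℤ × ℕ × ℕ} (he : e ∈ commTerms b c d) :
    e.1 = e.2.2.1 • c + e.2.2.2 • d ∧ IsRoot (comb b e.1) := by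
  obtain ⟨ab, hab, rfl⟩ := List.mem_map.1 he
  exact ⟨rfl, by simpa using (List.mem_filter.1 hab).2⟩

theorem natDegree_term_le {S : Type*} [CommRing S] {c d : Fin 3 → ℕ} {f g : S[X]}
    (hf : f.natDegree ≤ ht c) (hg : g.natDegree ≤ ht d) (k : ℤ) (m n : ℕ) :
    ((k : S[X]) * (f ^ m * g ^ n)).natDegree ≤ ht (m • c + n • d) := by
  rw [ht_smul_add_smul]
  refine (natDegree_mul_le_of_le (m := 0) (natDegree_intCast k).le
    (natDegree_mul_le_of_le (natDegree_pow_le_of_le m hf) (natDegree_pow_le_of_le n hg))).trans ?_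
  simp

/-- The commutator relations inside a designated subgroup. -/
theorem commutator_rootLetter (h : PresentMem K b x) {c d : Fin 3 → ℕ}
    {l : List ((Fin 3 → ℕ) × ℤ × ℕ × ℕ)} (hl : commTerms b c d = l) (hc : IsRoot (comb b c))
    (hd : IsRoot (comb b d)) (hne : comb b c ≠ -comb b d) {j : Fin 3} (hcj : c j = 0)
    (hdj : d j = 0) {f g : S[X]} (hf : f.natDegree ≤ ht c) (hg : g.natDegree ≤ ht d) :
    ⁅rootLetter F π b x c f, rootLetter F π b x d g⁆ = (l.map fun e =>
      rootLetter F π b x e.1 ((e.2.1 : S[X]) * (f ^ e.2.2.1 * g ^ e.2.2.2))).prod := by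
  subst hl
  have hterm : ∀ e ∈ commTerms b c d, rootFam π b x e.1
      ((e.2.1 : S[X]) * (f ^ e.2.2.1 * g ^ e.2.2.2)) ∈ subFam K b x j := by
    intro e he
    obtain ⟨e₁, e₂⟩ := mem_commTerms he
    refine h.rootFam_mem e₂ ?_ ?_
    · simp [e₁, hcj, hdj]
    · rw [e₁]; exact natDegree_term_le hf hg _ _ _
  rw [rootLetter_of_natDegree_le hf, rootLetter_of_natDegree_le hg,
    ← letter_commutator (h.rootFam_mem hc hcj hf) (h.rootFam_mem hd hdj hg)]
  have key : ⁅rootFam π b x c f, rootFam π b x d g⁆ = ((commTerms b c d).map fun e =>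
      rootFam π b x e.1 ((e.2.1 : S[X]) * (f ^ e.2.2.1 * g ^ e.2.2.2))).prod := by
    funext i
    rw [Pi.list_prod_apply, List.map_map]
    refine (commutator_xr_comb hc hd hne _ _).trans ?_
    simp [Function.comp_def, rootFam]
  rw [key, letter_list_prod (j := j) (by
    intro k hk
    obtain ⟨e, he, rfl⟩ := List.mem_map.1 hk
    exact hterm e he), List.map_map]
  congr 1
  refine List.map_congr_left fun e he => (rootLetter_of_natDegree_le ?_).symm
  rw [(mem_commTerms he).1]
  exact natDegree_term_le hf hg _ _ _

/-- The product of linear polynomials by which a root element with coefficients `c` is lifted. -/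
noncomputable def linProd {S : Type*} [CommRing S] (t₀ t₁ : Fin 3 → S) (c : Fin 3 → ℕ) : S[X] :=
  ∏ k, lin (t₀ k) (t₁ k) ^ c k

/-- The lift of a relation between root elements that holds in every base group. -/
theorem prod_lift_eq_one (h : PresentMem K b x)
    {s : List ((Fin 3 → ℕ) × (∀ i, F i) × S)}
    (hs : ∀ q ∈ s, IsRoot (comb b q.1) ∧ Present q.1 ∧
      ∀ i, π i q.2.2 = algebraMap (F i) (K i) (q.2.1 i))
    (h1 : ∀ i, (s.map fun q => xr (comb b q.1) (q.2.1 i)).prod = 1) (t₀ t₁ : Fin 3 → S) :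
    (s.map fun q => rootLetter F π b x q.1 (C q.2.2 *
      linProd t₀ t₁ q.1)).prod = 1 := by
  have hdeg : ∀ q : (Fin 3 → ℕ) × (∀ i, F i) × S,
      (C q.2.2 * linProd t₀ t₁ q.1).natDegree ≤ ht q.1 := by
    intro q
    refine (natDegree_C_mul_le _ _).trans ((natDegree_prod_le _ _).trans
      (Finset.sum_le_sum fun k _ => ?_))
    exact (natDegree_pow_le_of_le _ (natDegree_lin_le _ _)).trans (by simp)
  have := RelatorFamily.prod_letter_eq_one (𝓡 := allowedFamily F K b x)
    (l := s.map fun q => rootFam π b x q.1 (C q.2.2 * linProd t₀ t₁ q.1)) ?_ ?_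
  · rw [List.map_map] at this
    rw [← this]
    congr 1
    exact List.map_congr_left fun q _ => rootLetter_of_natDegree_le (hdeg q)
  · simp only [List.mem_map]
    rintro _ ⟨q, hq, rfl⟩
    exact cancellable_rootFam h (hs q hq).1 (hs q hq).2.1 (hdeg q)
  · refine ⟨s.length, fun i => Or.inr ⟨s.map fun q => (q.1, q.2.1 i), by simp, ?_, ?_,
      fun k => π i (t₀ k), fun k => π i (t₁ k), ?_⟩⟩
    · simp only [List.mem_map]
      rintro _ ⟨q, hq, rfl⟩
      exact ⟨(hs q hq).1, (hs q hq).2.1⟩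
    · rw [List.map_map]; exact h1 i
    · rw [List.map_map, List.map_map]
      refine List.map_congr_left fun q hq => ?_
      simp only [liftLetter, Function.comp_apply, rootFam]
      simp [evalAt, linProd, (hs q hq).2.2 i, lin, Polynomial.map_prod, add_comm]

end Families

/-! ### The links of the Chevalley group -/

section Links

variable {ι : Type*} {F K E : ι → Type*} [∀ i, Field (F i)] [∀ i, Field (K i)]
  [∀ i, Field (E i)] [∀ i, Algebra (F i) (K i)] [∀ i, Algebra (K i) (E i)]
  {S : Type*} [CommRing S] {π : ∀ i, S →+* K i} {b : Fin 3 → Vec} {x : ∀ i, E i}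

theorem presentMem_baseSm (h2 : ∀ i, (2 : K i) ≠ 0) : PresentMem K baseSm x :=
  fun i _ _ _ hc hj hf => xr_mem_sub_baseSm (h2 i) hc hj hf

theorem presentMem_baseLg (h2 : ∀ i, (2 : K i) ≠ 0) : PresentMem K baseLg x :=
  fun i _ _ _ hc hj hf => xr_mem_sub_baseLg (h2 i) hc hj hf

theorem rootLetter_truncDeg (c : Fin 3 → ℕ) (f : S[X]) :
    rootLetter F π b x c (truncDeg (ht c) f) = rootLetter F π b x c f := by
  rw [rootLetter, truncDeg_of_natDegree_le (natDegree_truncDeg_le _ _), rootLetter]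

theorem commute_rootLetter (h : PresentMem K b x) {c d : Fin 3 → ℕ}
    (hl : commTerms b c d = []) (hc : IsRoot (comb b c))
    (hd : IsRoot (comb b d)) (hne : comb b c ≠ -comb b d) {j : Fin 3} (hcj : c j = 0)
    (hdj : d j = 0) (f g : S[X]) :
    Commute (rootLetter F π b x c f) (rootLetter F π b x d g) := by
  rw [← rootLetter_truncDeg c, ← rootLetter_truncDeg d]
  exact commutatorElement_eq_one_iff_commute.1 (commutator_rootLetter h hl hc hd hne hcj hdj
    (natDegree_truncDeg_le _ _) (natDegree_truncDeg_le _ _))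

/-- The root elements of rank two inside a link of type `B_3`. -/
noncomputable def rankTwo (h : PresentMem K b x) {κ : S} (hκ : 2 * κ = 1) {cB cP cBP cQ : Fin 3 → ℕ}
    {j : Fin 3} (hj : cB j = 0 ∧ cP j = 0 ∧ cBP j = 0 ∧ cQ j = 0)
    (hr : IsRoot (comb b cB) ∧ IsRoot (comb b cP) ∧ IsRoot (comb b cBP) ∧ IsRoot (comb b cQ))
    (hht : ht cB = 1 ∧ ht cP = 1 ∧ ht cBP = 2 ∧ ht cQ = 3)
    (hne : comb b cB ≠ -comb b cP ∧ comb b cBP ≠ -comb b cP ∧ comb b cB ≠ -comb b cBP ∧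
      comb b cB ≠ -comb b cQ ∧ comb b cP ≠ -comb b cQ ∧ comb b cBP ≠ -comb b cQ)
    (hBP : commTerms b cB cP = [(cBP, 1, 1, 1), (cQ, 1, 1, 2)])
    (hBPP : commTerms b cBP cP = [(cQ, -2, 1, 1)])
    (h0 : commTerms b cB cBP = [] ∧ commTerms b cB cQ = [] ∧ commTerms b cP cQ = [] ∧
      commTerms b cBP cQ = []) : RankTwo S (allowedFamily F K b x).Grp where
  B := rootLetter F π b x cB
  P := rootLetter F π b x cP
  BP := rootLetter F π b x cBP
  Q := rootLetter F π b x cQ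
  κ := κ
  two_κ := hκ
  hB := degHom_rootLetter h hr.1 ⟨j, hj.1⟩ hht.1
  hP := degHom_rootLetter h hr.2.1 ⟨j, hj.2.1⟩ hht.2.1
  hBP := degHom_rootLetter h hr.2.2.1 ⟨j, hj.2.2.1⟩ hht.2.2.1
  hQ := degHom_rootLetter h hr.2.2.2 ⟨j, hj.2.2.2⟩ hht.2.2.2
  B_P f g hf hg := by
    simpa using commutator_rootLetter (F := F) h hBP hr.1 hr.2.1 hne.1 hj.1 hj.2.1 (hht.1 ▸ hf)
      (hht.2.1 ▸ hg)
  BP_P f g hf hg := by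
    simpa using commutator_rootLetter (F := F) h hBPP hr.2.2.1 hr.2.1 hne.2.1 hj.2.2.1 hj.2.1
      (hht.2.2.1 ▸ hf) (hht.2.1 ▸ hg)
  B_BP := commute_rootLetter h h0.1 hr.1 hr.2.2.1 hne.2.2.1 hj.1 hj.2.2.1
  B_Q := commute_rootLetter h h0.2.1 hr.1 hr.2.2.2 hne.2.2.2.1 hj.1 hj.2.2.2
  P_Q := commute_rootLetter h h0.2.2.1 hr.2.1 hr.2.2.2 hne.2.2.2.2.1 hj.2.1 hj.2.2.2
  BP_Q := commute_rootLetter h h0.2.2.2 hr.2.2.1 hr.2.2.2 hne.2.2.2.2.2 hj.2.2.1 hj.2.2.2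

theorem linProd_vec (a₀ a₁ b₀ b₁ c₀ c₁ : S) (l m n : ℕ) :
    linProd ![a₀, b₀, c₀] ![a₁, b₁, c₁] ![l, m, n] =
      lin a₀ a₁ ^ l * lin b₀ b₁ ^ m * lin c₀ c₁ ^ n := by
  simp [linProd, Fin.prod_univ_three]

/-- The lift of an equation between words. -/
theorem prod_lift_eq (h : PresentMem K b x) {s s' : List ((Fin 3 → ℕ) × (∀ i, F i) × S)}
    (hs : ∀ q ∈ s ++ s', IsRoot (comb b q.1) ∧ Present q.1 ∧
      ∀ i, π i q.2.2 = algebraMap (F i) (K i) (q.2.1 i))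
    (h1 : ∀ i, (s.map fun q => xr (comb b q.1) (q.2.1 i)).prod =
      (s'.map fun q => xr (comb b q.1) (q.2.1 i)).prod) (t₀ t₁ : Fin 3 → S) :
    (s.map fun q => rootLetter F π b x q.1 (C q.2.2 * linProd t₀ t₁ q.1)).prod =
      (s'.map fun q => rootLetter F π b x q.1 (C q.2.2 * linProd t₀ t₁ q.1)).prod := by
  have e := prod_lift_eq_one (F := F) (π := π) h
    (s := s ++ (s'.map fun q => (q.1, -q.2.1, -q.2.2)).reverse) ?_ (fun i => ?_) t₀ t₁
  · rw [List.map_append, List.prod_append, List.map_reverse, List.map_map] at e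
    rw [← mul_inv_eq_one, ← e, List.prod_inv_reverse, List.map_map]
    congr 3
    refine List.map_congr_left fun q hq => ?_
    obtain ⟨hc, hp, -⟩ := hs q (List.mem_append_right _ hq)
    simp [(degHom_rootLetter h hc hp rfl).neg]
  · intro q hq
    rcases List.mem_append.1 hq with hq' | hq'
    · exact hs q (List.mem_append_left _ hq')
    · rw [List.mem_reverse, List.mem_map] at hq'
      obtain ⟨q', hq', rfl⟩ := hq'
      obtain ⟨hc, hp, hi⟩ := hs q' (List.mem_append_right _ hq')
      exact ⟨hc, hp, fun i => by simp [hi i]⟩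
  · rw [List.map_append, List.prod_append, List.map_reverse, List.map_map, h1 i,
      mul_eq_one_iff_inv_eq, List.prod_inv_reverse, List.map_map]
    simp [Function.comp_def, xr_neg]

/-- The lift of a commutation relation. -/
theorem commute_lift (h : PresentMem K b x) {c d : Fin 3 → ℕ} (hc : IsRoot (comb b c))
    (hd : IsRoot (comb b d)) (hcp : Present c) (hdp : Present d)
    (hcd : ∀ i, Commute (xr (comb b c) (1 : F i)) (xr (comb b d) (1 : F i)))
    (t₀ t₁ : Fin 3 → S) :
    Commute (rootLetter F π b x c (linProd t₀ t₁ c)) (rootLetter F π b x d (linProd t₀ t₁ d)) := by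
  have e := prod_lift_eq (F := F) (π := π) h (s := [(c, 1, 1), (d, 1, 1)])
    (s' := [(d, 1, 1), (c, 1, 1)]) (by simp [hc, hd, hcp, hdp]) (fun i => ?_) t₀ t₁
  · simpa [Commute, SemiconjBy] using e
  · simpa using (hcd i).eq

variable (F π x) in
/-- The present root elements of the small link. -/
noncomputable def smallLink (h2 : ∀ i, (2 : K i) ≠ 0) {κ : S} (hκ : 2 * κ = 1) :
    SmallLink S (allowedFamily F K baseSm x).Grp where
  toRankTwo := rankTwo (F := F) (π := π) (presentMem_baseSm (x := x) h2) hκ (cB := ![1, 0, 0])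
    (cP := ![0, 1, 0]) (cBP := ![1, 1, 0]) (cQ := ![1, 2, 0]) (j := 2) (by decide) (by decide)
    (by decide) (by decide) (by decide) (by decide) (by decide)
  W := rootLetter F π baseSm x ![0, 0, 1]
  PW := rootLetter F π baseSm x ![0, 1, 1]
  hW := degHom_rootLetter (presentMem_baseSm h2) (by decide) (by decide) (by decide)
  hPW := degHom_rootLetter (presentMem_baseSm h2) (by decide) (by decide) (by decide)
  B_W := commute_rootLetter (presentMem_baseSm h2) (by decide) (by decide) (by decide)
    (by decide) (j := 1) rfl rfl
  P_W f g hf hg := by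
    change ⁅rootLetter F π baseSm x ![0, 1, 0] f, _⁆ = _
    simpa using commutator_rootLetter (F := F) (π := π) (presentMem_baseSm (x := x) h2)
      (c := ![0, 1, 0]) (d := ![0, 0, 1]) (l := [(![0, 1, 1], 2, 1, 1)]) (by decide) (by decide)
      (by decide) (by decide) (j := 0) rfl rfl hf hg
  P_PW := commute_rootLetter (presentMem_baseSm h2) (by decide) (by decide) (by decide)
    (by decide) (j := 0) rfl rfl
  W_PW := commute_rootLetter (presentMem_baseSm h2) (by decide) (by decide) (by decide)
    (by decide) (j := 0) rfl rfl
  lift_Q_W a₀ a₁ b₀ b₁ c₀ c₁ := by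
    have h := commute_lift (F := F) (π := π) (presentMem_baseSm (x := x) h2) (c := ![1, 2, 0])
      (d := ![0, 0, 1]) (by decide) (by decide) (by decide) (by decide)
      (fun i => commute_xSm_Q_W 1 1) ![a₀, b₀, c₀] ![a₁, b₁, c₁]
    simp only [linProd_vec, pow_zero, pow_one, mul_one, one_mul] at h
    exact h
  lift_BP_PW a₀ a₁ b₀ b₁ c₀ c₁ := by
    have h := commute_lift (F := F) (π := π) (presentMem_baseSm (x := x) h2) (c := ![1, 1, 0])
      (d := ![0, 1, 1]) (by decide) (by decide) (by decide) (by decide)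
      (fun i => commute_xSm_BP_PW 1 1) ![a₀, b₀, c₀] ![a₁, b₁, c₁]
    simp only [linProd_vec, pow_zero, pow_one, mul_one, one_mul] at h
    exact h

section LargeLifts

variable (h : PresentMem K baseLg x) (h2 : ∀ i, (2 : F i) ≠ 0) {κ : S} (hκ : 2 * κ = 1)
  (a₀ a₁ b₀ b₁ c₀ c₁ : S)

include h2 hκ in
theorem map_half (i : ι) : π i κ = algebraMap (F i) (K i) 2⁻¹ := by
  have e₁ : 2 * π i κ = 1 := by rw [← map_ofNat (π i) 2, ← map_mul, hκ, map_one]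
  have e₂ : 2 * algebraMap (F i) (K i) 2⁻¹ = 1 := by
    rw [← map_ofNat (algebraMap (F i) (K i)) 2, ← map_mul, mul_inv_cancel₀ (h2 i), map_one]
  calc π i κ = π i κ * (2 * algebraMap (F i) (K i) 2⁻¹) := by rw [e₂, mul_one]
    _ = algebraMap (F i) (K i) 2⁻¹ := by rw [← mul_assoc, mul_comm _ 2, e₁, one_mul]

include h h2 hκ in
theorem lift_short :
    rootLetter F π baseLg x ![0, 1, 1] (-(C κ * (lin b₀ b₁ * lin c₀ c₁))) *
      rootLetter F π baseLg x ![1, 0, 0] (lin a₀ a₁) *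
      rootLetter F π baseLg x ![0, 1, 1] (lin b₀ b₁ * lin c₀ c₁) *
      rootLetter F π baseLg x ![1, 0, 0] (-lin a₀ a₁) *
      rootLetter F π baseLg x ![0, 1, 1] (-(C κ * (lin b₀ b₁ * lin c₀ c₁))) =
    rootLetter F π baseLg x ![0, 0, 1] (-(C κ * lin c₀ c₁)) *
      ⁅rootLetter F π baseLg x ![1, 1, 0] (lin a₀ a₁ * lin b₀ b₁),
        rootLetter F π baseLg x ![0, 0, 1] (lin c₀ c₁)⁆ *
      rootLetter F π baseLg x ![0, 0, 1] (C κ * lin c₀ c₁) := by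
  have e := prod_lift_eq (F := F) (π := π) h
    (s := [(![0, 1, 1], fun _ => -2⁻¹, -κ), (![1, 0, 0], 1, 1), (![0, 1, 1], 1, 1),
      (![1, 0, 0], -1, -1), (![0, 1, 1], fun _ => -2⁻¹, -κ)])
    (s' := [(![0, 0, 1], fun _ => -2⁻¹, -κ), (![1, 1, 0], 1, 1), (![0, 0, 1], 1, 1),
      (![1, 1, 0], -1, -1), (![0, 0, 1], -1, -1), (![0, 0, 1], fun _ => 2⁻¹, κ)])
    ?_ (fun i => ?_) ![a₀, b₀, c₀] ![a₁, b₁, c₁]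
  · have hP := degHom_rootLetter (F := F) (π := π) h (c := ![0, 0, 1]) (by decide) (by decide) rfl
    have hAB := degHom_rootLetter (F := F) (π := π) h (c := ![1, 1, 0]) (by decide) (by decide) rfl
    simpa only [List.map_cons, List.map_nil, List.prod_cons, List.prod_nil, linProd_vec, mul_one,
      C_1, C_neg, neg_mul, one_mul, pow_one, pow_zero, commutatorElement_def, mul_assoc, hP.neg,
      hAB.neg] using e
  · have hκ' := map_half (π := π) h2 hκ
    intro q hq
    fin_cases hq <;> refine ⟨by dsimp only; decide, by dsimp only; decide, fun i => by simp [hκ' i]⟩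
  · have := (xLg_T_eq_conj_A_BP (mul_inv_cancel₀ (h2 i))).trans
      (xLg_T_eq_conj_AB_P (mul_inv_cancel₀ (h2 i))).symm
    simpa [mul_assoc, commutatorElement_def, xr_neg] using this

include h h2 hκ in
theorem lift_short_P :
    ⁅rootLetter F π baseLg x ![0, 0, 1] (-(C κ * lin c₀ c₁)) *
      ⁅rootLetter F π baseLg x ![1, 1, 0] (lin a₀ a₁ * lin b₀ b₁),
        rootLetter F π baseLg x ![0, 0, 1] (lin c₀ c₁)⁆ *
      rootLetter F π baseLg x ![0, 0, 1] (C κ * lin c₀ c₁),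
      rootLetter F π baseLg x ![0, 0, 1] (lin c₀ c₁)⁆ =
    ⁅rootLetter F π baseLg x ![1, 0, 0] (lin a₀ a₁),
      rootLetter F π baseLg x ![0, 1, 2] (-2 * (lin b₀ b₁ * lin c₀ c₁ ^ 2))⁆ := by
  have e := prod_lift_eq (F := F) (π := π) h
    (s := [(![0, 0, 1], fun _ => -2⁻¹, -κ), (![1, 1, 0], 1, 1), (![0, 0, 1], 1, 1),
      (![1, 1, 0], -1, -1), (![0, 0, 1], -1, -1), (![0, 0, 1], fun _ => 2⁻¹, κ),
      (![0, 0, 1], 1, 1),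
      (![0, 0, 1], fun _ => -2⁻¹, -κ), (![0, 0, 1], 1, 1), (![1, 1, 0], 1, 1),
      (![0, 0, 1], -1, -1), (![1, 1, 0], -1, -1), (![0, 0, 1], fun _ => 2⁻¹, κ),
      (![0, 0, 1], -1, -1)])
    (s' := [(![1, 0, 0], 1, 1), (![0, 1, 2], -2, -2), (![1, 0, 0], -1, -1), (![0, 1, 2], 2, 2)])
    ?_ (fun i => ?_) ![a₀, b₀, c₀] ![a₁, b₁, c₁]
  · have hP := degHom_rootLetter (F := F) (π := π) h (c := ![0, 0, 1]) (by decide) (by decide) rfl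
    have hA := degHom_rootLetter (F := F) (π := π) h (c := ![1, 0, 0]) (by decide) (by decide) rfl
    have hQ := degHom_rootLetter (F := F) (π := π) h (c := ![0, 1, 2]) (by decide) (by decide) rfl
    have hAB := degHom_rootLetter (F := F) (π := π) h (c := ![1, 1, 0]) (by decide) (by decide) rfl
    simpa only [List.map_cons, List.map_nil, List.prod_cons, List.prod_nil, linProd_vec, mul_one,
      C_1, C_neg, C_ofNat, neg_mul, one_mul, pow_one, pow_zero, commutatorElement_def, mul_assoc,
      hP.neg, hA.neg, hQ.neg, hAB.neg, mul_inv_rev, inv_inv] using e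
  · have hκ' := map_half (π := π) h2 hκ
    intro q hq
    fin_cases hq <;> refine ⟨by dsimp only; decide, by dsimp only; decide, fun i => by
      simp [hκ' i, map_ofNat (π i) 2, map_ofNat (algebraMap (F i) (K i)) 2]⟩
  · have := xLg_commutator_conj_AB_P (mul_inv_cancel₀ (h2 i))
    simpa [mul_assoc, commutatorElement_def, xr_neg] using this

include h in
theorem lift_Q_conj_BP : Commute
    (rootLetter F π baseLg x ![0, 1, 2] (lin b₀ b₁ * lin c₀ c₁ ^ 2))
    (rootLetter F π baseLg x ![1, 0, 0] (lin a₀ a₁) *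
      rootLetter F π baseLg x ![0, 1, 1] (lin b₀ b₁ * lin c₀ c₁) *
      (rootLetter F π baseLg x ![1, 0, 0] (lin a₀ a₁))⁻¹) := by
  have e := prod_lift_eq (F := F) (π := π) h
    (s := [(![0, 1, 2], 1, 1), (![1, 0, 0], 1, 1), (![0, 1, 1], 1, 1), (![1, 0, 0], -1, -1)])
    (s' := [(![1, 0, 0], 1, 1), (![0, 1, 1], 1, 1), (![1, 0, 0], -1, -1), (![0, 1, 2], 1, 1)])
    ?_ (fun i => ?_) ![a₀, b₀, c₀] ![a₁, b₁, c₁]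
  · have hA := degHom_rootLetter (F := F) (π := π) h (c := ![1, 0, 0]) (by decide) (by decide) rfl
    simpa only [List.map_cons, List.map_nil, List.prod_cons, List.prod_nil, linProd_vec, mul_one,
      C_1, C_neg, neg_mul, one_mul, pow_one, pow_zero, mul_assoc, hA.neg, Commute, SemiconjBy]
      using e
  · intro q hq
    fin_cases hq <;> refine ⟨by dsimp only; decide, by dsimp only; decide, fun i => by simp⟩
  · simpa [mul_assoc, xr_neg] using (commute_xLg_Q_conj_BP (1 : F i) 1 1).eq

/-- The lift of a commutation with a commutator of root elements. -/
theorem commute_commutator_lift {b : Fin 3 → Vec} (h : PresentMem K b x) {c d e : Fin 3 → ℕ}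
    (hr : IsRoot (comb b c) ∧ IsRoot (comb b d) ∧ IsRoot (comb b e))
    (hp : Present c ∧ Present d ∧ Present e)
    (hcomm : ∀ i, Commute (xr (comb b c) (1 : F i))
      ⁅xr (comb b d) (1 : F i), xr (comb b e) (1 : F i)⁆) (t₀ t₁ : Fin 3 → S) :
    Commute (rootLetter F π b x c (linProd t₀ t₁ c))
      ⁅rootLetter F π b x d (linProd t₀ t₁ d), rootLetter F π b x e (linProd t₀ t₁ e)⁆ := by
  have hd := degHom_rootLetter (F := F) (π := π) h hr.2.1 hp.2.1 rfl
  have he := degHom_rootLetter (F := F) (π := π) h hr.2.2 hp.2.2 rfl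
  have e := prod_lift_eq (F := F) (π := π) h
    (s := [(c, 1, 1), (d, 1, 1), (e, 1, 1), (d, -1, -1), (e, -1, -1)])
    (s' := [(d, 1, 1), (e, 1, 1), (d, -1, -1), (e, -1, -1), (c, 1, 1)])
    (by simp [hr, hp]) (fun i => ?_) t₀ t₁
  · simpa [commutatorElement_def, mul_assoc, hd.neg, he.neg, Commute, SemiconjBy] using e
  · simpa [commutatorElement_def, mul_assoc, xr_neg] using (hcomm i).eq

include h in
theorem lift_AB_comm : Commute
    (rootLetter F π baseLg x ![1, 1, 0] (lin a₀ a₁ * lin b₀ b₁))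
    ⁅rootLetter F π baseLg x ![1, 0, 0] (lin a₀ a₁),
      rootLetter F π baseLg x ![0, 1, 2] (lin b₀ b₁ * lin c₀ c₁ ^ 2)⁆ := by
  simpa only [linProd_vec, pow_zero, pow_one, mul_one, one_mul] using
    commute_commutator_lift (F := F) (π := π) h (c := ![1, 1, 0]) (d := ![1, 0, 0])
      (e := ![0, 1, 2]) (by decide) (by decide) (fun i => commute_xLg_AB_comm 1 1 1)
      ![a₀, b₀, c₀] ![a₁, b₁, c₁]

include h in
theorem lift_BP_comm : Commute
    (rootLetter F π baseLg x ![0, 1, 1] (lin b₀ b₁ * lin c₀ c₁))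
    ⁅rootLetter F π baseLg x ![1, 0, 0] (lin a₀ a₁),
      rootLetter F π baseLg x ![0, 1, 2] (lin b₀ b₁ * lin c₀ c₁ ^ 2)⁆ := by
  simpa only [linProd_vec, pow_zero, pow_one, mul_one, one_mul] using
    commute_commutator_lift (F := F) (π := π) h (c := ![0, 1, 1]) (d := ![1, 0, 0])
      (e := ![0, 1, 2]) (by decide) (by decide) (fun i => commute_xLg_BP_comm 1 1 1)
      ![a₀, b₀, c₀] ![a₁, b₁, c₁]

end LargeLifts

theorem two_ne_zero_of_algebra (h2 : ∀ i, (2 : F i) ≠ 0) (i : ι) : (2 : K i) ≠ 0 := by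
  rw [← map_ofNat (algebraMap (F i) (K i)) 2]
  exact (_root_.map_ne_zero _).2 (h2 i)

variable (π x) in
/-- The present root elements of the large link. -/
noncomputable def largeLink (h2 : ∀ i, (2 : F i) ≠ 0) {κ : S} (hκ : 2 * κ = 1) :
    LargeLink S (allowedFamily F K baseLg x).Grp where
  toRankTwo := rankTwo (F := F) (π := π) (presentMem_baseLg (x := x) (two_ne_zero_of_algebra h2))
    hκ (cB := ![0, 1, 0]) (cP := ![0, 0, 1]) (cBP := ![0, 1, 1]) (cQ := ![0, 1, 2]) (j := 0)
    (by decide) (by decide) (by decide) (by decide) (by decide) (by decide) (by decide)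
  A := rootLetter F π baseLg x ![1, 0, 0]
  AB := rootLetter F π baseLg x ![1, 1, 0]
  hA := degHom_rootLetter (presentMem_baseLg (two_ne_zero_of_algebra h2)) (by decide) (by decide)
    (by decide)
  hAB := degHom_rootLetter (presentMem_baseLg (two_ne_zero_of_algebra h2)) (by decide) (by decide)
    (by decide)
  A_B f g hf hg := by
    change ⁅_, rootLetter F π baseLg x ![0, 1, 0] g⁆ = _
    simpa using commutator_rootLetter (F := F) (π := π)
      (presentMem_baseLg (x := x) (two_ne_zero_of_algebra h2)) (c := ![1, 0, 0])
      (d := ![0, 1, 0]) (l := [(![1, 1, 0], 1, 1, 1)]) (by decide) (by decide) (by decide)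
      (by decide) (j := 2) rfl rfl hf hg
  A_P := commute_rootLetter (presentMem_baseLg (two_ne_zero_of_algebra h2)) (by decide)
    (by decide) (by decide) (by decide) (j := 1) rfl rfl
  A_AB := commute_rootLetter (presentMem_baseLg (two_ne_zero_of_algebra h2)) (by decide)
    (by decide) (by decide) (by decide) (j := 2) rfl rfl
  B_AB := commute_rootLetter (presentMem_baseLg (two_ne_zero_of_algebra h2)) (by decide)
    (by decide) (by decide) (by decide) (j := 2) rfl rfl
  lift_AB_BP a₀ a₁ b₀ b₁ c₀ c₁ := by
    have h := commute_lift (F := F) (π := π)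
      (presentMem_baseLg (x := x) (two_ne_zero_of_algebra h2)) (c := ![1, 1, 0])
      (d := ![0, 1, 1]) (by decide) (by decide) (by decide) (by decide)
      (fun i => commute_xLg_AB_BP 1 1) ![a₀, b₀, c₀] ![a₁, b₁, c₁]
    simp only [linProd_vec, pow_zero, pow_one, mul_one, one_mul] at h
    exact h
  lift_short := lift_short (presentMem_baseLg (two_ne_zero_of_algebra h2)) h2 hκ
  lift_short_P := lift_short_P (presentMem_baseLg (two_ne_zero_of_algebra h2)) h2 hκ
  lift_Q_conj_BP := lift_Q_conj_BP (presentMem_baseLg (two_ne_zero_of_algebra h2))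
  lift_AB_comm := lift_AB_comm (presentMem_baseLg (two_ne_zero_of_algebra h2))
  lift_BP_comm := lift_BP_comm (presentMem_baseLg (two_ne_zero_of_algebra h2))

end Links

/-! ### All commutator relations of the unipotent groups -/

section SteinbergSystem

variable {S : Type*} [CommRing S] {Γ : Type*} [Group Γ] {b : Fin 3 → Vec}
  {Y : (Fin 3 → ℕ) → S[X] → Γ} {c d e e' : Fin 3 → ℕ}

variable (b Y) in
/-- The commutator relation between the root elements with coefficients `c` and `d`, for
arguments of degree at most the heights of the roots. -/
def CommRel (c d : Fin 3 → ℕ) : Prop := ∀ f g : S[X], f.natDegree ≤ ht c → g.natDegree ≤ ht d →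
  ⁅Y c f, Y d g⁆ = ((commTerms b c d).map fun e =>
    Y e.1 ((e.2.1 : S[X]) * (f ^ e.2.2.1 * g ^ e.2.2.2))).prod

variable (b Y) in
/-- The commutator relations in both orders. -/
def CommRels (c d : Fin 3 → ℕ) : Prop := CommRel b Y c d ∧ CommRel b Y d c

theorem CommRels.symm (h : CommRels b Y c d) : CommRels b Y d c := And.symm h

theorem CommRels.of_commute {Yc Yd : S[X] → Γ} (hc : Y c = Yc) (hd : Y d = Yd)
    (hcd : commTerms b c d = []) (hdc : commTerms b d c = [])
    (h : ∀ f g, Commute (Yc f) (Yd g)) : CommRels b Y c d := by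
  subst hc hd
  constructor <;> intro f g _ _
  · rw [hcd, commutator_eq_one (h f g)]; rfl
  · rw [hdc, commutator_eq_one (h g f).symm]; rfl

theorem CommRels.of_one {Yc Yd Ye : S[X] → Γ} (hc : Y c = Yc) (hd : Y d = Yd) (he : Y e = Ye)
    {k : ℤ} (hcd : commTerms b c d = [(e, k, 1, 1)]) (hdc : commTerms b d c = [(e, -k, 1, 1)])
    {n : ℕ} (hY : DegHom n Ye)
    (h : ∀ f g : S[X], f.natDegree ≤ ht c → g.natDegree ≤ ht d →
      ⁅Yc f, Yd g⁆ = Ye (k * (f * g))) : CommRels b Y c d := by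
  subst hc hd he
  constructor <;> intro f g hf hg
  · simp [hcd, h f g hf hg]
  · rw [← commutatorElement_inv, h g f hg hf, ← hY.neg, hdc]
    simp [mul_comm f g]

theorem CommRels.of_two {Yc Yd Ye Ye' : S[X] → Γ} (hc : Y c = Yc) (hd : Y d = Yd)
    (he : Y e = Ye) (he' : Y e' = Ye')
    (hcd : commTerms b c d = [(e, 1, 1, 1), (e', 1, 1, 2)])
    (hdc : commTerms b d c = [(e, -1, 1, 1), (e', -1, 2, 1)]) {m n : ℕ} (hY : DegHom m Ye)
    (hY' : DegHom n Ye') (hcomm : ∀ f g, Commute (Ye f) (Ye' g))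
    (h : ∀ f g : S[X], f.natDegree ≤ ht c → g.natDegree ≤ ht d →
      ⁅Yc f, Yd g⁆ = Ye (f * g) * Ye' (f * g ^ 2)) : CommRels b Y c d := by
  subst hc hd he he'
  constructor <;> intro f g hf hg
  · simp [hcd, h f g hf hg]
  · rw [← commutatorElement_inv, h g f hg hf, (hcomm _ _).eq, mul_inv_rev, ← hY.neg, ← hY'.neg,
      hdc]
    simp [mul_comm]

/-- Relations between all pairs of a list, from those between an element and itself or a later
one. -/
theorem commRels_of_pairwise {l : List (Fin 3 → ℕ)} (h : l.Pairwise (CommRels b Y))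
    (h' : ∀ c ∈ l, CommRels b Y c c) {c d : Fin 3 → ℕ} (hc : c ∈ l) (hd : d ∈ l) :
    CommRel b Y c d :=
  have : Std.Symm (CommRels b Y) := ⟨fun _ _ => CommRels.symm⟩
  (List.Pairwise.forall_of_forall h' h hc hd).1

end SteinbergSystem

namespace SmallLink

variable {S : Type*} [CommRing S] {Γ : Type*} [Group Γ] (L : SmallLink S Γ)

/-- The root elements of the small link by coefficients, `T` being those of `β + ψ + ω`. -/
def family (T : S[X] → Γ) (c : Fin 3 → ℕ) : S[X] → Γ :=
  if c = ![1, 0, 0] then L.B else if c = ![0, 1, 0] then L.P else if c = ![0, 0, 1] then L.W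
  else if c = ![1, 1, 0] then L.BP else if c = ![1, 2, 0] then L.Q
  else if c = ![0, 1, 1] then L.PW else T

/-- The commutator relations that determine the root elements `T` of `β + ψ + ω`. -/
structure IsT (T : S[X] → Γ) : Prop where
  hT : DegHom 3 T
  central : ∀ f, L.IsCentral (T f)
  B_PW : ∀ a g, a.natDegree ≤ 1 → g.natDegree ≤ 2 → ⁅L.B a, L.PW g⁆ = T (a * g)
  BP_W : ∀ g c, g.natDegree ≤ 2 → c.natDegree ≤ 1 → ⁅L.BP g, L.W c⁆ = T (2 * (g * c))

theorem exists_T : ∃ T, L.IsT T :=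
  let ⟨T, h₁, h₂, h₃, h₄⟩ := L.exists_completion
  ⟨T, h₁, h₂, h₃, h₄⟩

variable {L} {T : S[X] → Γ} (hT : L.IsT T)

theorem family_B : L.family T ![1, 0, 0] = L.B := if_pos rfl
theorem family_P : L.family T ![0, 1, 0] = L.P := by simp [family]
theorem family_W : L.family T ![0, 0, 1] = L.W := by simp [family]
theorem family_BP : L.family T ![1, 1, 0] = L.BP := by simp [family]
theorem family_Q : L.family T ![1, 2, 0] = L.Q := by simp [family]
theorem family_PW : L.family T ![0, 1, 1] = L.PW := by simp [family]
theorem family_T : L.family T ![1, 1, 1] = T := by simp [family]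

include hT in
theorem IsT.degHom_family {c : Fin 3 → ℕ} (hc : IsRoot (comb baseSm c)) :
    DegHom (ht c) (L.family T c) := by
  have hmem := mem_of_isRoot_comb_baseSm hc
  simp only [List.mem_cons, List.not_mem_nil, or_false] at hmem
  rcases hmem with rfl | rfl | rfl | rfl | rfl | rfl | rfl
  · rw [family_B]; exact L.hB
  · rw [family_P]; exact L.hP
  · rw [family_W]; exact L.hW
  · rw [family_BP]; exact L.hBP
  · rw [family_Q]; exact L.hQ
  · rw [family_PW]; exact L.hPW
  · rw [family_T]; exact hT.hT

include hT in
theorem IsT.commRel {c d : Fin 3 → ℕ} (hc : IsRoot (comb baseSm c))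
    (hd : IsRoot (comb baseSm d)) : CommRel baseSm (L.family T) c d := by
  refine commRels_of_pairwise ?_ ?_ (mem_of_isRoot_comb_baseSm hc) (mem_of_isRoot_comb_baseSm hd)
  · simp only [List.pairwise_cons, List.forall_mem_cons, List.not_mem_nil, IsEmpty.forall_iff,
      implies_true, and_true, List.Pairwise.nil]
    have hB := family_B (L := L) (T := T)
    have hP := family_P (L := L) (T := T)
    have hW := family_W (L := L) (T := T)
    have hBP := family_BP (L := L) (T := T)
    have hQ := family_Q (L := L) (T := T)
    have hPW := family_PW (L := L) (T := T)
    have hT' := family_T (L := L) (T := T)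
    refine ⟨⟨?BP, ?BW, ?BBP, ?BQ, ?BPW, ?BT⟩, ⟨?PW, ?PBP, ?PQ, ?PPW, ?PT⟩, ⟨?WBP, ?WQ, ?WPW, ?WT⟩,
      ⟨?BPQ, ?BPPW, ?BPT⟩, ⟨?QPW, ?QT⟩, ?PWT⟩
    case BP =>
      exact .of_two hB hP hBP hQ (by decide) (by decide) L.hBP L.hQ L.BP_Q L.B_P
    case BW => exact .of_commute hB hW (by decide) (by decide) L.B_W
    case BBP => exact .of_commute hB hBP (by decide) (by decide) L.B_BP
    case BQ => exact .of_commute hB hQ (by decide) (by decide) L.B_Q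
    case BPW =>
      exact .of_one (k := 1) hB hPW hT' (by decide) (by decide) hT.hT fun f g hf hg => by
        simpa using hT.B_PW f g hf hg
    case BT => exact .of_commute hB hT' (by decide) (by decide) fun f g => ((hT.central g).B f).symm
    case PW =>
      exact .of_one (k := 2) hP hW hPW (by decide) (by decide) L.hPW fun f g hf hg => by
        simpa using L.P_W f g hf hg
    case PBP =>
      exact .symm <| .of_one (k := -2) hBP hP hQ (by decide) (by decide) L.hQ fun f g hf hg => by
        simpa using L.BP_P f g hf hg
    case PQ => exact .of_commute hP hQ (by decide) (by decide) L.P_Q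
    case PPW => exact .of_commute hP hPW (by decide) (by decide) L.P_PW
    case PT => exact .of_commute hP hT' (by decide) (by decide) fun f g => ((hT.central g).P f).symm
    case WBP =>
      exact .symm <| .of_one (k := 2) hBP hW hT' (by decide) (by decide) hT.hT fun f g hf hg => by
        simpa using hT.BP_W f g hf hg
    case WQ => exact .symm <| .of_commute hQ hW (by decide) (by decide) L.Q_W
    case WPW => exact .of_commute hW hPW (by decide) (by decide) L.W_PW
    case WT => exact .of_commute hW hT' (by decide) (by decide) fun f g => ((hT.central g).W f).symm
    case BPQ => exact .of_commute hBP hQ (by decide) (by decide) L.BP_Q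
    case BPPW => exact .of_commute hBP hPW (by decide) (by decide) L.BP_PW
    case BPT =>
      exact .of_commute hBP hT' (by decide) (by decide) fun f g => ((hT.central g).BP f).symm
    case QPW => exact .of_commute hQ hPW (by decide) (by decide) L.Q_PW
    case QT => exact .of_commute hQ hT' (by decide) (by decide) fun f g => ((hT.central g).Q f).symm
    case PWT =>
      exact .of_commute hPW hT' (by decide) (by decide) fun f g => ((hT.central g).PW f).symm
  · simp only [List.forall_mem_cons, List.not_mem_nil, IsEmpty.forall_iff, implies_true, and_true]
    refine ⟨?_, ?_, ?_, ?_, ?_, ?_, ?_⟩ <;>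
      exact .of_commute rfl rfl (by decide) (by decide) (hT.degHom_family (by decide)).comm

end SmallLink

namespace LargeLink

variable {S : Type*} [CommRing S] {Γ : Type*} [Group Γ] (L : LargeLink S Γ)

/-- The root elements of the large link by coefficients, `T`, `D`, `E` being those of
`α + β + ψ`, `α + β + 2ψ`, `α + 2β + 2ψ`. -/
def family (T D E : S[X] → Γ) (c : Fin 3 → ℕ) : S[X] → Γ :=
  if c = ![1, 0, 0] then L.A else if c = ![0, 1, 0] then L.B else if c = ![0, 0, 1] then L.P
  else if c = ![1, 1, 0] then L.AB else if c = ![0, 1, 1] then L.BP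
  else if c = ![0, 1, 2] then L.Q else if c = ![1, 1, 1] then T
  else if c = ![1, 1, 2] then D else E

variable {L} {T D E : S[X] → Γ} (hD : L.IsD D) (hE : L.IsE D E) (hT : L.IsT D E T)

theorem family_A : L.family T D E ![1, 0, 0] = L.A := if_pos rfl
theorem family_B : L.family T D E ![0, 1, 0] = L.B := by simp [family]
theorem family_P : L.family T D E ![0, 0, 1] = L.P := by simp [family]
theorem family_AB : L.family T D E ![1, 1, 0] = L.AB := by simp [family]
theorem family_BP : L.family T D E ![0, 1, 1] = L.BP := by simp [family]
theorem family_Q : L.family T D E ![0, 1, 2] = L.Q := by simp [family]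
theorem family_T : L.family T D E ![1, 1, 1] = T := by simp [family]
theorem family_D : L.family T D E ![1, 1, 2] = D := by simp [family]
theorem family_E : L.family T D E ![1, 2, 2] = E := by simp [family]

include hD hE hT in
theorem degHom_family {c : Fin 3 → ℕ} (hc : IsRoot (comb baseLg c)) :
    DegHom (ht c) (L.family T D E c) := by
  have hmem := mem_of_isRoot_comb_baseLg hc
  simp only [List.mem_cons, List.not_mem_nil, or_false] at hmem
  rcases hmem with rfl | rfl | rfl | rfl | rfl | rfl | rfl | rfl | rfl
  · rw [family_A]; exact L.hA
  · rw [family_B]; exact L.hB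
  · rw [family_P]; exact L.hP
  · rw [family_AB]; exact L.hAB
  · rw [family_BP]; exact L.hBP
  · rw [family_Q]; exact L.hQ
  · rw [family_T]; exact hT.hT
  · rw [family_D]; exact hD.hD
  · rw [family_E]; exact hE.hE

include hD hE hT in
theorem commRel {c d : Fin 3 → ℕ} (hc : IsRoot (comb baseLg c))
    (hd : IsRoot (comb baseLg d)) : CommRel baseLg (L.family T D E) c d := by
  refine commRels_of_pairwise ?_ ?_ (mem_of_isRoot_comb_baseLg hc) (mem_of_isRoot_comb_baseLg hd)
  · simp only [List.pairwise_cons, List.forall_mem_cons, List.not_mem_nil, IsEmpty.forall_iff,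
      implies_true, and_true, List.Pairwise.nil]
    have hA := family_A (L := L) (T := T) (D := D) (E := E)
    have hB := family_B (L := L) (T := T) (D := D) (E := E)
    have hP := family_P (L := L) (T := T) (D := D) (E := E)
    have hAB := family_AB (L := L) (T := T) (D := D) (E := E)
    have hBP := family_BP (L := L) (T := T) (D := D) (E := E)
    have hQ := family_Q (L := L) (T := T) (D := D) (E := E)
    have hT' := family_T (L := L) (T := T) (D := D) (E := E)
    have hD' := family_D (L := L) (T := T) (D := D) (E := E)
    have hE' := family_E (L := L) (T := T) (D := D) (E := E)
    have cE := hE.central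
    refine ⟨⟨?AB, ?AP, ?AAB, ?ABP, ?AQ, ?AT, ?AD, ?AE⟩, ⟨?BP, ?BAB, ?BBP, ?BQ, ?BT, ?BD, ?BE⟩,
      ⟨?PAB, ?PBP, ?PQ, ?PT, ?PD, ?PE⟩, ⟨?ABBP, ?ABQ, ?ABT, ?ABD, ?ABE⟩, ⟨?BPQ, ?BPT, ?BPD, ?BPE⟩,
      ⟨?QT, ?QD, ?QE⟩, ⟨?TD, ?TE⟩, ?DE⟩
    case AB =>
      exact .of_one (k := 1) hA hB hAB (by decide) (by decide) L.hAB fun f g hf hg => by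
        simpa using L.A_B f g hf hg
    case AP => exact .of_commute hA hP (by decide) (by decide) L.A_P
    case AAB => exact .of_commute hA hAB (by decide) (by decide) L.A_AB
    case ABP =>
      exact .of_two hA hBP hT' hE' (by decide) (by decide) hT.hT hE.hE
        (fun f g => (hT.E_T g f).symm) hT.A_BP
    case AQ =>
      exact .of_one (k := 1) hA hQ hD' (by decide) (by decide) hD.hD fun f g hf hg => by
        simpa using hD.A_Q f g hf hg
    case AT => exact .of_commute hA hT' (by decide) (by decide) hT.A_T
    case AD => exact .of_commute hA hD' (by decide) (by decide) hD.A_D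
    case AE => exact .of_commute hA hE' (by decide) (by decide) fun f g => ((cE g).A f).symm
    case BP =>
      exact .of_two hB hP hBP hQ (by decide) (by decide) L.hBP L.hQ L.BP_Q L.B_P
    case BAB => exact .of_commute hB hAB (by decide) (by decide) L.B_AB
    case BBP => exact .of_commute hB hBP (by decide) (by decide) L.B_BP
    case BQ => exact .of_commute hB hQ (by decide) (by decide) L.B_Q
    case BT => exact .of_commute hB hT' (by decide) (by decide) hT.B_T
    case BD =>
      exact .of_one (k := 1) hB hD' hE' (by decide) (by decide) hE.hE fun f g hf hg => by
        simpa using hE.B_D f g hf hg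
    case BE => exact .of_commute hB hE' (by decide) (by decide) fun f g => ((cE g).B f).symm
    case PAB =>
      exact .symm <| .of_two hAB hP hT' hD' (by decide) (by decide) hT.hT hD.hD
        (fun f g => (hT.D_T g f).symm) hT.AB_P
    case PBP =>
      exact .symm <| .of_one (k := -2) hBP hP hQ (by decide) (by decide) L.hQ fun f g hf hg => by
        simpa using L.BP_P f g hf hg
    case PQ => exact .of_commute hP hQ (by decide) (by decide) L.P_Q
    case PT =>
      exact .symm <| .of_one (k := -2) hT' hP hD' (by decide) (by decide) hD.hD fun f g hf hg => by
        simpa using hT.T_P f g hf hg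
    case PD => exact .of_commute hP hD' (by decide) (by decide) hD.P_D
    case PE => exact .of_commute hP hE' (by decide) (by decide) fun f g => ((cE g).P f).symm
    case ABBP => exact .of_commute hAB hBP (by decide) (by decide) L.AB_BP
    case ABQ =>
      exact .of_one (k := -1) hAB hQ hE' (by decide) (by decide) hE.hE fun f g hf hg => by
        simpa using hE.AB_Q f g hf hg
    case ABT => exact .of_commute hAB hT' (by decide) (by decide) hT.AB_T
    case ABD => exact .of_commute hAB hD' (by decide) (by decide) hD.AB_D
    case ABE => exact .of_commute hAB hE' (by decide) (by decide) fun f g => ((cE g).AB f).symm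
    case BPQ => exact .of_commute hBP hQ (by decide) (by decide) L.BP_Q
    case BPT =>
      exact .symm <| .of_one (k := -2) hT' hBP hE' (by decide) (by decide) hE.hE
        fun f g hf hg => by simpa using hT.T_BP f g hf hg
    case BPD => exact .of_commute hBP hD' (by decide) (by decide) hD.BP_D
    case BPE => exact .of_commute hBP hE' (by decide) (by decide) fun f g => ((cE g).BP f).symm
    case QT => exact .of_commute hQ hT' (by decide) (by decide) hT.Q_T
    case QD => exact .of_commute hQ hD' (by decide) (by decide) hD.Q_D
    case QE => exact .of_commute hQ hE' (by decide) (by decide) fun f g => ((cE g).Q f).symm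
    case TD => exact .symm <| .of_commute hD' hT' (by decide) (by decide) hT.D_T
    case TE => exact .symm <| .of_commute hE' hT' (by decide) (by decide) hT.E_T
    case DE => exact .of_commute hD' hE' (by decide) (by decide) fun f g => ((cE g).D f).symm
  · simp only [List.forall_mem_cons, List.not_mem_nil, IsEmpty.forall_iff, implies_true, and_true]
    refine ⟨?_, ?_, ?_, ?_, ?_, ?_, ?_, ?_, ?_⟩ <;>
      exact .of_commute rfl rfl (by decide) (by decide) (degHom_family hD hE hT (by decide)).comm

end LargeLink

/-! ### Pure-degree relations -/

section Represents

variable {ι : Type*} {G : ι → Type*} [∀ i, Group (G i)] {𝓡 : RelatorFamily G}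

variable (𝓡) in
/-- A family of words in cancellable letters, the same number at every index, has the value `γ`
in the group of families of letters. -/
def RelatorFamily.Represents (w : ∀ i, List (G i)) (γ : 𝓡.Grp) : Prop :=
  ∃ l : List (∀ i, G i), (∀ g ∈ l, 𝓡.Cancellable g) ∧ (∀ i, w i = l.map fun g => g i) ∧
    (l.map 𝓡.letter).prod = γ

namespace RelatorFamily.Represents

variable {v w : ∀ i, List (G i)} {γ δ : 𝓡.Grp}

theorem nil : 𝓡.Represents (fun _ => []) 1 := ⟨[], by simp, by simp, rfl⟩

theorem letter {g : ∀ i, G i} (h : 𝓡.Cancellable g) :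
    𝓡.Represents (fun i => [g i]) (𝓡.letter g) := ⟨[g], by simpa using h, by simp, by simp⟩

theorem append (hv : 𝓡.Represents v γ) (hw : 𝓡.Represents w δ) :
    𝓡.Represents (fun i => v i ++ w i) (γ * δ) := by
  obtain ⟨l, h₁, h₂, rfl⟩ := hv
  obtain ⟨l', h₁', h₂', rfl⟩ := hw
  refine ⟨l ++ l', fun g hg => (List.mem_append.1 hg).elim (h₁ g) (h₁' g), fun i => ?_, by simp⟩
  simp only [h₂, h₂', List.map_append]

theorem inv (hv : 𝓡.Represents v γ) : 𝓡.Represents (fun i => winv (v i)) γ⁻¹ := by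
  obtain ⟨l, h₁, h₂, rfl⟩ := hv
  refine ⟨winv l, fun g hg => ?_, fun i => ?_, RelatorFamily.prod_letter_winv h₁⟩
  · obtain ⟨k, hk, rfl⟩ := List.mem_map.1 (List.mem_reverse.1 hg)
    exact (h₁ k hk).inv
  · simp [h₂, winv, Function.comp_def]

theorem commWord {g h : ∀ i, G i} (hg : 𝓡.Cancellable g) (hh : 𝓡.Cancellable h) :
    𝓡.Represents (fun i => commWord (g i) (h i)) ⁅𝓡.letter g, 𝓡.letter h⁆ := by
  have := ((letter hg).append (letter hh)).append ((letter hg.inv).append (letter hh.inv))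
  rw [letter_inv hg, letter_inv hh, ← mul_assoc, ← commutatorElement_def] at this
  exact this

theorem flatMap {T : Type*} {l : List T} {w : T → ∀ i, List (G i)} {γ : T → 𝓡.Grp}
    (h : ∀ e ∈ l, 𝓡.Represents (w e) (γ e)) :
    𝓡.Represents (fun i => l.flatMap fun e => w e i) (l.map γ).prod := by
  induction l with
  | nil => exact nil
  | cons e l ih =>
    simpa using (h e List.mem_cons_self).append (ih fun e he => h e (List.mem_cons_of_mem _ he))

theorem derivableWithin (h : 𝓡.Represents w 1)
    (h1 : ∀ᶠ n in Filter.atTop, ∀ i, [1] ∈ 𝓡.rel n i) :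
    ∀ᶠ n in Filter.atTop, ∀ i, DerivableWithin (𝓡.rel n i) n (w i) := by
  obtain ⟨l, h₁, h₂, h₃⟩ := h
  simpa only [h₂] using exists_derivableWithin h₁ h₃ h1

end RelatorFamily.Represents

end Represents

section PureDegree

variable {ι : Type*} {F K E : ι → Type*} [∀ i, Field (F i)] [∀ i, Field (K i)]
  [∀ i, Field (E i)] [∀ i, Algebra (F i) (K i)] [∀ i, Algebra (K i) (E i)]
  {S : Type*} [CommRing S] {π : ∀ i, S →+* K i} {b : Fin 3 → Vec} {x : ∀ i, E i}
  {al : ∀ i, (Fin 3 → ℕ) → K i → ℕ → List (Chev (E i))}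

variable (F π b x al) in
/-- The words of the pure-degree symbols have the values `Y`. -/
def SymbolsRepresent (Y : (Fin 3 → ℕ) → S[X] → (allowedFamily F K b x).Grp) : Prop :=
  ∀ c, IsRoot (comb b c) → ∀ (t : S) (k : ℕ), k ≤ ht c → (allowedFamily F K b x).Represents
    (fun i => symWord b (al i) (x i) c (π i t) k) (Y c (C t * X ^ k))

theorem eventually_one_mem : ∀ᶠ n in Filter.atTop, ∀ i, [1] ∈ (allowedFamily F K b x).rel n i := by
  filter_upwards [Filter.eventually_ge_atTop 1] with n hn i
  exact Or.inl ⟨by simpa using hn, ⟨0, by simp [one_mem]⟩, by simp⟩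

theorem commRhs_eq_flatMap {K E : Type*} [Field K] [Field E] [Algebra K E] (b : Fin 3 → Vec)
    (al : (Fin 3 → ℕ) → K → ℕ → List (Chev E)) (x : E) (c d : Fin 3 → ℕ) (t u : K) (k m : ℕ) :
    commRhs b al x c d t u k m = (commTerms b c d).flatMap fun e =>
      symWord b al x e.1 ((e.2.1 : K) * (t ^ e.2.2.1 * u ^ e.2.2.2))
        (e.2.2.1 * k + e.2.2.2 * m) := by
  rw [commRhs, commTerms, List.flatMap_map]
  induction pairs with
  | nil => rfl
  | cons ab l ih =>
    by_cases h : IsRoot (comb b (ab.1 • c + ab.2 • d))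
    · rw [List.flatMap_cons, if_pos h, ih, List.filter_cons, if_pos (decide_eq_true h),
        List.flatMap_cons]
    · rw [List.flatMap_cons, if_neg h, ih, List.filter_cons,
        if_neg (by simpa using h), List.nil_append]

theorem SymbolsRepresent.eventually_derivableWithin_linear
    {Y : (Fin 3 → ℕ) → S[X] → (allowedFamily F K b x).Grp} (hY : SymbolsRepresent F π b x al Y)
    (hdeg : ∀ c, IsRoot (comb b c) → DegHom (ht c) (Y c)) {c : Fin 3 → ℕ}
    (hc : IsRoot (comb b c)) (t u : S) {k : ℕ} (hk : k ≤ ht c) :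
    ∀ᶠ n in Filter.atTop, ∀ i, DerivableWithin (allowedRel (F i) (K i) b (x i) n) n
      (symWord b (al i) (x i) c (π i t) k ++ symWord b (al i) (x i) c (π i u) k ++
        winv (symWord b (al i) (x i) c (π i t + π i u) k)) := by
  have h := ((hY c hc t k hk).append (hY c hc u k hk)).append (hY c hc (t + u) k hk).inv
  rw [C_add, add_mul, (hdeg c hc).add, mul_inv_cancel] at h
  simp only [map_add] at h
  exact h.derivableWithin eventually_one_mem

/-- If the values of the pure-degree symbols satisfy the commutator relations, then all instances
of such a relation have derivations of uniformly bounded length. -/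
theorem SymbolsRepresent.eventually_derivableWithin_comm
    {Y : (Fin 3 → ℕ) → S[X] → (allowedFamily F K b x).Grp} (hY : SymbolsRepresent F π b x al Y)
    (hcomm : ∀ c d, IsRoot (comb b c) → IsRoot (comb b d) → CommRel b Y c d) {c d : Fin 3 → ℕ}
    (hc : IsRoot (comb b c)) (hd : IsRoot (comb b d)) (t u : S) {k m : ℕ} (hk : k ≤ ht c)
    (hm : m ≤ ht d) :
    ∀ᶠ n in Filter.atTop, ∀ i, DerivableWithin (allowedRel (F i) (K i) b (x i) n) n
      (symWord b (al i) (x i) c (π i t) k ++ symWord b (al i) (x i) d (π i u) m ++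
        winv (symWord b (al i) (x i) c (π i t) k) ++ winv (symWord b (al i) (x i) d (π i u) m) ++
        winv (commRhs b (al i) (x i) c d (π i t) (π i u) k m)) := by
  have hrhs : (allowedFamily F K b x).Represents
      (fun i => commRhs b (al i) (x i) c d (π i t) (π i u) k m)
      ⁅Y c (C t * X ^ k), Y d (C u * X ^ m)⁆ := by
    rw [hcomm c d hc hd _ _ ((natDegree_C_mul_X_pow_le _ _).trans hk)
      ((natDegree_C_mul_X_pow_le _ _).trans hm)]
    simp only [commRhs_eq_flatMap]
    refine .flatMap fun e he => ?_
    obtain ⟨e₁, e₂⟩ := mem_commTerms he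
    have h := hY e.1 e₂ ((e.2.1 : S) * (t ^ e.2.2.1 * u ^ e.2.2.2)) (e.2.2.1 * k + e.2.2.2 * m) (by
      rw [e₁, ht_smul_add_smul]; gcongr)
    have e' : (C ((e.2.1 : S) * (t ^ e.2.2.1 * u ^ e.2.2.2)) : S[X]) *
        X ^ (e.2.2.1 * k + e.2.2.2 * m) =
        (e.2.1 : S[X]) * ((C t * X ^ k) ^ e.2.2.1 * (C u * X ^ m) ^ e.2.2.2) := by
      simp only [C_mul, C_pow, C_eq_intCast]
      ring
    rw [e'] at h
    simpa using h
  have h := ((((hY c hc t k hk).append (hY d hd u m hm)).append (hY c hc t k hk).inv).append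
    (hY d hd u m hm).inv).append hrhs.inv
  rw [← commutatorElement_def, mul_inv_cancel] at h
  exact h.derivableWithin eventually_one_mem

theorem represents_pd (h : PresentMem K b x) {c : Fin 3 → ℕ} (hc : IsRoot (comb b c))
    (hp : Present c) (t : S) {k : ℕ} (hk : k ≤ ht c) : (allowedFamily F K b x).Represents
      (fun i => [pd b (x i) c (π i t) k]) (rootLetter F π b x c (C t * X ^ k)) := by
  have hd : (C t * X ^ k).natDegree ≤ ht c := (natDegree_C_mul_X_pow_le _ _).trans hk
  rw [rootLetter_of_natDegree_le hd]
  have := RelatorFamily.Represents.letter (cancellable_rootFam (F := F) (π := π) h hc hp hd)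
  simpa [rootFam, evalAt, pd] using this

theorem represents_commWord_pd (h : PresentMem K b x) {c d : Fin 3 → ℕ} (hc : IsRoot (comb b c))
    (hp : Present c) (hd : IsRoot (comb b d)) (hp' : Present d) (t u : S) {k m : ℕ}
    (hk : k ≤ ht c) (hm : m ≤ ht d) : (allowedFamily F K b x).Represents
      (fun i => commWord (pd b (x i) c (π i t) k) (pd b (x i) d (π i u) m))
      ⁅rootLetter F π b x c (C t * X ^ k), rootLetter F π b x d (C u * X ^ m)⁆ := by
  have h₁ : (C t * X ^ k).natDegree ≤ ht c := (natDegree_C_mul_X_pow_le _ _).trans hk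
  have h₂ : (C u * X ^ m).natDegree ≤ ht d := (natDegree_C_mul_X_pow_le _ _).trans hm
  rw [rootLetter_of_natDegree_le h₁, rootLetter_of_natDegree_le h₂]
  have := RelatorFamily.Represents.commWord (cancellable_rootFam (F := F) (π := π) h hc hp h₁)
    (cancellable_rootFam (F := F) (π := π) h hd hp' h₂)
  simpa [rootFam, evalAt, pd] using this

end PureDegree

section Symbols

variable {ι : Type*} {F K E : ι → Type*} [∀ i, Field (F i)] [∀ i, Field (K i)]
  [∀ i, Field (E i)] [∀ i, Algebra (F i) (K i)] [∀ i, Algebra (K i) (E i)]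
  {S : Type*} [CommRing S] {π : ∀ i, S →+* K i} {x : ∀ i, E i} {κ : S} (hκ : 2 * κ = 1)

theorem smallLink_family (h2 : ∀ i, (2 : K i) ≠ 0) (T : S[X] → (allowedFamily F K baseSm x).Grp)
    {c : Fin 3 → ℕ} (hc : IsRoot (comb baseSm c)) (hp : Present c) :
    (smallLink F π x h2 hκ).family T c = rootLetter F π baseSm x c := by
  have hmem := mem_of_isRoot_comb_baseSm hc
  simp only [List.mem_cons, List.not_mem_nil, or_false] at hmem
  rcases hmem with rfl | rfl | rfl | rfl | rfl | rfl | rfl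
  exacts [SmallLink.family_B, SmallLink.family_P, SmallLink.family_W, SmallLink.family_BP,
    SmallLink.family_Q, SmallLink.family_PW, absurd hp (by decide)]

theorem symbolsRepresent_small (h2 : ∀ i, (2 : K i) ≠ 0)
    {T : S[X] → (allowedFamily F K baseSm x).Grp} (hT : (smallLink F π x h2 hκ).IsT T) :
    SymbolsRepresent F π baseSm x (fun i => aliasSm (x i)) ((smallLink F π x h2 hκ).family T) := by
  intro c hc t k hk
  by_cases hp : Present c
  · simp only [symWord, if_pos hp, smallLink_family hκ h2 T hc hp]
    exact represents_pd (presentMem_baseSm h2) hc hp t hk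
  have hmem := mem_of_isRoot_comb_baseSm hc
  obtain rfl : c = ![1, 1, 1] := by
    simp only [List.mem_cons, List.not_mem_nil, or_false] at hmem
    rcases hmem with rfl | rfl | rfl | rfl | rfl | rfl | rfl <;>
      first | rfl | exact absurd (by decide) hp
  have hk' : k ≤ 3 := hk
  have h := represents_commWord_pd (F := F) (π := π) (presentMem_baseSm (x := x) h2)
    (c := ![1, 0, 0]) (d := ![0, 1, 1]) (by decide) (by decide) (by decide) (by decide) t 1
    (k := min k 1) (m := k - min k 1) (min_le_right _ _) (show k - min k 1 ≤ 2 by omega)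
  have e := hT.B_PW (C t * X ^ min k 1) (C 1 * X ^ (k - min k 1))
    ((natDegree_C_mul_X_pow_le _ _).trans (min_le_right _ _))
    ((natDegree_C_mul_X_pow_le _ _).trans (by omega))
  have e' : C t * X ^ min k 1 * (C 1 * X ^ (k - min k 1)) = C t * X ^ k := by
    rw [C_1, one_mul, mul_assoc, ← pow_add, Nat.add_sub_cancel' (min_le_left _ _)]
  rw [e'] at e
  simp only [symWord, if_neg hp, SmallLink.family_T, aliasSm]
  rw [← e]
  simp only [map_one (π _)] at h
  exact h

theorem largeLink_family (h2 : ∀ i, (2 : F i) ≠ 0)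
    (T D E' : S[X] → (allowedFamily F K baseLg x).Grp) {c : Fin 3 → ℕ}
    (hc : IsRoot (comb baseLg c)) (hp : Present c) :
    (largeLink π x h2 hκ).family T D E' c = rootLetter F π baseLg x c := by
  have hmem := mem_of_isRoot_comb_baseLg hc
  simp only [List.mem_cons, List.not_mem_nil, or_false] at hmem
  rcases hmem with rfl | rfl | rfl | rfl | rfl | rfl | rfl | rfl | rfl
  exacts [LargeLink.family_A, LargeLink.family_B, LargeLink.family_P, LargeLink.family_AB,
    LargeLink.family_BP, LargeLink.family_Q, absurd hp (by decide), absurd hp (by decide),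
    absurd hp (by decide)]

theorem mul_X_pow_of_add {S : Type*} [CommRing S] (t u : S) {k k₁ k₂ : ℕ} (h : k₁ + k₂ = k) :
    C t * X ^ k₁ * (C u * X ^ k₂) = C (t * u) * X ^ k := by
  rw [← h, pow_add, C_mul]; ring

theorem aliasLg_T {K E : Type*} [Field K] [Field E] [Algebra K E] (x : E) (t : K) (k : ℕ) :
    aliasLg x ![1, 1, 1] t k =
      [pd baseLg x ![0, 1, 1] (-(1 / 2) : K) (k - min k 1), pd baseLg x ![1, 0, 0] t (min k 1),
       pd baseLg x ![0, 1, 1] (1 : K) (k - min k 1), pd baseLg x ![1, 0, 0] (-t) (min k 1),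
       pd baseLg x ![0, 1, 1] (-(1 / 2) : K) (k - min k 1)] :=
  if_pos rfl

theorem aliasLg_D {K E : Type*} [Field K] [Field E] [Algebra K E] (x : E) (t : K) (k : ℕ) :
    aliasLg x ![1, 1, 2] t k = commWord (pd baseLg x ![1, 0, 0] t (min k 1))
      (pd baseLg x ![0, 1, 2] (1 : K) (k - min k 1)) := by
  rw [aliasLg, if_neg (by decide), if_pos rfl]

theorem aliasLg_E {K E : Type*} [Field K] [Field E] [Algebra K E] (x : E) (t : K) (k : ℕ) :
    aliasLg x ![1, 2, 2] t k = commWord (pd baseLg x ![1, 1, 0] t (min k 2))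
      (pd baseLg x ![0, 1, 2] (-1 : K) (k - min k 2)) := by
  rw [aliasLg, if_neg (by decide), if_neg (by decide)]

theorem symbolsRepresent_large (h2 : ∀ i, (2 : F i) ≠ 0)
    {T D E' : S[X] → (allowedFamily F K baseLg x).Grp} (hD : (largeLink π x h2 hκ).IsD D)
    (hE : (largeLink π x h2 hκ).IsE D E') (hT : (largeLink π x h2 hκ).IsT D E' T) :
    SymbolsRepresent F π baseLg x (fun i => aliasLg (x i))
      ((largeLink π x h2 hκ).family T D E') := by
  intro c hc t k hk
  have hM := presentMem_baseLg (x := x) (two_ne_zero_of_algebra (K := K) h2)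
  by_cases hp : Present c
  · simp only [symWord, if_pos hp, largeLink_family hκ h2 T D E' hc hp]
    exact represents_pd hM hc hp t hk
  have hmem := mem_of_isRoot_comb_baseLg hc
  have hc' : c = ![1, 1, 1] ∨ c = ![1, 1, 2] ∨ c = ![1, 2, 2] := by
    simp only [List.mem_cons, List.not_mem_nil, or_false] at hmem
    rcases hmem with rfl | rfl | rfl | rfl | rfl | rfl | h <;>
      first | exact h | exact absurd (by decide) hp
  have deg {s : S} {n m : ℕ} (h : n ≤ m) : (C s * X ^ n).natDegree ≤ m :=
    (natDegree_C_mul_X_pow_le _ _).trans h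
  simp only [symWord, if_neg hp]
  rcases hc' with rfl | rfl | rfl
  · have hk' : k ≤ 3 := hk
    have h₁ : min k 1 ≤ 1 := min_le_right _ _
    have h₂ : k - min k 1 ≤ 2 := by omega
    have hA (s : S) := represents_pd (F := F) (π := π) hM (c := ![1, 0, 0]) (by decide)
      (by decide) s h₁
    have hBP (s : S) := represents_pd (F := F) (π := π) hM (c := ![0, 1, 1]) (by decide)
      (by decide) s h₂
    have h := (((hBP (-κ)).append (hA t)).append ((hBP 1).append (hA (-t)))).append (hBP (-κ))
    have e := hT.short_eq _ _ (deg (s := t) h₁) (deg (s := 1) h₂)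
    rw [mul_X_pow_of_add _ _ (Nat.add_sub_cancel' (min_le_left k 1)), mul_one] at e
    have hκ' (i) : π i (-κ) = -(1 / 2) := by
      rw [map_neg, map_half (π := π) h2 hκ, one_div, map_inv₀,
        map_ofNat (algebraMap (F i) (K i)) 2]
    have e₁ : C (-κ) * X ^ (k - min k 1) = -(C κ * (C 1 * X ^ (k - min k 1))) := by
      rw [C_neg, C_1, one_mul, neg_mul]
    have e₂ : C (-t) * X ^ min k 1 = -(C t * X ^ min k 1) := by rw [C_neg, neg_mul]
    simp only [hκ', map_one (π _), map_neg (π _) t, e₁, e₂, List.cons_append, List.nil_append] at h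
    simp only [aliasLg_T, LargeLink.family_T]
    rw [← e, LargeLink.short]
    simp only [mul_assoc] at h ⊢
    exact h
  · have hk' : k ≤ 4 := hk
    have h₁ : min k 1 ≤ 1 := min_le_right _ _
    have h₂ : k - min k 1 ≤ 3 := by omega
    have h := represents_commWord_pd (F := F) (π := π) hM (c := ![1, 0, 0]) (d := ![0, 1, 2])
      (by decide) (by decide) (by decide) (by decide) t 1 h₁ h₂
    have e := hD.A_Q _ _ (deg (s := t) h₁) (deg (s := 1) h₂)
    rw [mul_X_pow_of_add _ _ (Nat.add_sub_cancel' (min_le_left k 1)), mul_one] at e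
    simp only [aliasLg_D, LargeLink.family_D]
    rw [← e]
    simp only [map_one (π _)] at h
    exact h
  · have hk' : k ≤ 5 := hk
    have h₁ : min k 2 ≤ 2 := min_le_right _ _
    have h₂ : k - min k 2 ≤ 3 := by omega
    have h := represents_commWord_pd (F := F) (π := π) hM (c := ![1, 1, 0]) (d := ![0, 1, 2])
      (by decide) (by decide) (by decide) (by decide) t (-1) h₁ h₂
    have e := hE.AB_Q _ _ (deg (s := t) h₁) (deg (s := -1) h₂)
    rw [mul_X_pow_of_add _ _ (Nat.add_sub_cancel' (min_le_left k 2)), ← neg_mul, ← C_neg,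
      mul_neg_one, neg_neg] at e
    simp only [aliasLg_E, LargeLink.family_E]
    rw [← e]
    simp only [map_neg (π _), map_one (π _)] at h
    exact h

end Symbols

/-! ### Uniformity in the fields -/

section Uniformity

theorem finite_roots_baseSm : {c | IsRoot (comb baseSm c)}.Finite :=
  (List.finite_toSet _).subset fun _ hc => mem_of_isRoot_comb_baseSm hc

theorem finite_roots_baseLg : {c | IsRoot (comb baseLg c)}.Finite :=
  (List.finite_toSet _).subset fun _ hc => mem_of_isRoot_comb_baseLg hc

theorem SymbolsRepresent.eventually_derivableWithin {ι : Type*} {F K E : ι → Type*}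
    [∀ i, Field (F i)] [∀ i, Field (K i)] [∀ i, Field (E i)] [∀ i, Algebra (F i) (K i)]
    [∀ i, Algebra (K i) (E i)] {S : Type*} [CommRing S] {π : ∀ i, S →+* K i} {b : Fin 3 → Vec}
    {x : ∀ i, E i} {al : ∀ i, (Fin 3 → ℕ) → K i → ℕ → List (Chev (E i))}
    {Y : (Fin 3 → ℕ) → S[X] → (allowedFamily F K b x).Grp} (hY : SymbolsRepresent F π b x al Y)
    (hfin : {c | IsRoot (comb b c)}.Finite)
    (hdeg : ∀ c, IsRoot (comb b c) → DegHom (ht c) (Y c))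
    (hcomm : ∀ c d, IsRoot (comb b c) → IsRoot (comb b d) → CommRel b Y c d) (t u : S) :
    ∀ᶠ n in Filter.atTop, ∀ c ∈ {c | IsRoot (comb b c)}, ∀ k ∈ Set.Iic (ht c),
      (∀ i, DerivableWithin (allowedRel (F i) (K i) b (x i) n) n
        (symWord b (al i) (x i) c (π i t) k ++ symWord b (al i) (x i) c (π i u) k ++
          winv (symWord b (al i) (x i) c (π i t + π i u) k))) ∧
      ∀ d ∈ {c | IsRoot (comb b c)}, ∀ m ∈ Set.Iic (ht d), ∀ i,
        DerivableWithin (allowedRel (F i) (K i) b (x i) n) n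
          (symWord b (al i) (x i) c (π i t) k ++ symWord b (al i) (x i) d (π i u) m ++
            winv (symWord b (al i) (x i) c (π i t) k) ++
            winv (symWord b (al i) (x i) d (π i u) m) ++
            winv (commRhs b (al i) (x i) c d (π i t) (π i u) k m)) := by
  rw [Filter.eventually_all_finite hfin]
  intro c hc
  rw [Filter.eventually_all_finite (Set.finite_Iic _)]
  intro k hk
  refine (hY.eventually_derivableWithin_linear hdeg hc t u hk).and ?_
  rw [Filter.eventually_all_finite hfin]
  intro d hd
  rw [Filter.eventually_all_finite (Set.finite_Iic _)]
  exact fun m hm => hY.eventually_derivableWithin_comm hcomm hc hd t u hk hm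

theorem oddScalars_pi {ι : Type*} {K : ι → Type*} [∀ i, Field (K i)] (h2 : ∀ i, (2 : K i) ≠ 0) :
    OddScalars (∀ i, K i) where
  exists_half := ⟨fun _ => 2⁻¹, funext fun i => mul_inv_cancel₀ (h2 i)⟩
  exists_units s := by
    classical
    -- Zero is `1 + (-1)`, and any other element is the sum of its halves.
    have h : ∀ i, ∃ s₁ s₂ v₁ v₂ : K i, s i = s₁ + s₂ ∧ s₁ * v₁ = 1 ∧ s₂ * v₂ = 1 := by
      intro i
      by_cases hs : s i = 0
      · exact ⟨1, -1, 1, -1, by simp [hs], by simp, by simp⟩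
      · have := h2 i
        exact ⟨s i / 2, s i / 2, 2 / s i, 2 / s i, by field_simp; ring, by field_simp,
          by field_simp⟩
    choose s₁ s₂ v₁ v₂ h using h
    exact ⟨s₁, s₂, v₁, v₂, funext fun i => (h i).1, funext fun i => (h i).2.1,
      funext fun i => (h i).2.2⟩

/-- Fields as in the definition of the unipotent groups, with base field of odd characteristic,
and the scalars of a pair of pure-degree symbols. -/
structure SymbolPair where
  F : Type
  K : Type
  E : Type
  [fieldF : Field F]
  [fieldK : Field K]
  [fieldE : Field E]
  [algebraK : Algebra F K]
  [algebraE : Algebra K E]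
  x : E
  t : K
  u : K
  two_ne_zero : (2 : F) ≠ 0

attribute [instance] SymbolPair.fieldF SymbolPair.fieldK SymbolPair.fieldE SymbolPair.algebraK
  SymbolPair.algebraE

theorem eventually_isSteinberg_small : ∀ᶠ n in Filter.atTop, ∀ (F K E : Type) [Field F] [Field K]
    [Field E] [Algebra F K] [Algebra K E] (x : E), (2 : F) ≠ 0 →
    ∀ w, IsSteinberg (K := K) baseSm (aliasSm x) x w →
      DerivableWithin (allowedRel F K baseSm x n) n w := by
  let π : ∀ i : SymbolPair, (∀ i : SymbolPair, i.K) →+* i.K := Pi.evalRingHom SymbolPair.K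
  have h2 (i : SymbolPair) : (2 : i.K) ≠ 0 := two_ne_zero_of_algebra SymbolPair.two_ne_zero i
  obtain ⟨κ, hκ⟩ := (oddScalars_pi h2).exists_half
  obtain ⟨T, hT⟩ := (smallLink SymbolPair.F π SymbolPair.x h2 hκ).exists_T
  filter_upwards [(symbolsRepresent_small hκ h2 hT).eventually_derivableWithin finite_roots_baseSm
    (fun c hc => hT.degHom_family hc) (fun c d hc hd => hT.commRel hc hd) SymbolPair.t
    SymbolPair.u] with n hn F K E _ _ _ _ _ x hF w hw
  rcases hw with ⟨c, hc, t, u, k, hk⟩ | ⟨c, d, hc, hd, t, u, k, m, hk, hm⟩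
  · exact (hn c hc k hk).1 ⟨F, K, E, x, t, u, hF⟩
  · exact (hn c hc k hk).2 d hd m hm ⟨F, K, E, x, t, u, hF⟩

theorem eventually_isSteinberg_large : ∀ᶠ n in Filter.atTop, ∀ (F K E : Type) [Field F] [Field K]
    [Field E] [Algebra F K] [Algebra K E] (x : E), (2 : F) ≠ 0 →
    ∀ w, IsSteinberg (K := K) baseLg (aliasLg x) x w →
      DerivableWithin (allowedRel F K baseLg x n) n w := by
  let π : ∀ i : SymbolPair, (∀ i : SymbolPair, i.K) →+* i.K := Pi.evalRingHom SymbolPair.K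
  have : OddScalars (∀ i : SymbolPair, i.K) :=
    oddScalars_pi (two_ne_zero_of_algebra SymbolPair.two_ne_zero)
  obtain ⟨κ, hκ⟩ := OddScalars.exists_half (S := ∀ i : SymbolPair, i.K)
  obtain ⟨D, hD⟩ := (largeLink π SymbolPair.x SymbolPair.two_ne_zero hκ).exists_D
  obtain ⟨E', hE⟩ := hD.exists_E
  obtain ⟨T, hT⟩ := hE.exists_T hD
  filter_upwards [(symbolsRepresent_large hκ SymbolPair.two_ne_zero hD hE
    hT).eventually_derivableWithin finite_roots_baseLg
    (fun c hc => LargeLink.degHom_family hD hE hT hc)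
    (fun c d hc hd => LargeLink.commRel hD hE hT hc hd) SymbolPair.t
    SymbolPair.u] with n hn F K E _ _ _ _ _ x hF w hw
  rcases hw with ⟨c, hc, t, u, k, hk⟩ | ⟨c, d, hc, hd, t, u, k, m, hk, hm⟩
  · exact (hn c hc k hk).1 ⟨F, K, E, x, t, u, hF⟩
  · exact (hn c hc k hk).2 d hd m hm ⟨F, K, E, x, t, u, hF⟩

theorem two_ne_zero_of_odd_natCard {F : Type*} [Field F] (h : Odd (Nat.card F)) : (2 : F) ≠ 0 := by
  intro h2
  have h₁ : addOrderOf (1 : F) ∣ 2 := addOrderOf_dvd_of_nsmul_eq_zero (by simpa using h2)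
  have h₂ : addOrderOf (1 : F) ∣ Nat.card F := addOrderOf_dvd_natCard 1
  have h₃ := Nat.Coprime.eq_one_of_dvd (h.coprime_two_left.coprime_dvd_left h₁) h₂
  exact one_ne_zero (AddMonoid.addOrderOf_eq_one_iff.1 h₃)

end Uniformity

end B3Lift

theorem mainTheorem4 :
    ∃ N M : ℕ, ∀ p k : ℕ, IsPrimePow p → Odd p → 1 ≤ k →
      ∀ (F K E : Type) [Field F] [Field K] [Field E] [Algebra F K] [Algebra K E] (x : E),
        Nat.card F = p → Nat.card K = p ^ k →
        IntermediateField.adjoin K {x} = ⊤ → 6 ≤ Module.finrank K E →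
        (∀ w, B3Lift.IsSteinberg (K := K) B3Lift.baseSm (B3Lift.aliasSm x) x w →
          B3Lift.DerivableWithin (B3Lift.allowedRel F K B3Lift.baseSm x M) N w) ∧
        (∀ w, B3Lift.IsSteinberg (K := K) B3Lift.baseLg (B3Lift.aliasLg x) x w →
          B3Lift.DerivableWithin (B3Lift.allowedRel F K B3Lift.baseLg x M) N w) := by
  obtain ⟨n, hn⟩ := (B3Lift.eventually_isSteinberg_small.and
    B3Lift.eventually_isSteinberg_large).exists
  refine ⟨n, n, fun p k _ hp _ F K E _ _ _ _ _ x hF _ _ _ => ?_⟩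
  have h2 : (2 : F) ≠ 0 := B3Lift.two_ne_zero_of_odd_natCard (hF ▸ hp)
  exact ⟨hn.1 F K E x h2, hn.2 F K E x h2⟩
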